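/- **Setting.** Fix $\hbar,c,g,\mu,a>0$ and an integer $N\ge 1$. *Plate operator and sources.* For $L>0$ let $L_B=-\Delta$ on $H=L^2(\mathbb T_L^2\times[0,a];\mathbb C)$, where $\mathbb T_L^2$ is the flat torus of side $L$, with Dirichlet conditions at $z=0$ and $z=a$. Let $(u_j)_{j\in\mathbb N}$ be any orthonormal basis of $H$ with $L_Bu_j=\lambda_ju_j$. For each channel $i=1,\dots,N$ let $\xi^{(i)}=\sum_j\xi^{(i)}_ju_j$ be a (real or complex) Gaussian white noise, i.e. $(\xi^{(i)}_j)_j$ is a centred Gaussian family with $\mathbb E[\xi^{(i)}_j\overline{\xi^{(i)}_k}]=\delta_{jk}$, the $N$ channels being independent. For $\tau>0$ set $$\sigma^{(i)}_\tau=(\hbar c/g)^{1/2}L_B^{3/4}e^{-\tau L_B/2}\xi^{(i)},\qquad U^{(N)}_\tau=\sum_{i=1}^N\tfrac12\big\langle\sigma^{(i)}_\tau,\,gL_B^{-1}\sigma^{(i)}_\tau\big\rangle .$$ *Reference cells.* For $\alpha>0$ let $D_\alpha=[0,\alpha]\times[0,\alpha^{-1}]\times[0,1]$, $$\Delta(\alpha)=\int_{D_\alpha}\!\int_{D_\alpha}\frac{dx\,dy}{|x-y|},\qquad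 \Delta_3(-1)=\int_{[0,1]^3}\!\int_{[0,1]^3}\frac{dx\,dy}{|x-y|}.$$ Let $\gamma>0$ and $Q$ satisfy $\mathcal Q:=\gamma Q^2=\hbar c$. The reference energy of $n^2$ cells $aD_\alpha$, carrying uniform densities $\pm Q/a^3$ that interact through the kernel $\gamma/|x-y|$, is $$U_\alpha(n,a)=n^2\int_{aD_\alpha}\!\int_{aD_\alpha}\frac{Q}{a^3}\,\frac{\gamma}{|x-y|}\Big(-\frac{Q}{a^3}\Big)dx\,dy .$$ *Comparison coefficient.* With $L=na$ (plate area $A=L^2=n^2a^2$; $n>0$ real) put $\Theta^{(N)}_{\alpha,\tau}=U^{(N)}_\tau/U_\alpha(n,a)$. The finite part $\operatorname{FP}_{\tau\to0^+}f(\tau)$ is the limit of $f(\tau)$ as $\tau\to0^+$ after subtraction of finitely many terms $a_\beta\tau^{-\beta}$ $(\beta>0)$ and of a term $a_{\log}\log(\mu^2\tau)$. Define $$\overline\Theta^{(N)}_\alpha=\lim_{L\to\infty}\ \operatorname{FP}_{\tau\to0^+}\ \mathbb E\big[\Theta^{(N)}_{\alpha,\tau}\big].$$ **Proposition (Aspect-ratio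 comparison coefficient and cubical minimum).** For all $\alpha,L,\tau>0$ the variable $\Theta^{(N)}_{\alpha,\tau}$ is integrable. For all $\alpha,L>0$ the finite part of $\mathbb E[\Theta^{(N)}_{\alpha,\tau}]$ exists, and it is the one given by the standard plate interaction-energy subtraction: it equals the limit as $\tau\to0^+$ of $$\mathbb E[\Theta^{(N)}_{\alpha,\tau}]-\frac{N\big(L^2a\,\varepsilon_{\rm bulk}(\tau)+2L^2\varepsilon_{\rm plate}(\tau)\big)}{U_\alpha(n,a)},$$ where $$\varepsilon_{\rm bulk}(\tau)=\frac{\hbar c}{2}\int_{\mathbb R^3}|k|e^{-\tau|k|^2}\frac{d^3k}{(2\pi)^3},\qquad \varepsilon_{\rm plate}(\tau)=-\frac14\,\frac{\hbar c}{2}\int_{\mathbb R^2}|k|e^{-\tau|k|^2}\frac{d^2k}{(2\pi)^2}$$ are the heat-regularized bulk energy density and the self-energy per unit area of one Dirichlet plate. For every $\alpha>0$ the limit $L\to\infty$ exists, and $$\overline\Theta^{(N)}_\alpha=\frac{N\pi^2}{1440\,\Delta(\alpha)} .$$ Consequently, for every $\alpha>0$, $$\overline\Theta^{(N)}_\alpha\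 \ge\ \overline\Theta^{(N)}_1=\frac{N\pi^2}{1440\,\Delta_3(-1)},$$ with equality if and only if $\alpha=1$. In particular, for $N=2$, $\overline\Theta^{(2)}_1=\dfrac{\pi^2}{720\,\Delta_3(-1)}$. -/

import Mathlib

namespace CasimirPlate

open MeasureTheory ProbabilityTheory Filter Topology
open scoped InnerProductSpace Pointwise

noncomputable section

/-- Three-dimensional Euclidean space. -/
abbrev E3 : Type := EuclideanSpace ℝ (Fin 3)

/-! ### The plate operator -/

/-- The region between the plates: a fundamental domain `[0,L]² × [0,a]` of `𝕋_L² × [0,a]`. -/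
def plateBox (L a : ℝ) : Set E3 :=
  {x | x 0 ∈ Set.Icc 0 L ∧ x 1 ∈ Set.Icc 0 L ∧ x 2 ∈ Set.Icc 0 a}

/-- The Hilbert space `L²(𝕋_L² × [0,a])`. -/
abbrev PlateSpace (L a : ℝ) : Type := Lp ℂ 2 (volume.restrict (plateBox L a))

/-- Smooth functions on `𝕋_L² × ℝ` (functions on `ℝ³` that are `L`-periodic in the two lateral
coordinates) satisfying the Dirichlet condition on the plates `z = 0` and `z = a`. -/
structure IsPlateTest (L a : ℝ) (φ : E3 → ℂ) : Prop where
  smooth : ContDiff ℝ (⊤ : ℕ∞) φ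
  periodic_zero : ∀ x, φ (x + EuclideanSpace.single 0 L) = φ x
  periodic_one : ∀ x, φ (x + EuclideanSpace.single 1 L) = φ x
  dirichlet_zero : ∀ x : E3, x 2 = 0 → φ x = 0
  dirichlet_a : ∀ x : E3, x 2 = a → φ x = 0

/-- `f ∈ Dom(L_B)` and `L_B f = h`, where `L_B = -Δ` on `𝕋_L² × [0,a]` with Dirichlet conditions on
the plates: `L_B` is the adjoint of the essentially self-adjoint operator `-Δ` with domain
the functions `IsPlateTest L a`. -/
def IsPlateLaplacian (L a : ℝ) (f h : PlateSpace L a) : Prop :=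
  ∀ φ : E3 → ℂ, IsPlateTest L a φ →
    ∫ x in plateBox L a, starRingEnd ℂ (-(Laplacian.laplacian φ x)) * f x =
      ∫ x in plateBox L a, starRingEnd ℂ (φ x) * h x

/-- An orthonormal basis of `L²(𝕋_L² × [0,a])` consisting of eigenvectors of `L_B`:
`L_B u_j = λ_j u_j`. -/
structure PlateEigenbasis (L a : ℝ) where
  u : HilbertBasis ℕ ℂ (PlateSpace L a)
  lam : ℕ → ℝ
  eigen : ∀ j, IsPlateLaplacian L a (u j) ((lam j : ℂ) • u j)

/-- The spectral multiplier `F(L_B)`, `v ↦ ∑ F(λ_j) ⟨u_j, v⟩ u_j`. -/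
def PlateEigenbasis.multiplier {L a : ℝ} (S : PlateEigenbasis L a) (F : ℝ → ℝ)
    (v : PlateSpace L a) : PlateSpace L a :=
  ∑' j, ((F (S.lam j) : ℂ) * ⟪S.u j, v⟫_ℂ) • S.u j

/-! ### Gaussian sources and the regulated energy -/

section Stochastic

variable {Ω : Type*} [MeasurableSpace Ω]

/-- The coefficients `ξ_j` of a (real or complex) Gaussian white noise `ξ = ∑ ξ_j u_j`: a centred
Gaussian family with `E[ξ_i conj ξ_j] = δ_ij`. -/
structure IsWhiteNoise (ξ : ℕ → Ω → ℂ) (P : Measure Ω) : Prop where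
  gaussian : IsGaussianProcess ξ P
  mean : ∀ j, ∫ ω, ξ j ω ∂P = 0
  cov : ∀ i j, ∫ ω, ξ i ω * starRingEnd ℂ (ξ j ω) ∂P = if i = j then 1 else 0

/-- `N` independent white noises, one for each scalar channel. -/
structure IsChannelNoise {N : ℕ} (ξ : Fin N → ℕ → Ω → ℂ) (P : Measure Ω) : Prop where
  whiteNoise : ∀ i, IsWhiteNoise (ξ i) P
  indep : iIndepFun (fun i ω j => ξ i j ω) P

/-- The heat-regularized source `σ_τ = (ħc/g)^{1/2} L_B^{3/4} e^{-τ L_B/2} ξ`. -/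
def source (hbar c g : ℝ) {L a : ℝ} (S : PlateEigenbasis L a) (ξ : ℕ → Ω → ℂ)
    (τ : ℝ) (ω : Ω) : PlateSpace L a :=
  ∑' j, (((Real.sqrt (hbar * c / g) * S.lam j ^ (3 / 4 : ℝ) * Real.exp (-τ * S.lam j / 2) : ℝ) : ℂ)
    * ξ j ω) • S.u j

/-- The regulated interaction energy of `N` channels,
`U_τ^{(N)} = ∑_i ½ ⟨σ_τ^{(i)}, g L_B⁻¹ σ_τ^{(i)}⟩`. -/
def energy (hbar c g : ℝ) {N : ℕ} {L a : ℝ} (S : PlateEigenbasis L a) (ξ : Fin N → ℕ → Ω → ℂ)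
    (τ : ℝ) (ω : Ω) : ℝ :=
  ∑ i, 1 / 2 * (⟪source hbar c g S (ξ i) τ ω,
    S.multiplier (fun l => g * l⁻¹) (source hbar c g S (ξ i) τ ω)⟫_ℂ).re

end Stochastic

/-! ### Finite parts -/

/-- `c` is the minimal finite part of `f` as `τ → 0⁺`: the limit of `f τ` after subtraction of
finitely many terms `a_β τ^{-β}`, `β > 0`, and a term `a_log log(μ² τ)`. -/
def IsFinitePart (μ : ℝ) (f : ℝ → ℝ) (c : ℝ) : Prop :=
  ∃ (D : Finset ℝ) (A : ℝ → ℝ) (Alog : ℝ), (∀ β ∈ D, 0 < β) ∧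
    Tendsto (fun τ => f τ - ∑ β ∈ D, A β * τ ^ (-β) - Alog * Real.log (μ ^ 2 * τ))
      (𝓝[>] 0) (𝓝 c)

/-- The minimal finite part of `f` as `τ → 0⁺` (meaningful when it exists, and then unique). -/
def finitePart (μ : ℝ) (f : ℝ → ℝ) : ℝ :=
  Classical.epsilon (IsFinitePart μ f)

/-- The bulk energy density in the heat cutoff, `(ħc/2) ∫_{ℝ³} |k| e^{-τ|k|²} d³k/(2π)³`. -/
def bulkDensity (hbar c τ : ℝ) : ℝ :=
  hbar * c / 2 * ∫ k : E3, ‖k‖ * Real.exp (-τ * ‖k‖ ^ 2) / (2 * Real.pi) ^ 3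

/-- The self-energy per unit area of a single Dirichlet plate (one side) in the heat cutoff,
`-(1/4) (ħc/2) ∫_{ℝ²} |k| e^{-τ|k|²} d²k/(2π)²`. -/
def plateSelfEnergy (hbar c τ : ℝ) : ℝ :=
  -(1 / 4) * (hbar * c / 2) *
    ∫ k : EuclideanSpace ℝ (Fin 2), ‖k‖ * Real.exp (-τ * ‖k‖ ^ 2) / (2 * Real.pi) ^ 2

/-- The terms removed by the standard plate interaction-energy subtraction for `N` channels: the
bulk energy of the volume `L² a` and the self-energies of two plates of area `L²`. -/
def plateSubtraction (hbar c : ℝ) (N : ℕ) (L a τ : ℝ) : ℝ :=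
  N * (L ^ 2 * a * bulkDensity hbar c τ + 2 * L ^ 2 * plateSelfEnergy hbar c τ)

/-! ### Reference cells -/

/-- The flat Green energy `∫_D ∫_D |x - y|⁻¹` of a cell `D`. -/
def greenEnergy (D : Set E3) : ℝ :=
  ∫ x in D, ∫ y in D, ‖x - y‖⁻¹

/-- The unit-volume cell `D_α = [0,α] × [0,α⁻¹] × [0,1]`. -/
def aspectCell (α : ℝ) : Set E3 :=
  {x | x 0 ∈ Set.Icc 0 α ∧ x 1 ∈ Set.Icc 0 α⁻¹ ∧ x 2 ∈ Set.Icc 0 1}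

/-- The Green energy `Δ(α)` of `D_α`. -/
def delta (α : ℝ) : ℝ := greenEnergy (aspectCell α)

/-- `Δ₃(-1)`, the Green energy of the unit cube. -/
def deltaCube : ℝ := greenEnergy {x | ∀ i, x i ∈ Set.Icc (0 : ℝ) 1}

/-- The energy of the uniform densities `± Q / a³` on the scaled cell `aD`, for the
pair kernel `γ / |x - y|`. -/
def cellEnergy (γ Q : ℝ) (D : Set E3) (a : ℝ) : ℝ :=
  ∫ x in a • D, ∫ y in a • D, Q / a ^ 3 * (γ / ‖x - y‖) * (-(Q / a ^ 3))

/-- The additive reference energy of `n²` identical cells. -/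
def referenceEnergy (γ Q : ℝ) (D : Set E3) (n a : ℝ) : ℝ :=
  n ^ 2 * cellEnergy γ Q D a

/-! ### The comparison coefficient -/

section Comparison

variable {Ω : Type*} [MeasurableSpace Ω]

/-- The regulated ratio `Θ_{α,τ}^{(N)}`: the energy `U_τ^{(N)}` of plates of area
`A = L² = n² a²` divided by the reference energy of `n²` cells `a D_α`, with `n = L / a`
(a positive real number). -/
def ratio (hbar c g γ Q : ℝ) {N : ℕ} {L a : ℝ} (S : PlateEigenbasis L a)
    (ξ : Fin N → ℕ → Ω → ℂ) (α τ : ℝ) (ω : Ω) : ℝ :=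
  energy hbar c g S ξ τ ω / referenceEnergy γ Q (aspectCell α) (L / a) a

/-- The comparison coefficient: the limit, as the lateral side `L → ∞`, of the finite part of
`E[Θ_{α,τ}^{(N)}]` as `τ → 0⁺`. -/
def comparisonCoeff (hbar c g γ Q μ : ℝ) {N : ℕ} {a : ℝ} (P : Measure Ω)
    (S : ∀ L : Set.Ioi (0 : ℝ), PlateEigenbasis L a)
    (ξ : Set.Ioi (0 : ℝ) → Fin N → ℕ → Ω → ℂ) (α : ℝ) : ℝ :=
  limUnder atTop fun L : Set.Ioi (0 : ℝ) =>
    finitePart μ fun τ => ∫ ω, ratio hbar c g γ Q (S L) (ξ L) α τ ω ∂P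

end Comparison

end

end CasimirPlate

namespace CasimirPlate

open MeasureTheory ProbabilityTheory Filter Topology
open scoped InnerProductSpace Pointwise

noncomputable section

/-! The theorem combines two independent facts: the coefficient equals `N π² / (1440 Δ(α))`, and `Δ`
has its strict maximum at `α = 1`.

Value of the coefficient. The weights `λ^{3/4}` in the source, squared, against `g λ⁻¹` leave `√λ`,
and expectation replaces `|ξ_j|²` by `1`. The expected energy is thus `N (ħc/2) ∑ √λ_j e^{-τ λ_j}`
(`integral_energy`). The eigenbasis is arbitrary, so its heat trace is found by double counting
`|⟨m_k, u_j⟩|²` over basis vectors `u_j` and explicit modes `m_k`: Parseval holds in both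
directions, and the weak eigenvalue equation kills every pair with unequal eigenvalues
(`hasSum_exp_lam`). The square root comes from the heat semigroup through `√λ = (2√π)⁻¹ ∫ (1 -
e^{-λs}) s^{-3/2} ds` (`subord_laplace`), so the heat trace is all that is needed.

Poisson summation rewrites that trace as a sum of Gaussian heat kernels over image lattices
(`plateTrace_eq`). The images at the origin give pure powers `τ^{-2}` and `τ^{-3/2}`, which are
exactly the bulk and single-plate subtractions (`plateSubtraction_eq`). All other images have a
finite limit as `τ → 0⁺`, with a domination uniform in `τ` (`subord_tsum_heatKernel`). Negative
powers and a logarithm cannot combine to a nonzero finite limit (`limit_eq_zero_of_divergent`), so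
the finite part is unambiguous. As `L → ∞`, only images displaced normally to the plates survive per
unit area. They sum to a multiple of `ζ(4)` (`tendsto_plateFinite_div`), and division by the
reference energy `-ħc L² Δ(α) / a³` gives the value.

Cubical extremum. Writing `1/r` as a superposition of Gaussians makes the Green energy of a box an
integral over `u` of products of one-dimensional energies `φ(u b_i)/u²` (`greenEnergy_box`). The
function `s ↦ log φ(e^s)` is strictly concave (`strictConcaveOn_log_gaussEnergy`), hence `φ(uα)
φ(u/α) < φ(u)²` for `α ≠ 1`. Integration over `u` gives `Δ(α) < Δ(1)`. -/

/-! ### Logarithmic concavity of the one-dimensional Gaussian self-energy -/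

/-- The primitive `∫₀ˣ e^{-t²} dt`. -/
def gaussPrim (x : ℝ) : ℝ := ∫ t in (0 : ℝ)..x, Real.exp (-t ^ 2)

/-- The self-energy `2 ∫₀ˣ (∫₀ʸ e^{-t²} dt) dy` of the interval `[0, x]` for the kernel
`e^{-(s-t)²}`. -/
def gaussEnergy (x : ℝ) : ℝ := ∫ y in (0 : ℝ)..x, 2 * gaussPrim y

lemma hasDerivAt_gaussPrim (x : ℝ) : HasDerivAt gaussPrim (Real.exp (-x ^ 2)) x :=
  intervalIntegral.integral_hasDerivAt_right (by apply Continuous.intervalIntegrable; fun_prop)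
    (by apply Continuous.stronglyMeasurableAtFilter; fun_prop) (by fun_prop)

lemma continuous_gaussPrim : Continuous gaussPrim :=
  continuous_iff_continuousAt.2 fun x => (hasDerivAt_gaussPrim x).continuousAt

lemma hasDerivAt_gaussEnergy (x : ℝ) : HasDerivAt gaussEnergy (2 * gaussPrim x) x :=
  intervalIntegral.integral_hasDerivAt_right
    ((continuous_const.mul continuous_gaussPrim).intervalIntegrable _ _)
    (Continuous.stronglyMeasurableAtFilter (continuous_const.mul continuous_gaussPrim) _ _)
    (continuous_const.mul continuous_gaussPrim).continuousAt

lemma gaussPrim_zero : gaussPrim 0 = 0 := by simp [gaussPrim]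

lemma gaussPrim_pos {x : ℝ} (hx : 0 < x) : 0 < gaussPrim x :=
  intervalIntegral.intervalIntegral_pos_of_pos (by apply Continuous.intervalIntegrable; fun_prop)
    (fun _ => Real.exp_pos _) hx

lemma gaussPrim_le {x : ℝ} (hx : 0 ≤ x) : gaussPrim x ≤ x := by
  have := intervalIntegral.integral_mono_on (f := fun t => Real.exp (-t ^ 2)) (g := fun _ => 1)
    (μ := volume) hx
    (by apply Continuous.intervalIntegrable; fun_prop) (by simp)
    (fun t _ => Real.exp_le_one_iff.2 (by nlinarith [sq_nonneg t]))
  simpa [gaussPrim] using this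

lemma gaussEnergy_pos {x : ℝ} (hx : 0 < x) : 0 < gaussEnergy x :=
  intervalIntegral.intervalIntegral_pos_of_pos_on
    ((continuous_const.mul continuous_gaussPrim).intervalIntegrable _ _)
    (fun _ ht => mul_pos two_pos (gaussPrim_pos ht.1)) hx

/-- Integration by parts: `φ(x) = 2 x p(x) - (1 - e^{-x²})`. -/
lemma gaussEnergy_eq (x : ℝ) :
    gaussEnergy x = 2 * x * gaussPrim x - (1 - Real.exp (-x ^ 2)) := by
  have h : ∀ y, HasDerivAt (fun x => 2 * x * gaussPrim x - (1 - Real.exp (-x ^ 2)))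
      (2 * gaussPrim y) y := by
    intro y
    have h1 := ((hasDerivAt_id y).const_mul 2).mul (hasDerivAt_gaussPrim y)
    have h2 := ((((hasDerivAt_id y).pow 2).neg).exp.const_sub 1)
    refine (h1.sub h2).congr_deriv ?_
    simp
    ring
  have := intervalIntegral.integral_eq_sub_of_hasDerivAt (a := 0) (b := x) (fun y _ => h y)
    ((continuous_const.mul continuous_gaussPrim).intervalIntegrable _ _)
  rw [gaussEnergy, this]
  simp [gaussPrim_zero]

/-- The inequality that makes the elasticity of the Gaussian self-energy decreasing. -/
lemma elasticity_aux {x : ℝ} (hx : 0 < x) :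
    0 < gaussPrim x * (Real.exp (x ^ 2) - 1) / 2 + x * (1 - Real.exp (-x ^ 2)) / 2
      - x ^ 2 * gaussPrim x := by
  -- Since `q 0 = 0`, it is enough that the derivative of `q` is positive on the half-line.
  set q : ℝ → ℝ := fun x => gaussPrim x * (Real.exp (x ^ 2) - 1) / 2
    + x * (1 - Real.exp (-x ^ 2)) / 2 - x ^ 2 * gaussPrim x with hq
  have hd : ∀ y, HasDerivAt q
      ((1 - Real.exp (-y ^ 2)) + gaussPrim y * y * (Real.exp (y ^ 2) - 2)) y := by
    intro y
    have e1 := (((hasDerivAt_id y).pow 2).exp.sub_const 1)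
    have e2 := ((((hasDerivAt_id y).pow 2).neg).exp.const_sub 1)
    have h1 := ((hasDerivAt_gaussPrim y).mul e1).div_const 2
    have h2 := ((hasDerivAt_id y).mul e2).div_const 2
    have h3 := ((hasDerivAt_id y).pow 2).mul (hasDerivAt_gaussPrim y)
    refine ((h1.add h2).sub h3).congr_deriv ?_
    have : Real.exp (-y ^ 2) * Real.exp (y ^ 2) = 1 := by rw [← Real.exp_add]; simp
    simp
    linear_combination this / 2
  have hpos : ∀ y, 0 < y →
      0 < (1 - Real.exp (-y ^ 2)) + gaussPrim y * y * (Real.exp (y ^ 2) - 2) := by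
    intro y hy
    have hy2 : 0 < y ^ 2 := by positivity
    have he : Real.exp (-y ^ 2) < 1 := by rw [← Real.exp_zero]; exact Real.exp_lt_exp.2 (by linarith)
    have hp := gaussPrim_pos hy
    -- If `e^{y²} ≥ 2`, no term is negative. Otherwise put `t = y²` and use `p(y) ≤ y` and `e^t ≥ 1
    -- + t`. What remains is `1/(1+t) < 1 - t + t²`, which holds because `(1+t)(1-t+t²) = 1 + t³`.
    rcases le_or_gt 2 (Real.exp (y ^ 2)) with h | h
    · have : 0 ≤ gaussPrim y * y * (Real.exp (y ^ 2) - 2) :=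
        mul_nonneg (by positivity) (by linarith)
      linarith
    · have h1 : gaussPrim y * y ≤ y ^ 2 := by nlinarith [gaussPrim_le hy.le]
      have h2 := Real.add_one_le_exp (y ^ 2)
      have h3 : Real.exp (-y ^ 2) ≤ 1 / (1 + y ^ 2) := by
        rw [Real.exp_neg, one_div]
        exact inv_anti₀ (by positivity) (by linarith)
      have h4 : 1 / (1 + y ^ 2) < 1 - y ^ 2 * (1 - y ^ 2) := by
        rw [div_lt_iff₀ (by positivity)]
        nlinarith [mul_pos hy2 (mul_pos hy2 hy2)]
      nlinarith [mul_le_mul_of_nonneg_right h1 (by linarith : (0 : ℝ) ≤ 2 - Real.exp (y ^ 2))]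
  have hmono : StrictMonoOn q (Set.Ici 0) := by
    refine strictMonoOn_of_deriv_pos (convex_Ici 0)
      (fun y _ => (hd y).continuousAt.continuousWithinAt) ?_
    intro y hy
    rw [(hd y).deriv]
    exact hpos y (by simpa using hy)
  have := hmono (Set.self_mem_Ici) (Set.mem_Ici.2 hx.le) hx
  simpa [hq, gaussPrim_zero] using this

/-- The Gaussian self-energy is strictly log-concave in the logarithm of the side. -/
lemma strictConcaveOn_log_gaussEnergy :
    StrictConcaveOn ℝ Set.univ (fun s => Real.log (gaussEnergy (Real.exp s))) := by
  have hd : ∀ s, HasDerivAt (fun s => Real.log (gaussEnergy (Real.exp s)))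
      (2 * gaussPrim (Real.exp s) * Real.exp s / gaussEnergy (Real.exp s)) s := fun s =>
    ((hasDerivAt_gaussEnergy _).comp s (Real.hasDerivAt_exp s)).log
      (gaussEnergy_pos (Real.exp_pos s)).ne'
  have hE : ∀ x : ℝ, 0 < x → HasDerivAt (fun x => 2 * gaussPrim x * x / gaussEnergy x)
      (((2 * Real.exp (-x ^ 2) * x + 2 * gaussPrim x) * gaussEnergy x
        - 2 * gaussPrim x * x * (2 * gaussPrim x)) / gaussEnergy x ^ 2) x := by
    intro x hx
    refine ((((hasDerivAt_gaussPrim x).const_mul 2).mul (hasDerivAt_id x)).div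
      (hasDerivAt_gaussEnergy x) (gaussEnergy_pos hx).ne').congr_deriv ?_
    simp
  have hanti : StrictAntiOn (fun x => 2 * gaussPrim x * x / gaussEnergy x) (Set.Ioi 0) := by
    refine strictAntiOn_of_deriv_neg (convex_Ioi 0)
      (fun y hy => (hE y hy).continuousAt.continuousWithinAt) ?_
    intro x hx
    rw [interior_Ioi] at hx
    have hx : 0 < x := hx
    rw [(hE x hx).deriv]
    refine div_neg_of_neg_of_pos ?_ (by have := gaussEnergy_pos hx; positivity)
    rw [gaussEnergy_eq]
    -- With `φ = 2xp - (1 - e^{-x²})` substituted, the numerator equals `-4 e^{-x²}` times the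
    -- quantity in `elasticity_aux`.
    have h := mul_pos (elasticity_aux hx) (Real.exp_pos (-x ^ 2))
    have : Real.exp (-x ^ 2) * Real.exp (x ^ 2) = 1 := by rw [← Real.exp_add]; simp
    nlinarith [congrArg (fun z => gaussPrim x * z) this]
  -- The derivative of `s ↦ log φ(e^s)` is the elasticity `x φ'(x)/φ(x)` at `x = e^s`, and `exp` is
  -- increasing.
  refine StrictAntiOn.strictConcaveOn_of_deriv convex_univ
    (fun s _ => (hd s).continuousAt.continuousWithinAt) ?_
  intro s _ t _ hst
  rw [(hd s).deriv, (hd t).deriv]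
  exact hanti (Real.exp_pos s) (Real.exp_pos t) (Real.exp_lt_exp.2 hst)

/-- Strict midpoint concavity at the points `log u ± log α`, whose midpoint is `log u`; they are
distinct exactly when `α ≠ 1`. -/
lemma gaussEnergy_mul_lt {u α : ℝ} (hu : 0 < u) (hα : 0 < α) (h1 : α ≠ 1) :
    gaussEnergy (u * α) * gaussEnergy (u * α⁻¹) < gaussEnergy u ^ 2 := by
  have hne : Real.log u + Real.log α ≠ Real.log u - Real.log α := by
    intro h
    exact Real.log_ne_zero_of_pos_of_ne_one hα h1 (by linarith)
  have := strictConcaveOn_log_gaussEnergy.2 (Set.mem_univ _) (Set.mem_univ _) hne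
    (by norm_num : (0 : ℝ) < 1 / 2) (by norm_num : (0 : ℝ) < 1 / 2) (by norm_num)
  simp only [smul_eq_mul] at this
  rw [show 1 / 2 * (Real.log u + Real.log α) + 1 / 2 * (Real.log u - Real.log α) = Real.log u by
    ring, Real.exp_add, Real.exp_sub, Real.exp_log hu, Real.exp_log hα, div_eq_mul_inv u α] at this
  have p1 := gaussEnergy_pos (mul_pos hu hα)
  have p2 := gaussEnergy_pos (mul_pos hu (inv_pos.2 hα))
  have p3 := gaussEnergy_pos hu
  rw [← Real.log_lt_log_iff (mul_pos p1 p2) (by positivity), Real.log_mul p1.ne' p2.ne',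
    Real.log_pow]
  push_cast
  linarith

/-! ### Boxes -/

/-- The box `∏ [0, b i]` in `ℝ³`. -/
def box (b : Fin 3 → ℝ) : Set E3 := {x | ∀ i, x i ∈ Set.Icc 0 (b i)}

lemma plateBox_eq (L a : ℝ) : plateBox L a = box ![L, L, a] := by
  ext x; simp [plateBox, box, Fin.forall_fin_succ]

lemma aspectCell_eq (α : ℝ) : aspectCell α = box ![α, α⁻¹, 1] := by
  ext x; simp [aspectCell, box, Fin.forall_fin_succ]

lemma setIntegral_box_eq {E : Type*} [NormedAddCommGroup E] [NormedSpace ℝ E] (b : Fin 3 → ℝ)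
    (f : (Fin 3 → ℝ) → E) :
    ∫ x in box b, f (fun i => x i) =
      ∫ y, f y ∂(Measure.pi fun i => volume.restrict (Set.Icc 0 (b i))) := by
  rw [← Measure.restrict_pi_pi]
  have h : box b = (@WithLp.ofLp 2 (Fin 3 → ℝ)) ⁻¹' (Set.univ.pi fun i => Set.Icc 0 (b i)) := by
    ext x; simp only [box, Set.mem_ofPred_eq, Set.mem_preimage, Set.mem_pi, Set.mem_univ,
      forall_true_left]
  rw [h]
  exact (PiLp.volume_preserving_ofLp (Fin 3)).setIntegral_preimage_emb
    (MeasurableEquiv.toLp 2 (Fin 3 → ℝ)).symm.measurableEmbedding f _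

lemma setIntegral_box_prod {𝕜 : Type*} [RCLike 𝕜] (b : Fin 3 → ℝ) (f : Fin 3 → ℝ → 𝕜) :
    ∫ x in box b, ∏ i, f i (x i) = ∏ i, ∫ t in Set.Icc 0 (b i), f i t := by
  rw [setIntegral_box_eq b (fun y => ∏ i, f i (y i)), integral_fintype_prod_eq_prod]

lemma volume_box_lt_top (b : Fin 3 → ℝ) : volume (box b) < ⊤ := by
  refine Bornology.IsBounded.measure_lt_top ?_
  refine isBounded_iff_forall_norm_le.2 ⟨Real.sqrt (∑ i, |b i| ^ 2), fun x hx => ?_⟩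
  rw [EuclideanSpace.norm_eq]
  refine Real.sqrt_le_sqrt (Finset.sum_le_sum fun i _ => ?_)
  have := hx i
  rw [Real.norm_eq_abs, abs_of_nonneg this.1]
  exact pow_le_pow_left₀ this.1 (this.2.trans (le_abs_self _)) 2

instance isFiniteMeasure_box (b : Fin 3 → ℝ) : IsFiniteMeasure (volume.restrict (box b)) :=
  ⟨by simpa using volume_box_lt_top b⟩

/-! ### Green energies of boxes -/

/-- The Gaussian self-energy of the interval `[0, ℓ]` at inverse scale `u`. -/
def intervalEnergy (u l : ℝ) : ℝ :=
  ∫ s in Set.Icc 0 l, ∫ t in Set.Icc 0 l, Real.exp (-u ^ 2 * (s - t) ^ 2)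

lemma integral_exp_shift {u : ℝ} (hu : u ≠ 0) (l s : ℝ) :
    ∫ t in (0 : ℝ)..l, Real.exp (-u ^ 2 * (s - t) ^ 2)
      = u⁻¹ * (gaussPrim (u * s) - gaussPrim (u * (s - l))) := by
  have hd : ∀ t, HasDerivAt (fun t => -(u⁻¹ * gaussPrim (u * (s - t))))
      (Real.exp (-u ^ 2 * (s - t) ^ 2)) t := by
    intro t
    have h1 : HasDerivAt (fun t => u * (s - t)) (u * (0 - 1)) t :=
      ((hasDerivAt_const t s).sub (hasDerivAt_id t)).const_mul u
    refine (((hasDerivAt_gaussPrim _).comp t h1).const_mul u⁻¹).neg.congr_deriv ?_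
    rw [show -(u * (s - t)) ^ 2 = -u ^ 2 * (s - t) ^ 2 by ring]
    field_simp
    ring
  rw [intervalIntegral.integral_eq_sub_of_hasDerivAt (fun t _ => hd t)
    (by apply Continuous.intervalIntegrable; fun_prop)]
  simp only [sub_zero]
  ring

lemma gaussPrim_neg (x : ℝ) : gaussPrim (-x) = -gaussPrim x := by
  have := intervalIntegral.integral_comp_neg (f := fun t => Real.exp (-t ^ 2)) (a := 0) (b := x)
  simp only [even_two.neg_pow, neg_zero] at this
  rw [gaussPrim, intervalIntegral.integral_symm, ← this, gaussPrim]

lemma gaussEnergy_neg (x : ℝ) : gaussEnergy (-x) = gaussEnergy x := by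
  rw [gaussEnergy_eq, gaussEnergy_eq, gaussPrim_neg]; simp

lemma gaussEnergy_zero : gaussEnergy 0 = 0 := by simp [gaussEnergy]

/-- The kernel depends only on `s - t`, so both integrations have primitives built from `gaussPrim`
and `gaussEnergy`. Evenness of `gaussEnergy` and its vanishing at `0` collapse the endpoint terms.
-/
lemma intervalEnergy_eq {u l : ℝ} (hu : u ≠ 0) (hl : 0 ≤ l) :
    intervalEnergy u l = gaussEnergy (u * l) / u ^ 2 := by
  have hd : ∀ s, HasDerivAt
      (fun s => (gaussEnergy (u * s) - gaussEnergy (u * (s - l))) / (2 * u ^ 2))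
      (∫ t in (0 : ℝ)..l, Real.exp (-u ^ 2 * (s - t) ^ 2)) s := by
    intro s
    have h1 : HasDerivAt (fun s => u * s) (u * 1) s := (hasDerivAt_id s).const_mul u
    have h2 : HasDerivAt (fun s => u * (s - l)) (u * 1) s :=
      ((hasDerivAt_id s).sub_const l).const_mul u
    refine ((((hasDerivAt_gaussEnergy _).comp s h1).sub
      ((hasDerivAt_gaussEnergy _).comp s h2)).div_const (2 * u ^ 2)).congr_deriv ?_
    rw [integral_exp_shift hu]
    field_simp
  unfold intervalEnergy
  rw [integral_Icc_eq_integral_Ioc, ← intervalIntegral.integral_of_le hl]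
  simp_rw [integral_Icc_eq_integral_Ioc, ← intervalIntegral.integral_of_le hl]
  rw [intervalIntegral.integral_eq_sub_of_hasDerivAt (fun s _ => hd s)]
  · rw [sub_self, mul_zero, zero_sub, mul_neg, gaussEnergy_neg, gaussEnergy_zero]
    field_simp
    ring
  · refine Continuous.intervalIntegrable ?_ _ _
    simp_rw [integral_exp_shift hu]
    have := continuous_gaussPrim
    fun_prop

lemma intervalEnergy_pos {u l : ℝ} (hu : 0 < u) (hl : 0 < l) : 0 < intervalEnergy u l := by
  rw [intervalEnergy_eq hu.ne' hl.le]
  have := gaussEnergy_pos (mul_pos hu hl)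
  positivity

lemma gaussPrim_le_sqrt_pi (x : ℝ) : gaussPrim x ≤ Real.sqrt Real.pi := by
  have hi : Integrable fun t : ℝ => Real.exp (-t ^ 2) := by
    simpa using integrable_exp_neg_mul_sq (b := 1) one_pos
  have h := integral_gaussian 1
  rcases le_or_gt 0 x with hx | hx
  · rw [gaussPrim, intervalIntegral.integral_of_le hx]
    refine (setIntegral_le_integral hi (Eventually.of_forall fun t => (Real.exp_pos _).le)).trans ?_
    simp only [neg_mul, one_mul, div_one] at h
    exact h.le
  · have : 0 < gaussPrim (-x) := gaussPrim_pos (by linarith)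
    rw [gaussPrim_neg] at this
    linarith [Real.sqrt_nonneg Real.pi]

/-- The first bound controls small `u`, the second gives decay `1/u` for large `u`. Together they
dominate a product of three such energies by a multiple of `1/(1+u²)`. -/
lemma intervalEnergy_le {u l : ℝ} (hu : 0 < u) (hl : 0 < l) :
    intervalEnergy u l ≤ 2 * l ^ 2 ∧ u * intervalEnergy u l ≤ 2 * l * Real.sqrt Real.pi := by
  have h0 : 0 < u * l := mul_pos hu hl
  have h1 : gaussEnergy (u * l) ≤ 2 * (u * l) * gaussPrim (u * l) := by
    rw [gaussEnergy_eq]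
    have : Real.exp (-(u * l) ^ 2) ≤ 1 := Real.exp_le_one_iff.2 (by nlinarith [sq_nonneg (u * l)])
    linarith
  rw [intervalEnergy_eq hu.ne' hl.le]
  constructor
  · rw [div_le_iff₀ (by positivity)]
    nlinarith [gaussPrim_le h0.le]
  · rw [← mul_div_assoc, div_le_iff₀ (by positivity)]
    have := mul_le_mul_of_nonneg_left (gaussPrim_le_sqrt_pi (u * l)) h0.le
    nlinarith

/-- A Gaussian of the Euclidean distance factors over the coordinates. This is the reason for
trading the Newtonian kernel for Gaussians. -/
lemma gaussKernel_box (u : ℝ) (b : Fin 3 → ℝ) :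
    ∫ x in box b, ∫ y in box b, Real.exp (-u ^ 2 * ‖x - y‖ ^ 2) =
      ∏ i, intervalEnergy u (b i) := by
  have h : ∀ x y : E3, Real.exp (-u ^ 2 * ‖x - y‖ ^ 2)
      = ∏ i, Real.exp (-u ^ 2 * (x i - y i) ^ 2) := by
    intro x y
    rw [← Real.exp_sum, EuclideanSpace.norm_sq_eq, Finset.mul_sum]
    simp
  simp_rw [h]
  have h2 : ∀ x : E3, ∫ y in box b, ∏ i, Real.exp (-u ^ 2 * (x i - y i) ^ 2) =
      ∏ i, ∫ t in Set.Icc 0 (b i), Real.exp (-u ^ 2 * (x i - t) ^ 2) := fun x =>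
    setIntegral_box_prod b (fun i t => Real.exp (-u ^ 2 * (x i - t) ^ 2))
  simp_rw [h2]
  exact setIntegral_box_prod b
    (fun i s => ∫ t in Set.Icc 0 (b i), Real.exp (-u ^ 2 * (s - t) ^ 2))

/-- Stated with `ℝ≥0∞` values so that Tonelli applies to the singular kernel before its
integrability is known. -/
lemma inv_eq_lintegral_gauss {r : ℝ} (hr : 0 < r) :
    ENNReal.ofReal r⁻¹ =
      ∫⁻ u in Set.Ioi (0 : ℝ), ENNReal.ofReal (2 / Real.sqrt Real.pi * Real.exp (-u ^ 2 * r ^ 2)) := by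
  have hi : Integrable (fun u : ℝ => 2 / Real.sqrt Real.pi * Real.exp (-u ^ 2 * r ^ 2)) := by
    have := (integrable_exp_neg_mul_sq (b := r ^ 2) (by positivity)).const_mul
      (2 / Real.sqrt Real.pi)
    refine this.congr (Eventually.of_forall fun u => ?_)
    simp only; congr 2; ring
  rw [← ofReal_integral_eq_lintegral_ofReal hi.integrableOn
    (Eventually.of_forall fun u => by positivity)]
  congr 1
  have := integral_gaussian_Ioi (r ^ 2)
  rw [integral_const_mul]
  have h2 : ∀ u : ℝ, -u ^ 2 * r ^ 2 = -r ^ 2 * u ^ 2 := fun u => by ring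
  simp_rw [h2]
  rw [this, Real.sqrt_div' _ (by positivity), Real.sqrt_sq hr.le]
  have := Real.sqrt_pos.2 Real.pi_pos
  field_simp

/-- The Green energy of a box as a superposition of products of Gaussian self-energies. -/
lemma greenEnergy_box {b : Fin 3 → ℝ} (hb : ∀ i, 0 < b i) :
    IntegrableOn (fun u => 2 / Real.sqrt Real.pi * ∏ i, intervalEnergy u (b i)) (Set.Ioi 0) ∧
    greenEnergy (box b) =
      ∫ u in Set.Ioi (0 : ℝ), 2 / Real.sqrt Real.pi * ∏ i, intervalEnergy u (b i) := by
  have hcont : ContinuousOn (fun u => 2 / Real.sqrt Real.pi * ∏ i, intervalEnergy u (b i))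
      (Set.Ioi 0) := by
    have : ContinuousOn (fun u => 2 / Real.sqrt Real.pi * ∏ i, (gaussEnergy (u * b i) / u ^ 2))
        (Set.Ioi 0) := by
      refine continuousOn_const.mul (continuousOn_finsetProd _ fun i _ => ?_)
      have : Continuous gaussEnergy :=
        continuous_iff_continuousAt.2 fun x => (hasDerivAt_gaussEnergy x).continuousAt
      refine ContinuousOn.div (by fun_prop) (by fun_prop) fun u hu => ?_
      exact pow_ne_zero _ (ne_of_gt hu)
    refine this.congr fun u hu => ?_
    simp only
    congr 1
    exact Finset.prod_congr rfl fun i _ => intervalEnergy_eq (ne_of_gt hu) (hb i).le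
  have hpos : ∀ u ∈ Set.Ioi (0 : ℝ), 0 ≤ 2 / Real.sqrt Real.pi * ∏ i, intervalEnergy u (b i) :=
    fun u hu => mul_nonneg (by positivity)
      (Finset.prod_nonneg fun i _ => (intervalEnergy_pos hu (hb i)).le)
  have hint : IntegrableOn (fun u => 2 / Real.sqrt Real.pi * ∏ i, intervalEnergy u (b i))
      (Set.Ioi 0) := by
    -- `C` bounds `(1 + u²)` times the integrand: the summand `1` uses the constant bounds on all
    -- three sides, while `u²` is absorbed by the `1/u` decay of the first two.
    set C := 2 / Real.sqrt Real.pi * ((2 * b 0 ^ 2) * (2 * b 1 ^ 2) * (2 * b 2 ^ 2)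
      + (2 * b 0 * Real.sqrt Real.pi) * (2 * b 1 * Real.sqrt Real.pi) * (2 * b 2 ^ 2)) with hC
    refine Integrable.mono' ((integrable_inv_one_add_sq.const_mul C).integrableOn)
      (hcont.aestronglyMeasurable measurableSet_Ioi) ?_
    refine (ae_restrict_iff' measurableSet_Ioi).2 (Eventually.of_forall fun u hu => ?_)
    rw [Real.norm_of_nonneg (hpos u hu), ← div_eq_mul_inv, le_div_iff₀ (by positivity), hC,
      mul_assoc]
    refine mul_le_mul_of_nonneg_left ?_ (by positivity)
    have hu' : 0 < u := hu
    obtain ⟨a0, c0⟩ := intervalEnergy_le hu' (hb 0)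
    obtain ⟨a1, c1⟩ := intervalEnergy_le hu' (hb 1)
    obtain ⟨a2, c2⟩ := intervalEnergy_le hu' (hb 2)
    have p0 := intervalEnergy_pos hu' (hb 0)
    have p1 := intervalEnergy_pos hu' (hb 1)
    have p2 := intervalEnergy_pos hu' (hb 2)
    have q0 := hb 0
    have q1 := hb 1
    rw [Fin.prod_univ_three]
    calc _ = intervalEnergy u (b 0) * intervalEnergy u (b 1) * intervalEnergy u (b 2)
          + (u * intervalEnergy u (b 0)) * (u * intervalEnergy u (b 1))
            * intervalEnergy u (b 2) := by ring
      _ ≤ _ := by gcongr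
  refine ⟨hint, ?_⟩
  have hI : ∫⁻ x in box b, ∫⁻ y in box b, ENNReal.ofReal ‖x - y‖⁻¹ =
      ENNReal.ofReal (∫ u in Set.Ioi (0 : ℝ),
        2 / Real.sqrt Real.pi * ∏ i, intervalEnergy u (b i)) := by
    calc _ = ∫⁻ x in box b, ∫⁻ y in box b, ∫⁻ u in Set.Ioi (0 : ℝ),
          ENNReal.ofReal (2 / Real.sqrt Real.pi * Real.exp (-u ^ 2 * ‖x - y‖ ^ 2)) := by
          refine lintegral_congr fun x => lintegral_congr_ae ?_
          have : ∀ᵐ y ∂(volume.restrict (box b)), y ≠ x :=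
            ae_restrict_of_ae (Measure.ae_ne volume x)
          filter_upwards [this] with y hy
          exact inv_eq_lintegral_gauss (norm_pos_iff.2 (sub_ne_zero.2 hy.symm))
      _ = ∫⁻ u in Set.Ioi (0 : ℝ), ∫⁻ x in box b, ∫⁻ y in box b,
          ENNReal.ofReal (2 / Real.sqrt Real.pi * Real.exp (-u ^ 2 * ‖x - y‖ ^ 2)) := by
          have h1 : ∀ x : E3, ∫⁻ y in box b, ∫⁻ u in Set.Ioi (0 : ℝ),
              ENNReal.ofReal (2 / Real.sqrt Real.pi * Real.exp (-u ^ 2 * ‖x - y‖ ^ 2)) =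
              ∫⁻ u in Set.Ioi (0 : ℝ), ∫⁻ y in box b,
              ENNReal.ofReal (2 / Real.sqrt Real.pi * Real.exp (-u ^ 2 * ‖x - y‖ ^ 2)) :=
            fun x => lintegral_lintegral_swap (by fun_prop : Measurable (fun z : E3 × ℝ =>
              ENNReal.ofReal (2 / Real.sqrt Real.pi *
                Real.exp (-z.2 ^ 2 * ‖x - z.1‖ ^ 2)))).aemeasurable
          simp_rw [h1]
          exact lintegral_lintegral_swap (Measurable.lintegral_prod_right'
            (ν := volume.restrict (box b)) (f := fun z : (E3 × ℝ) × E3 => ENNReal.ofReal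
            (2 / Real.sqrt Real.pi * Real.exp (-z.1.2 ^ 2 * ‖z.1.1 - z.2‖ ^ 2)))
            (by fun_prop)).aemeasurable
      _ = ∫⁻ u in Set.Ioi (0 : ℝ),
          ENNReal.ofReal (2 / Real.sqrt Real.pi * ∏ i, intervalEnergy u (b i)) := by
          refine lintegral_congr fun u => ?_
          have hb1 : ∀ x y : E3, ‖Real.exp (-u ^ 2 * ‖x - y‖ ^ 2)‖ ≤ 1 := fun x y => by
            rw [Real.norm_of_nonneg (Real.exp_pos _).le]
            exact Real.exp_le_one_iff.2 (by nlinarith [mul_nonneg (sq_nonneg u) (sq_nonneg ‖x - y‖)])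
          have hp : Integrable (fun z : E3 × E3 => Real.exp (-u ^ 2 * ‖z.1 - z.2‖ ^ 2))
              ((volume.restrict (box b)).prod (volume.restrict (box b))) :=
            Integrable.of_bound (by fun_prop) 1 (Eventually.of_forall fun z => hb1 _ _)
          rw [← gaussKernel_box, ← integral_const_mul]
          simp_rw [← integral_const_mul]
          rw [ofReal_integral_eq_lintegral_ofReal]
          · refine lintegral_congr fun x => ?_
            rw [ofReal_integral_eq_lintegral_ofReal]
            · exact (Integrable.of_bound (by fun_prop) 1
                (Eventually.of_forall fun y => hb1 _ _)).const_mul _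
            · exact Eventually.of_forall fun y => by positivity
          · simp_rw [integral_const_mul]
            exact hp.integral_prod_left.const_mul _
          · exact Eventually.of_forall fun x => integral_nonneg fun y => by positivity
      _ = _ := (ofReal_integral_eq_lintegral_ofReal hint
          ((ae_restrict_iff' measurableSet_Ioi).2 (Eventually.of_forall hpos))).symm
  have hm1 : Measurable fun x : E3 => ∫⁻ y in box b, ENNReal.ofReal ‖x - y‖⁻¹ :=
    Measurable.lintegral_prod_right' (ν := volume.restrict (box b))
      (f := fun z : E3 × E3 => ENNReal.ofReal ‖z.1 - z.2‖⁻¹) (by fun_prop)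
  have h1 : ∀ x : E3, ∫ y in box b, ‖x - y‖⁻¹ =
      (∫⁻ y in box b, ENNReal.ofReal ‖x - y‖⁻¹).toReal := fun x =>
    integral_eq_lintegral_of_nonneg_ae (Eventually.of_forall fun y => by positivity)
      (by fun_prop)
  unfold greenEnergy
  simp_rw [h1]
  rw [integral_toReal hm1.aemeasurable (ae_lt_top hm1 (by rw [hI]; exact ENNReal.ofReal_ne_top)),
    hI, ENNReal.toReal_ofReal (setIntegral_nonneg measurableSet_Ioi hpos)]

lemma setIntegral_Ioi_lt {f g : ℝ → ℝ} (hf : IntegrableOn f (Set.Ioi 0))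
    (hg : IntegrableOn g (Set.Ioi 0)) (h : ∀ u, 0 < u → f u < g u) :
    ∫ u in Set.Ioi (0 : ℝ), f u < ∫ u in Set.Ioi (0 : ℝ), g u := by
  rw [← sub_pos, ← integral_sub hg hf]
  rw [setIntegral_pos_iff_support_of_nonneg_ae]
  · have : Function.support (fun u => g u - f u) ∩ Set.Ioi 0 = Set.Ioi 0 :=
      Set.inter_eq_right.2 fun u hu => (sub_pos.2 (h u hu)).ne'
    rw [this]; simp
  · exact (ae_restrict_iff' measurableSet_Ioi).2
      (Eventually.of_forall fun u hu => (sub_pos.2 (h u hu)).le)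
  · exact hg.sub hf

lemma delta_one : delta 1 = deltaCube := by
  rw [delta, deltaCube, aspectCell_eq, box]
  congr 1
  ext x
  simp [Fin.forall_fin_succ]

lemma aspectSides_pos {α : ℝ} (hα : 0 < α) (i : Fin 3) : 0 < (![α, α⁻¹, 1] : Fin 3 → ℝ) i := by
  fin_cases i <;> simp [hα]

lemma delta_pos {α : ℝ} (hα : 0 < α) : 0 < delta α := by
  obtain ⟨h1, h2⟩ := greenEnergy_box (aspectSides_pos hα)
  rw [delta, aspectCell_eq, h2]
  have := setIntegral_Ioi_lt (f := fun _ => 0) (by simp) h1 fun u hu =>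
    mul_pos (by positivity)
      (Finset.prod_pos fun i _ => intervalEnergy_pos hu (aspectSides_pos hα i))
  simpa using this

/-- Among the cells `D_α` the cube has the strictly largest Green energy. -/
lemma delta_lt_delta_one {α : ℝ} (hα : 0 < α) (h : α ≠ 1) : delta α < delta 1 := by
  obtain ⟨h1, h2⟩ := greenEnergy_box (aspectSides_pos hα)
  obtain ⟨h3, h4⟩ := greenEnergy_box (aspectSides_pos one_pos)
  rw [delta, delta, aspectCell_eq, aspectCell_eq, h2, h4]
  refine setIntegral_Ioi_lt h1 h3 fun u hu => ?_
  refine mul_lt_mul_of_pos_left ?_ (by positivity)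
  simp only [Fin.prod_univ_three, Matrix.cons_val]
  refine mul_lt_mul_of_pos_right ?_ (intervalEnergy_pos hu one_pos)
  rw [intervalEnergy_eq hu.ne' hα.le, intervalEnergy_eq hu.ne' (inv_pos.2 hα).le,
    intervalEnergy_eq hu.ne' zero_le_one, intervalEnergy_eq hu.ne' (by simp),
    div_mul_div_comm, div_mul_div_comm]
  refine div_lt_div_of_pos_right ?_ (by positivity)
  have := gaussEnergy_mul_lt hu hα h
  simpa [sq] using this

/-! ### The reference energy -/

/-- Scaling: two volume elements contribute `a⁶`, the two densities and the kernel contribute `a⁻⁷`.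
-/
lemma cellEnergy_eq (γ Q : ℝ) (D : Set E3) {a : ℝ} (ha : 0 < a) :
    cellEnergy γ Q D a = -(γ * Q ^ 2 / a) * greenEnergy D := by
  have hs : ∀ f : E3 → ℝ, ∫ x in a • D, f x = a ^ 3 * ∫ x in D, f (a • x) := by
    intro f
    have := Measure.setIntegral_comp_smul_of_pos (volume : Measure E3) f D ha
    rw [this]
    simp only [finrank_euclideanSpace, Fintype.card_fin, smul_eq_mul]
    rw [← mul_assoc, mul_inv_cancel₀ (by positivity), one_mul]
  unfold cellEnergy greenEnergy
  rw [hs]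
  simp_rw [hs, ← smul_sub, norm_smul, Real.norm_of_nonneg ha.le]
  have : ∀ x y : E3, Q / a ^ 3 * (γ / (a * ‖x - y‖)) * -(Q / a ^ 3)
      = -(γ * Q ^ 2 / a ^ 7) * ‖x - y‖⁻¹ := by
    intro x y
    -- On the diagonal both sides are `0` by the convention for division by zero.
    by_cases h : ‖x - y‖ = 0
    · simp [h]
    · field_simp
  simp_rw [this, integral_const_mul]
  rw [← mul_assoc]
  field_simp

lemma referenceEnergy_eq (γ Q : ℝ) (α n : ℝ) {a : ℝ} (ha : 0 < a) :
    referenceEnergy γ Q (aspectCell α) n a = -(n ^ 2 * (γ * Q ^ 2 / a) * delta α) := by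
  rw [referenceEnergy, cellEnergy_eq _ _ _ ha, delta]
  ring

/-! ### Subordination: square roots from heat semigroups -/

/-- The weight `s^{-3/2}` integrates every function bounded by `min (A s) B`. -/
lemma integral_min_mul_rpow {A B : ℝ} (hA : 0 < A) (hB : 0 < B) :
    IntegrableOn (fun s : ℝ => min (A * s) B * s ^ (-(3 / 2) : ℝ)) (Set.Ioi 0) ∧
    ∫ s in Set.Ioi (0 : ℝ), min (A * s) B * s ^ (-(3 / 2) : ℝ) = 4 * Real.sqrt (A * B) := by
  -- The two branches of the minimum cross at `s = B / A`, where the integral is split.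
  have hR : 0 < B / A := by positivity
  have e1 : Set.EqOn (fun s : ℝ => A * s ^ (-(1 / 2) : ℝ))
      (fun s : ℝ => min (A * s) B * s ^ (-(3 / 2) : ℝ)) (Set.Ioc 0 (B / A)) := by
    intro s hs
    have : A * s ≤ B := by have := (le_div_iff₀ hA).1 hs.2; linarith
    simp only [min_eq_left this]
    rw [show (-(1 / 2) : ℝ) = 1 + -(3 / 2) by norm_num, Real.rpow_add hs.1, Real.rpow_one]
    ring
  have e2 : Set.EqOn (fun s : ℝ => B * s ^ (-(3 / 2) : ℝ))
      (fun s : ℝ => min (A * s) B * s ^ (-(3 / 2) : ℝ)) (Set.Ioi (B / A)) := by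
    intro s hs
    have : B ≤ A * s := by have := (div_lt_iff₀ hA).1 hs; linarith
    simp only [min_eq_right this]
  have i1 : IntegrableOn (fun s : ℝ => A * s ^ (-(1 / 2) : ℝ)) (Set.Ioc 0 (B / A)) := by
    have := (intervalIntegral.intervalIntegrable_rpow' (a := 0) (b := B / A)
      (by norm_num : (-1 : ℝ) < -(1 / 2))).const_mul A
    exact (intervalIntegrable_iff_integrableOn_Ioc_of_le hR.le).1 this
  have i2 : IntegrableOn (fun s : ℝ => B * s ^ (-(3 / 2) : ℝ)) (Set.Ioi (B / A)) :=
    (integrableOn_Ioi_rpow_of_lt (by norm_num) hR).const_mul B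
  have hU : Set.Ioc 0 (B / A) ∪ Set.Ioi (B / A) = Set.Ioi 0 := Set.Ioc_union_Ioi_eq_Ioi hR.le
  have j1 := i1.congr_fun e1 measurableSet_Ioc
  have j2 := i2.congr_fun e2 measurableSet_Ioi
  refine ⟨hU ▸ j1.union j2, ?_⟩
  rw [← hU, setIntegral_union Set.Ioc_disjoint_Ioi_same measurableSet_Ioi j1 j2,
    ← setIntegral_congr_fun measurableSet_Ioc e1, ← setIntegral_congr_fun measurableSet_Ioi e2,
    integral_const_mul, integral_const_mul, integral_Ioi_rpow_of_lt (by norm_num) hR,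
    ← intervalIntegral.integral_of_le hR.le, integral_rpow (Or.inl (by norm_num))]
  rw [show (-(1 / 2) : ℝ) + 1 = 1 / 2 by norm_num, show (-(3 / 2) : ℝ) + 1 = -(1 / 2) by norm_num,
    Real.zero_rpow (by norm_num), Real.rpow_neg hR.le, ← Real.sqrt_eq_rpow, Real.sqrt_div hB.le,
    Real.sqrt_mul hA.le]
  have sA := Real.sqrt_pos.2 hA
  have sB := Real.sqrt_pos.2 hB
  have hA2 := Real.mul_self_sqrt hA.le
  have hB2 := Real.mul_self_sqrt hB.le
  field_simp
  linear_combination (-2 * √B ^ 2) * hA2 - 2 * √A ^ 2 * hB2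

lemma one_sub_exp_le_min {l s : ℝ} (hl : 0 ≤ l) (hs : 0 ≤ s) :
    0 ≤ 1 - Real.exp (-(l * s)) ∧ 1 - Real.exp (-(l * s)) ≤ min (l * s) 1 := by
  have h := Real.add_one_le_exp (-(l * s))
  have h0 : 0 ≤ l * s := mul_nonneg hl hs
  refine ⟨by linarith [Real.exp_le_one_iff.2 (neg_nonpos.2 h0)], le_min (by linarith) ?_⟩
  linarith [Real.exp_pos (-(l * s))]

/-- Integration by parts against `-2 s^{-1/2}` reduces the integral to `Γ(1/2)`. The boundary terms
vanish because `1 - e^{-ls}` is `O(s)` at the origin and bounded at infinity. -/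
lemma integral_one_sub_exp_mul_rpow {l : ℝ} (hl : 0 ≤ l) :
    IntegrableOn (fun s : ℝ => (1 - Real.exp (-(l * s))) * s ^ (-(3 / 2) : ℝ)) (Set.Ioi 0) ∧
    ∫ s in Set.Ioi (0 : ℝ), (1 - Real.exp (-(l * s))) * s ^ (-(3 / 2) : ℝ) =
      2 * Real.sqrt Real.pi * Real.sqrt l := by
  rcases hl.eq_or_lt with rfl | hl
  · simp
  have hint : IntegrableOn (fun s : ℝ => (1 - Real.exp (-(l * s))) * s ^ (-(3 / 2) : ℝ))
      (Set.Ioi 0) := by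
    refine Integrable.mono' (integral_min_mul_rpow hl one_pos).1 (by fun_prop) ?_
    refine (ae_restrict_iff' measurableSet_Ioi).2 (Eventually.of_forall fun s hs => ?_)
    have hs : 0 < s := hs
    obtain ⟨h1, h2⟩ := one_sub_exp_le_min hl.le hs.le
    rw [norm_mul, Real.norm_of_nonneg h1, Real.norm_of_nonneg (by positivity)]
    exact mul_le_mul_of_nonneg_right h2 (by positivity)
  refine ⟨hint, ?_⟩
  have hG := Real.integral_rpow_mul_exp_neg_mul_Ioi (a := 1 / 2) (r := l) (by norm_num) hl
  have hGi : IntegrableOn (fun s : ℝ => s ^ (1 / 2 - 1 : ℝ) * Real.exp (-(l * s))) (Set.Ioi 0) :=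
    .of_integral_ne_zero (by rw [hG]; positivity)
  have hcongr : ∀ s ∈ Set.Ioi (0 : ℝ), s ^ (1 / 2 - 1 : ℝ) = s ^ (-(1 / 2) : ℝ) := by
    intro s _; norm_num
  have hpow : ∀ s : ℝ, 0 < s → s ^ (1 / 2 : ℝ) = s * s ^ (-(1 / 2) : ℝ) := fun s hs => by
    rw [← Real.rpow_one_add' hs.le (by norm_num)]; norm_num
  have key := integral_Ioi_mul_deriv_eq_deriv_mul (a := 0) (a' := 0) (b' := 0)
    (u := fun s => 1 - Real.exp (-(l * s))) (u' := fun s => l * Real.exp (-(l * s)))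
    (v := fun s => -2 * s ^ (-(1 / 2) : ℝ)) (v' := fun s => s ^ (-(3 / 2) : ℝ))
    (fun s _ => by
      have := (((hasDerivAt_id s).const_mul l).neg.exp).const_sub 1
      refine this.congr_deriv ?_
      simp; ring)
    (fun s hs => by
      have := (Real.hasDerivAt_rpow_const (x := s) (p := -(1 / 2)) (Or.inl (ne_of_gt hs))).const_mul (-2)
      refine this.congr_deriv ?_
      rw [show (-(1 / 2) : ℝ) - 1 = -(3 / 2) by norm_num]; ring)
    hint
    (by
      refine IntegrableOn.congr_fun (hGi.const_mul (-2 * l)) (fun s hs => ?_) measurableSet_Ioi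
      simp only [Pi.mul_apply]
      rw [hcongr s hs]; ring)
    (by
      refine squeeze_zero_norm' (a := fun s => 2 * l * s ^ (1 / 2 : ℝ)) ?_ ?_
      · filter_upwards [self_mem_nhdsWithin] with s hs
        have hs : 0 < s := hs
        obtain ⟨h1, h2⟩ := one_sub_exp_le_min hl.le hs.le
        have h3 := h2.trans (min_le_left _ _)
        have : 0 ≤ s ^ (-(1 / 2) : ℝ) := by positivity
        rw [Pi.mul_apply, norm_mul, Real.norm_of_nonneg h1, norm_mul, Real.norm_of_nonneg this, hpow s hs,
          norm_neg, Real.norm_ofNat]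
        nlinarith [mul_le_mul_of_nonneg_right h3 this]
      · have : Tendsto (fun s : ℝ => 2 * l * s ^ (1 / 2 : ℝ)) (𝓝 0) (𝓝 (2 * l * 0 ^ (1 / 2 : ℝ))) :=
          ((Real.continuousAt_rpow_const 0 (1 / 2) (Or.inr (by norm_num))).tendsto).const_mul _
        rw [Real.zero_rpow (by norm_num), mul_zero] at this
        exact this.mono_left nhdsWithin_le_nhds)
    (by
      have h0 : Tendsto (fun s : ℝ => 2 * s ^ (-(1 / 2) : ℝ)) atTop (𝓝 0) := by
        simpa using (tendsto_rpow_neg_atTop (by norm_num : (0 : ℝ) < 1 / 2)).const_mul 2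
      refine squeeze_zero_norm' ?_ h0
      filter_upwards [eventually_gt_atTop 0] with s hs
      obtain ⟨h1, h2⟩ := one_sub_exp_le_min hl.le hs.le
      have h3 := h2.trans (min_le_right _ _)
      have : 0 ≤ s ^ (-(1 / 2) : ℝ) := by positivity
      rw [Pi.mul_apply, norm_mul, Real.norm_of_nonneg h1, norm_mul, Real.norm_of_nonneg this, norm_neg,
        Real.norm_ofNat]
      nlinarith [mul_le_mul_of_nonneg_right h3 this])
  rw [key, sub_zero, zero_sub]
  have : ∫ s in Set.Ioi (0 : ℝ), l * Real.exp (-(l * s)) * (-2 * s ^ (-(1 / 2) : ℝ)) =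
      -2 * l * ∫ s in Set.Ioi (0 : ℝ), s ^ (1 / 2 - 1 : ℝ) * Real.exp (-(l * s)) := by
    rw [← integral_const_mul]
    refine setIntegral_congr_fun measurableSet_Ioi fun s hs => ?_
    rw [hcongr s hs]; ring
  rw [this, hG, Real.Gamma_one_half_eq, ← Real.sqrt_eq_rpow, one_div, Real.sqrt_inv]
  have h1 := Real.mul_self_sqrt hl.le
  have := Real.sqrt_pos.2 hl
  field_simp
  linear_combination -h1

/-- The subordination functional: it sends `τ ↦ e^{-τλ}` to `√λ e^{-τλ}`. -/
def subord (g : ℝ → ℝ) (τ : ℝ) : ℝ :=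
  (2 * Real.sqrt Real.pi)⁻¹ *
    ∫ s in Set.Ioi (0 : ℝ), (g τ - g (τ + s)) * s ^ (-(3 / 2) : ℝ)

/-- The integrand of the subordination functional is integrable at `τ`. -/
def SubordIntegrable (g : ℝ → ℝ) (τ : ℝ) : Prop :=
  IntegrableOn (fun s : ℝ => (g τ - g (τ + s)) * s ^ (-(3 / 2) : ℝ)) (Set.Ioi 0)

/-- Subordination for Laplace transforms of measures. -/
lemma subord_laplace {X : Type*} [MeasurableSpace X] {ν : Measure X} [SFinite ν] {l : X → ℝ}
    (hl : Measurable l) (hl0 : ∀ x, 0 ≤ l x) {τ : ℝ}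
    (hi : Integrable (fun x => Real.exp (-(τ * l x))) ν)
    (hs : Integrable (fun x => Real.sqrt (l x) * Real.exp (-(τ * l x))) ν) :
    SubordIntegrable (fun t => ∫ x, Real.exp (-(t * l x)) ∂ν) τ ∧
    ∫ x, Real.sqrt (l x) * Real.exp (-(τ * l x)) ∂ν =
      subord (fun t => ∫ x, Real.exp (-(t * l x)) ∂ν) τ := by
  set F : X → ℝ → ℝ := fun x s =>
    Real.exp (-(τ * l x)) * ((1 - Real.exp (-(l x * s))) * s ^ (-(3 / 2) : ℝ)) with hF
  have hFi : ∀ x, IntegrableOn (F x) (Set.Ioi 0) := fun x =>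
    (integral_one_sub_exp_mul_rpow (hl0 x)).1.const_mul _
  have hFv : ∀ x, ∫ s in Set.Ioi (0 : ℝ), F x s =
      2 * Real.sqrt Real.pi * (Real.sqrt (l x) * Real.exp (-(τ * l x))) := fun x => by
    simp only [hF, integral_const_mul, (integral_one_sub_exp_mul_rpow (hl0 x)).2]
    ring
  have hFn : ∀ x, ∀ s ∈ Set.Ioi (0 : ℝ), ‖F x s‖ = F x s := fun x s hs => by
    have hs : 0 < s := hs
    have := (one_sub_exp_le_min (hl0 x) hs.le).1
    exact Real.norm_of_nonneg (by positivity)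
  -- `F` is nonnegative for `s > 0`, so joint integrability follows from the explicit value of its
  -- `s`-integral, which is integrable in `x` by `hs`.
  have hprod : Integrable (Function.uncurry F) (ν.prod (volume.restrict (Set.Ioi 0))) := by
    rw [integrable_prod_iff (by simp only [hF, Function.uncurry_def]; fun_prop)]
    refine ⟨Eventually.of_forall hFi, ?_⟩
    refine (hs.const_mul (2 * Real.sqrt Real.pi)).congr (Eventually.of_forall fun x => ?_)
    simp only [Function.uncurry_apply_pair]
    rw [setIntegral_congr_fun measurableSet_Ioi (hFn x), hFv]
  have hin : ∀ s ∈ Set.Ioi (0 : ℝ), ∫ x, F x s ∂ν = ((∫ x, Real.exp (-(τ * l x)) ∂ν)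
      - ∫ x, Real.exp (-((τ + s) * l x)) ∂ν) * s ^ (-(3 / 2) : ℝ) := by
    intro s hs
    have hs : 0 < s := hs
    have h2 : Integrable (fun x => Real.exp (-((τ + s) * l x))) ν := by
      refine hi.mono' (by fun_prop) (Eventually.of_forall fun x => ?_)
      rw [Real.norm_of_nonneg (Real.exp_pos _).le]
      exact Real.exp_le_exp.2 (by nlinarith [mul_nonneg hs.le (hl0 x)])
    rw [← integral_sub hi h2, ← integral_mul_const]
    refine integral_congr_ae (Eventually.of_forall fun x => ?_)
    simp only [hF]
    rw [show -((τ + s) * l x) = -(τ * l x) + -(l x * s) by ring, Real.exp_add]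
    ring
  constructor
  · exact IntegrableOn.congr_fun hprod.integral_prod_right hin measurableSet_Ioi
  · have h := integral_integral_swap hprod
    simp_rw [hFv, integral_const_mul] at h
    rw [setIntegral_congr_fun measurableSet_Ioi hin] at h
    rw [subord, ← h, ← mul_assoc, inv_mul_cancel₀, one_mul]
    have := Real.sqrt_pos.2 Real.pi_pos
    positivity

/-! ### Heat kernels and their subordinated limits -/

/-- The heat kernel `(4πt)^{-p} e^{-q/4t}` of dimension `2p` at squared distance `q`. -/
def heatKernel (p q t : ℝ) : ℝ := (4 * Real.pi) ^ (-p) * (t ^ (-p) * Real.exp (-(q / (4 * t))))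

/-- The inequality `y ≤ e^y` at `y = q/(4rt)`, raised to the power `r`. -/
lemma rpow_mul_exp_le {r q t : ℝ} (hr : 0 < r) (hq : 0 < q) (ht : 0 < t) :
    t ^ (-r) * Real.exp (-(q / (4 * t))) ≤ (4 * r) ^ r * q ^ (-r) := by
  have h1 : q / (4 * r * t) ≤ Real.exp (q / (4 * r * t)) := by
    linarith [Real.add_one_le_exp (q / (4 * r * t))]
  have h2 := Real.rpow_le_rpow (by positivity) h1 hr.le
  rw [← Real.exp_mul, show q / (4 * r * t) * r = q / (4 * t) by field_simp,
    Real.div_rpow hq.le (by positivity), Real.mul_rpow (by positivity) ht.le] at h2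
  rw [Real.exp_neg, Real.rpow_neg ht.le, Real.rpow_neg hq.le]
  have a1 : 0 < t ^ r := by positivity
  have a2 : 0 < q ^ r := by positivity
  have a3 : 0 < (4 * r) ^ r := by positivity
  rw [div_le_iff₀ (by positivity)] at h2
  rw [← mul_inv, ← div_eq_mul_inv, le_div_iff₀ a2, ← div_eq_inv_mul, div_le_iff₀
    (mul_pos a1 (Real.exp_pos _))]
  linarith

lemma hasDerivAt_heatKernel (p q : ℝ) {t : ℝ} (ht : 0 < t) :
    HasDerivAt (heatKernel p q) ((4 * Real.pi) ^ (-p) *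
      (-p * (t ^ (-(p + 1)) * Real.exp (-(q / (4 * t)))) +
        q / 4 * (t ^ (-(p + 2)) * Real.exp (-(q / (4 * t)))))) t := by
  have h1 := Real.hasDerivAt_rpow_const (x := t) (p := -p) (Or.inl ht.ne')
  have h2 : HasDerivAt (fun t : ℝ => q / (4 * t)) (-(q * 4) / (4 * t) ^ 2) t := by
    have := ((hasDerivAt_const t q).div ((hasDerivAt_id t).const_mul 4)
      (by simpa using ht.ne'))
    refine this.congr_deriv ?_
    simp
  refine ((h1.mul h2.neg.exp).const_mul ((4 * Real.pi) ^ (-p))).congr_deriv ?_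
  rw [show -(p + 1) = -p - 1 by ring, show -(p + 2) = -p - ((2 : ℕ) : ℝ) by push_cast; ring,
    Real.rpow_sub_natCast ht.ne', Pi.neg_apply]
  field_simp

lemma heatKernel_pos (p q : ℝ) {t : ℝ} (ht : 0 < t) : 0 < heatKernel p q t := by
  unfold heatKernel; have := Real.pi_pos; positivity

/-- Uniform bounds for increments of the heat kernel away from the diagonal. -/
lemma exists_heatKernel_bound {p : ℝ} (hp : 0 < p) : ∃ C : ℝ, 0 < C ∧ ∀ q : ℝ, 0 < q →
    (∀ t, 0 < t → heatKernel p q t ≤ C * q ^ (-(p + 1)) * t) ∧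
    ∀ t s, 0 < t → 0 < s → |heatKernel p q t - heatKernel p q (t + s)| ≤
      min (C * q ^ (-(p + 1)) * s) (C * q ^ (-p)) := by
  set D := (4 * Real.pi) ^ (-p) with hD
  have hDpos : 0 < D := by have := Real.pi_pos; positivity
  set c0 := (4 * p) ^ p with hc0
  set c1 := (4 * (p + 1)) ^ (p + 1) with hc1
  set c2 := (4 * (p + 2)) ^ (p + 2) with hc2
  have p0 : 0 < c0 := by positivity
  have p1 : 0 < c1 := by positivity
  have p2 : 0 < c2 := by positivity
  -- One constant serves all three estimates: `c1` for linear growth in `t`, `p * c1 + c2` for the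
  -- time derivative, `c0` for the size of the kernel.
  refine ⟨D * (c0 + c1 + p * c1 + c2), by positivity, fun q hq => ?_⟩
  have b0 : ∀ t, 0 < t → heatKernel p q t ≤ D * c0 * q ^ (-p) := fun t ht => by
    have := mul_le_mul_of_nonneg_left (rpow_mul_exp_le hp hq ht) hDpos.le
    rw [heatKernel]; linarith
  have qp : 0 < q ^ (-p) := by positivity
  have qp1 : 0 < q ^ (-(p + 1)) := by positivity
  refine ⟨fun t ht => ?_, fun t s ht hs => le_min ?_ ?_⟩
  · have := mul_le_mul_of_nonneg_left (rpow_mul_exp_le (by linarith : 0 < p + 1) hq ht)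
      (mul_pos hDpos ht).le
    have e : t ^ (-p) = t * t ^ (-(p + 1)) := by
      rw [← Real.rpow_one_add' ht.le (by linarith)]; congr 1; ring
    rw [heatKernel, e]
    calc _ = D * t * (t ^ (-(p + 1)) * Real.exp (-(q / (4 * t)))) := by rw [hD]; ring
      _ ≤ D * t * (c1 * q ^ (-(p + 1))) := this
      _ = D * c1 * (q ^ (-(p + 1)) * t) := by ring
      _ ≤ D * (c0 + c1 + p * c1 + c2) * (q ^ (-(p + 1)) * t) := by
        gcongr; nlinarith [mul_pos hp p1]
      _ = _ := by ring
  · have hder : ∀ x ∈ Set.Ioi (0 : ℝ), ‖(4 * Real.pi) ^ (-p) *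
      (-p * (x ^ (-(p + 1)) * Real.exp (-(q / (4 * x)))) +
        q / 4 * (x ^ (-(p + 2)) * Real.exp (-(q / (4 * x)))))‖ ≤
        D * (c0 + c1 + p * c1 + c2) * q ^ (-(p + 1)) := by
      intro x hx
      have hx : 0 < x := hx
      have h1 := rpow_mul_exp_le (by linarith : 0 < p + 1) hq hx
      have h2 := rpow_mul_exp_le (by linarith : 0 < p + 2) hq hx
      have e : q ^ (-(p + 1)) = q * q ^ (-(p + 2)) := by
        rw [← Real.rpow_one_add' hq.le (by linarith)]; congr 1; ring
      have h3 : q * (x ^ (-(p + 2)) * Real.exp (-(q / (4 * x)))) ≤ c2 * q ^ (-(p + 1)) := by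
        rw [e]; nlinarith [mul_le_mul_of_nonneg_left h2 hq.le]
      have h4 : p * (x ^ (-(p + 1)) * Real.exp (-(q / (4 * x)))) ≤ p * (c1 * q ^ (-(p + 1))) :=
        mul_le_mul_of_nonneg_left h1 hp.le
      rw [norm_mul, Real.norm_of_nonneg hDpos.le, mul_assoc]
      refine mul_le_mul_of_nonneg_left ?_ hDpos.le
      have n1 : 0 ≤ p * (x ^ (-(p + 1)) * Real.exp (-(q / (4 * x)))) := by positivity
      have n2 : 0 ≤ q * (x ^ (-(p + 2)) * Real.exp (-(q / (4 * x)))) := by positivity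
      have n3 := mul_pos p0 qp1
      have n4 := mul_pos p1 qp1
      rw [Real.norm_eq_abs, abs_le]
      constructor <;> nlinarith
    -- The mean value inequality turns the derivative bound, uniform on the half-line, into a
    -- Lipschitz estimate.
    have := Convex.norm_image_sub_le_of_norm_hasDerivWithin_le (f := heatKernel p q)
      (fun x hx => (hasDerivAt_heatKernel p q hx).hasDerivWithinAt) hder (convex_Ioi 0)
      (show t + s ∈ Set.Ioi (0 : ℝ) from add_pos ht hs) (show t ∈ Set.Ioi (0 : ℝ) from ht)
    rwa [show t - (t + s) = -s by ring, norm_neg, Real.norm_of_nonneg hs.le] at this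
  · have h1 := b0 t ht
    have h2 := b0 (t + s) (by linarith)
    have h3 := heatKernel_pos p q ht
    have h4 := heatKernel_pos p q (add_pos ht hs)
    have h5 : D * c0 * q ^ (-p) ≤ D * (c0 + c1 + p * c1 + c2) * q ^ (-p) := by
      gcongr; nlinarith [mul_pos hp p1]
    rw [abs_le]; constructor <;> linarith

/-- Tonelli for the series of norms. It serves both the lattice sums under the subordination
integral and the random series of squared noise coefficients. -/
lemma integrable_tsum_of_summable_integral_norm {X ι : Type*} [MeasurableSpace X] {ν : Measure X}
    [Countable ι] {F : ι → X → ℝ} (hF : ∀ i, Integrable (F i) ν)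
    (hs : Summable fun i => ∫ x, ‖F i x‖ ∂ν) :
    (∀ᵐ x ∂ν, Summable fun i => ‖F i x‖) ∧ Integrable (fun x => ∑' i, F i x) ν := by
  have hfin : ∫⁻ x, ∑' i, ‖F i x‖ₑ ∂ν < ⊤ := by
    rw [lintegral_tsum fun i => (hF i).1.enorm]
    have : ∀ i, ∫⁻ x, ‖F i x‖ₑ ∂ν = ENNReal.ofReal (∫ x, ‖F i x‖ ∂ν) := fun i =>
      (ofReal_integral_norm_eq_lintegral_enorm (hF i)).symm
    simp_rw [this]
    exact hs.tsum_ofReal_lt_top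
  have hsum : ∀ᵐ x ∂ν, Summable fun i => ‖F i x‖ := by
    filter_upwards [ae_lt_top' (AEMeasurable.tsum fun i => (hF i).1.enorm) hfin.ne]
      with x hx
    simp_rw [enorm_eq_nnnorm] at hx
    exact NNReal.summable_coe.2 (ENNReal.tsum_coe_ne_top_iff_summable.1 hx.ne)
  refine ⟨hsum, ?_, ?_⟩
  · refine aestronglyMeasurable_of_tendsto_ae atTop
      (f := fun (t : Finset ι) x => ∑ i ∈ t, F i x) (fun t => ?_) ?_
    · exact Finset.aestronglyMeasurable_fun_sum t fun i _ => (hF i).1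
    · filter_upwards [hsum] with x hx using hx.of_norm.hasSum
  · refine lt_of_le_of_lt (lintegral_mono_ae ?_) hfin
    filter_upwards [hsum] with x hx
    exact enorm_tsum_le_tsum_enorm

/-- The value at coinciding times of the subordinated heat kernel at unit distance. -/
def subordConst (p : ℝ) : ℝ :=
  (2 * Real.sqrt Real.pi)⁻¹ * (4 * Real.pi) ^ (-p) * (4 ^ (p + 1 / 2) * Real.Gamma (p + 1 / 2))

/-- The substitution `s ↦ 1/s` yields a Gamma integral. Up to sign this is the contribution of one
nonzero image as `τ → 0⁺`. -/
lemma integral_heatKernel {p q : ℝ} (hp : 0 < p) (hq : 0 < q) :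
    (2 * Real.sqrt Real.pi)⁻¹ * ∫ s in Set.Ioi (0 : ℝ), heatKernel p q s * s ^ (-(3 / 2) : ℝ) =
      subordConst p * q ^ (-(p + 1 / 2)) := by
  have hG := Real.integral_rpow_mul_exp_neg_mul_Ioi (a := p + 1 / 2) (r := q / 4)
    (by linarith) (by linarith)
  rw [← integral_comp_rpow_Ioi _ (by norm_num : (-1 : ℝ) ≠ 0)] at hG
  have h : ∀ s ∈ Set.Ioi (0 : ℝ), heatKernel p q s * s ^ (-(3 / 2) : ℝ) =
      (4 * Real.pi) ^ (-p) * ((|(-1 : ℝ)| * s ^ ((-1 : ℝ) - 1)) •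
        ((s ^ (-1 : ℝ)) ^ (p + 1 / 2 - 1) * Real.exp (-(q / 4 * s ^ (-1 : ℝ))))) := by
    intro s hs
    have hs : 0 < s := hs
    rw [← Real.rpow_mul hs.le, smul_eq_mul, abs_neg, abs_one, one_mul, heatKernel,
      Real.rpow_neg_one, show q / 4 * s⁻¹ = q / (4 * s) by field_simp]
    have : s ^ (-p) * s ^ (-(3 / 2) : ℝ) = s ^ ((-1 : ℝ) - 1) * s ^ (-1 * (p + 1 / 2 - 1)) := by
      rw [← Real.rpow_add hs, ← Real.rpow_add hs]; congr 1; ring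
    linear_combination ((4 * Real.pi) ^ (-p) * Real.exp (-(q / (4 * s)))) * this
  rw [setIntegral_congr_fun measurableSet_Ioi h, integral_const_mul, hG, subordConst,
    one_div (q / 4), inv_div, Real.div_rpow (by norm_num) hq.le, Real.rpow_neg hq.le]
  ring

lemma measurable_heatKernel (p q : ℝ) : Measurable (heatKernel p q) := by
  unfold heatKernel; fun_prop

/-- The sum over a lattice without its origin of subordinated heat kernels: exchange of sum and
subordination, and the limit `τ → 0⁺`. -/
lemma subord_tsum_heatKernel {ι : Type*} [Countable ι] {p : ℝ} (hp : 0 < p) {q : ι → ℝ}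
    (hq : ∀ i, 0 < q i) (hs : Summable fun i => q i ^ (-(p + 1 / 2)))
    (hK : ∀ t, 0 < t → Summable fun i => heatKernel p (q i) t) :
    (∀ τ, 0 < τ → SubordIntegrable (fun t => ∑' i, heatKernel p (q i) t) τ) ∧
    Tendsto (subord fun t => ∑' i, heatKernel p (q i) t) (𝓝[>] 0)
      (𝓝 (-(subordConst p * ∑' i, q i ^ (-(p + 1 / 2))))) := by
  obtain ⟨C, hC, hbound⟩ := exists_heatKernel_bound hp
  set F : ℝ → ι → ℝ → ℝ := fun τ i s =>
    (heatKernel p (q i) τ - heatKernel p (q i) (τ + s)) * s ^ (-(3 / 2) : ℝ) with hF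
  -- A majorant independent of `τ`. Its integral is proportional to the geometric mean of
  -- `q^{-(p+1)}` and `q^{-p}`, that is `q^{-(p+1/2)}`, the quantity assumed summable.
  set M : ι → ℝ → ℝ := fun i s =>
    min (C * q i ^ (-(p + 1)) * s) (C * q i ^ (-p)) * s ^ (-(3 / 2) : ℝ) with hM
  have hMi : ∀ i, IntegrableOn (M i) (Set.Ioi 0) ∧
      ∫ s in Set.Ioi (0 : ℝ), M i s = 4 * C * q i ^ (-(p + 1 / 2)) := by
    intro i
    have hqi := hq i
    obtain ⟨h1, h2⟩ := integral_min_mul_rpow (A := C * q i ^ (-(p + 1))) (B := C * q i ^ (-p))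
      (by positivity) (by positivity)
    refine ⟨h1, h2.trans ?_⟩
    have : C * q i ^ (-(p + 1)) * (C * q i ^ (-p)) = (C * q i ^ (-(p + 1 / 2))) ^ 2 := by
      have : q i ^ (-(p + 1)) * q i ^ (-p) = q i ^ (-(p + 1 / 2)) * q i ^ (-(p + 1 / 2)) := by
        rw [← Real.rpow_add hqi, ← Real.rpow_add hqi]; congr 1; ring
      linear_combination C ^ 2 * this
    rw [this, Real.sqrt_sq (by positivity)]
    ring
  have hFM : ∀ τ, 0 < τ → ∀ i, ∀ s ∈ Set.Ioi (0 : ℝ), ‖F τ i s‖ ≤ M i s := by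
    intro τ hτ i s hs'
    have hs' : 0 < s := hs'
    simp only [hF, hM]
    rw [norm_mul, Real.norm_of_nonneg (by positivity : 0 ≤ s ^ (-(3 / 2) : ℝ))]
    exact mul_le_mul_of_nonneg_right ((hbound _ (hq i)).2 τ s hτ hs') (by positivity)
  have hFmeas : ∀ τ i, Measurable (F τ i) := by
    intro τ i
    have := measurable_heatKernel p (q i)
    simp only [hF]
    fun_prop
  have hFi : ∀ τ, 0 < τ → ∀ i, IntegrableOn (F τ i) (Set.Ioi 0) := fun τ hτ i =>
    (hMi i).1.mono' (hFmeas τ i).aestronglyMeasurable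
      ((ae_restrict_iff' measurableSet_Ioi).2 (Eventually.of_forall (hFM τ hτ i)))
  have hFn : ∀ τ, 0 < τ → ∀ i, ∫ s in Set.Ioi (0 : ℝ), ‖F τ i s‖ ≤
      4 * C * q i ^ (-(p + 1 / 2)) := fun τ hτ i => by
    rw [← (hMi i).2]
    exact setIntegral_mono_on (hFi τ hτ i).norm (hMi i).1 measurableSet_Ioi (hFM τ hτ i)
  have hsC := hs.mul_left (4 * C)
  have hFs : ∀ τ, 0 < τ → Summable fun i => ∫ s in Set.Ioi (0 : ℝ), ‖F τ i s‖ := fun τ hτ =>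
    Summable.of_nonneg_of_le (fun i => integral_nonneg fun s => norm_nonneg _) (hFn τ hτ) hsC
  have hFt : ∀ τ, 0 < τ → ∀ s ∈ Set.Ioi (0 : ℝ), ∑' i, F τ i s = ((∑' i, heatKernel p (q i) τ)
      - ∑' i, heatKernel p (q i) (τ + s)) * s ^ (-(3 / 2) : ℝ) := by
    intro τ hτ s hs'
    have hs' : 0 < s := hs'
    rw [← (hK τ hτ).tsum_sub (hK (τ + s) (by linarith)), ← tsum_mul_right]
  have hsub : ∀ τ, 0 < τ → subord (fun t => ∑' i, heatKernel p (q i) t) τ =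
      ∑' i, (2 * Real.sqrt Real.pi)⁻¹ * ∫ s in Set.Ioi (0 : ℝ), F τ i s := by
    intro τ hτ
    rw [subord, ← setIntegral_congr_fun measurableSet_Ioi (hFt τ hτ), tsum_mul_left,
      integral_tsum_of_summable_integral_norm (hFi τ hτ) (hFs τ hτ)]
  refine ⟨fun τ hτ => ?_, ?_⟩
  · exact IntegrableOn.congr_fun (integrable_tsum_of_summable_integral_norm (hFi τ hτ) (hFs τ hτ)).2
      (hFt τ hτ) measurableSet_Ioi
  · have hlim : ∀ i, Tendsto (fun τ => (2 * Real.sqrt Real.pi)⁻¹ *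
        ∫ s in Set.Ioi (0 : ℝ), F τ i s) (𝓝[>] 0)
        (𝓝 (-(subordConst p * q i ^ (-(p + 1 / 2))))) := by
      intro i
      rw [← integral_heatKernel hp (hq i), ← mul_neg, ← integral_neg]
      refine Tendsto.const_mul _ ?_
      refine tendsto_integral_filter_of_dominated_convergence (M i)
        (Eventually.of_forall fun τ => (hFmeas τ i).aestronglyMeasurable) ?_ (hMi i).1 ?_
      · filter_upwards [self_mem_nhdsWithin] with τ hτ
        exact (ae_restrict_iff' measurableSet_Ioi).2 (Eventually.of_forall (hFM τ hτ i))
      · refine (ae_restrict_iff' measurableSet_Ioi).2 (Eventually.of_forall fun s hs' => ?_)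
        have hs' : 0 < s := hs'
        -- Off the diagonal the heat kernel vanishes at time zero, so only the term `-heatKernel p
        -- (q i) s` survives in the limit.
        have h0 : Tendsto (heatKernel p (q i)) (𝓝[>] 0) (𝓝 0) := by
          refine squeeze_zero' (g := fun t => C * q i ^ (-(p + 1)) * t) ?_ ?_ ?_
          · filter_upwards [self_mem_nhdsWithin] with t ht using (heatKernel_pos _ _ ht).le
          · filter_upwards [self_mem_nhdsWithin] with t ht using (hbound _ (hq i)).1 t ht
          · have : Tendsto (fun t : ℝ => C * q i ^ (-(p + 1)) * t) (𝓝 0)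
                (𝓝 (C * q i ^ (-(p + 1)) * 0)) := tendsto_id.const_mul _
            rw [mul_zero] at this
            exact this.mono_left nhdsWithin_le_nhds
        have h1 : Tendsto (fun τ => heatKernel p (q i) (τ + s)) (𝓝[>] 0)
            (𝓝 (heatKernel p (q i) s)) := by
          have hc := (hasDerivAt_heatKernel p (q i) hs').continuousAt.tendsto
          refine hc.comp ?_
          have : Tendsto (fun τ : ℝ => τ + s) (𝓝 0) (𝓝 (0 + s)) := tendsto_id.add_const s
          rw [zero_add] at this
          exact this.mono_left nhdsWithin_le_nhds
        have := (h0.sub h1).mul_const (s ^ (-(3 / 2) : ℝ))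
        rw [zero_sub, neg_mul] at this
        exact this
    -- A second dominated convergence, now over the lattice; the bound on each term is again
    -- independent of `τ`.
    have hdom := tendsto_tsum_of_dominated_convergence
      (bound := fun i => (2 * Real.sqrt Real.pi)⁻¹ * (4 * C * q i ^ (-(p + 1 / 2))))
      (hsC.mul_left _) hlim (by
        filter_upwards [self_mem_nhdsWithin] with τ hτ i
        rw [norm_mul, Real.norm_of_nonneg (by positivity : 0 ≤ (2 * Real.sqrt Real.pi)⁻¹)]
        exact mul_le_mul_of_nonneg_left
          ((norm_integral_le_integral_norm _).trans (hFn τ hτ i)) (by positivity))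
    rw [tsum_neg, tsum_mul_left] at hdom
    refine hdom.congr' ?_
    filter_upwards [self_mem_nhdsWithin] with τ hτ using (hsub τ hτ).symm

/-! ### Lattice sums and Poisson summation -/

lemma hasSum_mul_of_nonneg {ι κ : Type*} {f : ι → ℝ} {g : κ → ℝ} {a b : ℝ} (hf : HasSum f a)
    (hg : HasSum g b) (hf0 : ∀ i, 0 ≤ f i) (hg0 : ∀ i, 0 ≤ g i) :
    HasSum (fun x : ι × κ => f x.1 * g x.2) (a * b) := by
  have h := hf.summable.mul_of_nonneg hg.summable hf0 hg0
  have h2 := h.hasSum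
  rwa [← hf.summable.tsum_mul_tsum hg.summable h, hf.tsum_eq, hg.tsum_eq] at h2

lemma hasSum_pi_two {f g : ℤ → ℝ} {a b : ℝ} (hf : HasSum f a) (hg : HasSum g b)
    (hf0 : ∀ i, 0 ≤ f i) (hg0 : ∀ i, 0 ≤ g i) :
    HasSum (fun k : Fin 2 → ℤ => f (k 0) * g (k 1)) (a * b) := by
  let e : (Fin 2 → ℤ) ≃ ℤ × ℤ := finTwoArrowEquiv ℤ
  exact (e.hasSum_iff (f := fun x : ℤ × ℤ => f x.1 * g x.2)).2
    (hasSum_mul_of_nonneg hf hg hf0 hg0)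

lemma hasSum_pi_three {f g h : ℤ → ℝ} {a b c : ℝ} (hf : HasSum f a) (hg : HasSum g b)
    (hh : HasSum h c) (hf0 : ∀ i, 0 ≤ f i) (hg0 : ∀ i, 0 ≤ g i) (hh0 : ∀ i, 0 ≤ h i) :
    HasSum (fun k : Fin 3 → ℤ => f (k 0) * g (k 1) * h (k 2)) (a * b * c) := by
  let e : (Fin 3 → ℤ) ≃ (ℤ × ℤ) × ℤ :=
    { toFun := fun k => ((k 0, k 1), k 2)
      invFun := fun x => ![x.1.1, x.1.2, x.2]
      left_inv := fun k => by ext i; fin_cases i <;> rfl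
      right_inv := fun x => rfl }
  exact (e.hasSum_iff (f := fun x : (ℤ × ℤ) × ℤ => f x.1.1 * g x.1.2 * h x.2)).2
    (hasSum_mul_of_nonneg (f := fun x : ℤ × ℤ => f x.1 * g x.2)
      (hasSum_mul_of_nonneg hf hg hf0 hg0) hh (fun x => mul_nonneg (hf0 _) (hg0 _)) hh0)

/-- The heat trace `∑_{m ∈ ℤ} e^{-t(2πm/b)²}` of the circle of length `b`. -/
def circleTrace (b t : ℝ) : ℝ := ∑' m : ℤ, Real.exp (-(t * (2 * Real.pi * m / b) ^ 2))

lemma summable_exp_neg_mul_int_sq {c : ℝ} (hc : 0 < c) :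
    Summable fun m : ℤ => Real.exp (-(c * (m : ℝ) ^ 2)) := by
  have := summable_pow_mul_jacobiTheta₂_term_bound 0 (T := c / Real.pi)
    (by have := Real.pi_pos; positivity) 0
  refine this.congr fun m => ?_
  rw [pow_zero, one_mul]
  congr 1
  have := Real.pi_pos
  field_simp
  ring

lemma hasSum_circleTrace {b t : ℝ} (hb : 0 < b) (ht : 0 < t) :
    HasSum (fun m : ℤ => Real.exp (-(t * (2 * Real.pi * m / b) ^ 2))) (circleTrace b t) := by
  have hc : 0 < t * (2 * Real.pi / b) ^ 2 := by have := Real.pi_pos; positivity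
  refine Summable.hasSum ((summable_exp_neg_mul_int_sq hc).congr fun m => ?_)
  congr 1; ring

/-- Poisson summation for the heat trace of a circle. -/
lemma hasSum_circleTrace_dual {b t : ℝ} (hb : 0 < b) (ht : 0 < t) :
    HasSum (fun m : ℤ => b * ((4 * Real.pi) ^ (-(1 / 2) : ℝ) *
      (t ^ (-(1 / 2) : ℝ) * Real.exp (-(b ^ 2 * (m : ℝ) ^ 2 / (4 * t)))))) (circleTrace b t) := by
  have hpi := Real.pi_pos
  have ha : 0 < 4 * Real.pi * t / b ^ 2 := by positivity
  have h := Real.tsum_exp_neg_mul_int_sq ha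
  have hs := summable_exp_neg_mul_int_sq (c := b ^ 2 / (4 * t)) (by positivity)
  have e1 : circleTrace b t = ∑' n : ℤ, Real.exp (-Real.pi * (4 * Real.pi * t / b ^ 2) * n ^ 2) := by
    refine tsum_congr fun m => ?_
    congr 1; field_simp; ring
  have e2 : ∀ n : ℤ, Real.exp (-Real.pi / (4 * Real.pi * t / b ^ 2) * (n : ℝ) ^ 2) =
      Real.exp (-(b ^ 2 / (4 * t) * (n : ℝ) ^ 2)) := by
    intro n; congr 1; field_simp
  have e3 : 1 / (4 * Real.pi * t / b ^ 2) ^ (1 / 2 : ℝ) =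
      b * ((4 * Real.pi) ^ (-(1 / 2) : ℝ) * t ^ (-(1 / 2) : ℝ)) := by
    rw [Real.div_rpow (by positivity) (by positivity), Real.mul_rpow (by positivity) ht.le,
      Real.rpow_neg (by positivity), Real.rpow_neg ht.le, ← Real.sqrt_eq_rpow (b ^ 2),
      Real.sqrt_sq hb.le, one_div, inv_div, div_eq_mul_inv, mul_inv]
  rw [e1, h, e3]
  simp_rw [e2]
  refine (hs.hasSum.mul_left _).congr_fun fun m => ?_
  rw [show b ^ 2 * (m : ℝ) ^ 2 / (4 * t) = b ^ 2 / (4 * t) * (m : ℝ) ^ 2 by ring]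
  ring

/-- Squared lengths in the lattice of images of the slab. -/
def imageSq (L a : ℝ) (k : Fin 3 → ℤ) : ℝ :=
  L ^ 2 * (k 0 : ℝ) ^ 2 + L ^ 2 * (k 1 : ℝ) ^ 2 + (2 * a) ^ 2 * (k 2 : ℝ) ^ 2

/-- Squared lengths in the lattice of lateral images. -/
def lateralSq (L : ℝ) (k : Fin 2 → ℤ) : ℝ := L ^ 2 * (k 0 : ℝ) ^ 2 + L ^ 2 * (k 1 : ℝ) ^ 2

lemma hasSum_heatKernel_lateral {L t : ℝ} (hL : 0 < L) (ht : 0 < t) :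
    HasSum (fun k => L ^ 2 * heatKernel 1 (lateralSq L k) t) (circleTrace L t ^ 2) := by
  have h := hasSum_circleTrace_dual hL ht
  have hpi := Real.pi_pos
  rw [sq (circleTrace L t)]
  refine (hasSum_pi_two h h (fun m => by positivity) (fun m => by positivity)).congr_fun fun k => ?_
  have e1 : (4 * Real.pi) ^ (-1 : ℝ) = (4 * Real.pi) ^ (-(1 / 2) : ℝ) * (4 * Real.pi) ^ (-(1 / 2) : ℝ) := by
    rw [← Real.rpow_add (by positivity)]; norm_num
  have e2 : t ^ (-1 : ℝ) = t ^ (-(1 / 2) : ℝ) * t ^ (-(1 / 2) : ℝ) := by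
    rw [← Real.rpow_add ht]; norm_num
  rw [heatKernel, e1, e2, lateralSq, add_div, neg_add, Real.exp_add]
  ring

/-- The product of three one-dimensional Poisson formulas, whose exponents `1/2` add up to `3/2`.
The third period is `2a` because the Dirichlet slab is unfolded by reflection. -/
lemma hasSum_heatKernel_image {L a t : ℝ} (hL : 0 < L) (ha : 0 < a) (ht : 0 < t) :
    HasSum (fun k => L ^ 2 * (2 * a) * heatKernel (3 / 2) (imageSq L a k) t)
      (circleTrace L t ^ 2 * circleTrace (2 * a) t) := by
  have h := hasSum_circleTrace_dual hL ht
  have h' := hasSum_circleTrace_dual (b := 2 * a) (by positivity) ht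
  have hpi := Real.pi_pos
  rw [sq (circleTrace L t)]
  refine (hasSum_pi_three h h h' (fun m => by positivity) (fun m => by positivity)
    (fun m => by positivity)).congr_fun fun k => ?_
  have e1 : (4 * Real.pi) ^ (-(3 / 2) : ℝ) = (4 * Real.pi) ^ (-(1 / 2) : ℝ) *
      (4 * Real.pi) ^ (-(1 / 2) : ℝ) * (4 * Real.pi) ^ (-(1 / 2) : ℝ) := by
    rw [← Real.rpow_add (by positivity), ← Real.rpow_add (by positivity)]; norm_num
  have e2 : t ^ (-(3 / 2) : ℝ) = t ^ (-(1 / 2) : ℝ) * t ^ (-(1 / 2) : ℝ) * t ^ (-(1 / 2) : ℝ) := by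
    rw [← Real.rpow_add ht, ← Real.rpow_add ht]; norm_num
  rw [heatKernel, e1, e2, imageSq, add_div, add_div, neg_add, neg_add, Real.exp_add, Real.exp_add]
  ring

lemma summable_one_add_sq_rpow {r : ℝ} (hr : 1 / 2 < r) :
    Summable fun m : ℤ => (1 + (m : ℝ) ^ 2) ^ (-r) := by
  refine (Real.summable_abs_int_rpow (b := 2 * r) (by linarith)).of_norm_bounded_eventually ?_
  refine (Set.finite_singleton (0 : ℤ)).subset fun m hm => ?_
  by_contra h0
  refine hm (show ‖(1 + (m : ℝ) ^ 2) ^ (-r)‖ ≤ |(m : ℝ)| ^ (-(2 * r)) from ?_)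
  have h1 : (0 : ℝ) < |(m : ℝ)| := abs_pos.2 (by exact_mod_cast h0)
  rw [Real.norm_of_nonneg (by positivity), show -(2 * r) = ((2 : ℕ) : ℝ) * -r by push_cast; ring,
    Real.rpow_mul h1.le, Real.rpow_natCast, sq_abs]
  refine Real.rpow_le_rpow_of_nonpos (by rw [← sq_abs]; positivity) (by linarith) (by linarith)

lemma one_le_int_sq {m : ℤ} (h : m ≠ 0) : (1 : ℝ) ≤ (m : ℝ) ^ 2 := by
  have : (1 : ℤ) ≤ m ^ 2 := by have := sq_pos_of_ne_zero h; omega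
  exact_mod_cast this

lemma imageSq_pos {L a : ℝ} (hL : 0 < L) (ha : 0 < a) {k : Fin 3 → ℤ} (hk : k ≠ 0) :
    0 < imageSq L a k := by
  have : k 0 ≠ 0 ∨ k 1 ≠ 0 ∨ k 2 ≠ 0 := by
    by_contra! h
    exact hk (by ext i; fin_cases i <;> simp [h])
  unfold imageSq
  rcases this with h | h | h <;> have := one_le_int_sq h <;> positivity

lemma lateralSq_pos {L : ℝ} (hL : 0 < L) {k : Fin 2 → ℤ} (hk : k ≠ 0) : 0 < lateralSq L k := by
  have : k 0 ≠ 0 ∨ k 1 ≠ 0 := by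
    by_contra! h
    exact hk (by ext i; fin_cases i <;> simp [h])
  unfold lateralSq
  rcases this with h | h <;> have := one_le_int_sq h <;> positivity

/-- The form dominates a multiple of `1 + |k|²`, and `(1 + |k|²)^{-2}` is at most a product of three
factors `(1 + k_i²)^{-2/3}`, each summable since `2/3 > 1/2`. -/
lemma summable_imageSq {L a : ℝ} (hL : 0 < L) (ha : 0 < a) :
    Summable fun k : {k : Fin 3 → ℤ // k ≠ 0} => imageSq L a k ^ (-(3 / 2 + 1 / 2) : ℝ) := by
  have h := (summable_one_add_sq_rpow (r := 2 / 3) (by norm_num)).hasSum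
  have h3 := (hasSum_pi_three h h h (fun m => by positivity) (fun m => by positivity)
    (fun m => by positivity)).summable
  -- The factor `1/2` pays for the added `1`: away from the origin `1 + |k|² ≤ 2|k|²`.
  set c := min (L ^ 2) ((2 * a) ^ 2) / 2 with hc
  have hc0 : 0 < c := by positivity
  have hcL : 2 * c ≤ L ^ 2 := by rw [hc]; linarith [min_le_left (L ^ 2) ((2 * a) ^ 2)]
  have hca : 2 * c ≤ (2 * a) ^ 2 := by rw [hc]; linarith [min_le_right (L ^ 2) ((2 * a) ^ 2)]
  refine Summable.of_nonneg_of_le (fun k => ?_) (fun k => ?_)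
    ((h3.mul_left (c ^ (-2 : ℝ))).comp_injective (Subtype.val_injective (p := fun k => k ≠ 0)))
  · have := imageSq_pos hL ha k.2; positivity
  · obtain ⟨k, hk⟩ := k
    simp only [Function.comp_apply]
    set x := 1 + (k 0 : ℝ) ^ 2 with hx
    set y := 1 + (k 1 : ℝ) ^ 2 with hy
    set z := 1 + (k 2 : ℝ) ^ 2 with hz
    set w := 1 + (k 0 : ℝ) ^ 2 + (k 1 : ℝ) ^ 2 + (k 2 : ℝ) ^ 2 with hw
    have x0 : 0 < x := by positivity
    have y0 : 0 < y := by positivity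
    have z0 : 0 < z := by positivity
    have w0 : 0 < w := by positivity
    have hxw : x ≤ w := by nlinarith [sq_nonneg (k 1 : ℝ), sq_nonneg (k 2 : ℝ)]
    have hyw : y ≤ w := by nlinarith [sq_nonneg (k 0 : ℝ), sq_nonneg (k 2 : ℝ)]
    have hzw : z ≤ w := by nlinarith [sq_nonneg (k 0 : ℝ), sq_nonneg (k 1 : ℝ)]
    have hq : c * w ≤ imageSq L a k := by
      have hs : (1 : ℝ) ≤ (k 0 : ℝ) ^ 2 + (k 1 : ℝ) ^ 2 + (k 2 : ℝ) ^ 2 := by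
        have : k 0 ≠ 0 ∨ k 1 ≠ 0 ∨ k 2 ≠ 0 := by
          by_contra! h
          exact hk (by ext i; fin_cases i <;> simp [h])
        rcases this with h | h | h <;> have := one_le_int_sq h <;>
          nlinarith [sq_nonneg (k 0 : ℝ), sq_nonneg (k 1 : ℝ), sq_nonneg (k 2 : ℝ)]
      unfold imageSq
      nlinarith [mul_le_mul_of_nonneg_right hcL (sq_nonneg (k 0 : ℝ)),
        mul_le_mul_of_nonneg_right hcL (sq_nonneg (k 1 : ℝ)),
        mul_le_mul_of_nonneg_right hca (sq_nonneg (k 2 : ℝ))]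
    calc imageSq L a k ^ (-(3 / 2 + 1 / 2) : ℝ) ≤ (c * w) ^ (-(3 / 2 + 1 / 2) : ℝ) :=
          Real.rpow_le_rpow_of_nonpos (by positivity) hq (by norm_num)
      _ = c ^ (-2 : ℝ) * (w ^ (-(2 / 3) : ℝ) * w ^ (-(2 / 3) : ℝ) * w ^ (-(2 / 3) : ℝ)) := by
          rw [Real.mul_rpow hc0.le w0.le, ← Real.rpow_add w0, ← Real.rpow_add w0]; norm_num
      _ ≤ _ := by
          refine mul_le_mul_of_nonneg_left ?_ (by positivity)
          have hx' := Real.rpow_le_rpow_of_nonpos x0 hxw (by norm_num : (-(2 / 3) : ℝ) ≤ 0)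
          have hy' := Real.rpow_le_rpow_of_nonpos y0 hyw (by norm_num : (-(2 / 3) : ℝ) ≤ 0)
          have hz' := Real.rpow_le_rpow_of_nonpos z0 hzw (by norm_num : (-(2 / 3) : ℝ) ≤ 0)
          gcongr

/-- The two-dimensional analogue, distributing the exponent `3/2` as `3/4 + 3/4`. -/
lemma summable_lateralSq {L : ℝ} (hL : 0 < L) :
    Summable fun k : {k : Fin 2 → ℤ // k ≠ 0} => lateralSq L k ^ (-(1 + 1 / 2) : ℝ) := by
  have h := (summable_one_add_sq_rpow (r := 3 / 4) (by norm_num)).hasSum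
  have h2 := (hasSum_pi_two h h (fun m => by positivity) (fun m => by positivity)).summable
  set c := L ^ 2 / 2 with hc
  have hc0 : 0 < c := by positivity
  refine Summable.of_nonneg_of_le (fun k => ?_) (fun k => ?_)
    ((h2.mul_left (c ^ (-(3 / 2) : ℝ))).comp_injective
      (Subtype.val_injective (p := fun k => k ≠ 0)))
  · have := lateralSq_pos hL k.2; positivity
  · obtain ⟨k, hk⟩ := k
    simp only [Function.comp_apply]
    set x := 1 + (k 0 : ℝ) ^ 2 with hx
    set y := 1 + (k 1 : ℝ) ^ 2 with hy
    set w := 1 + (k 0 : ℝ) ^ 2 + (k 1 : ℝ) ^ 2 with hw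
    have x0 : 0 < x := by positivity
    have y0 : 0 < y := by positivity
    have w0 : 0 < w := by positivity
    have hxw : x ≤ w := by nlinarith [sq_nonneg (k 1 : ℝ)]
    have hyw : y ≤ w := by nlinarith [sq_nonneg (k 0 : ℝ)]
    have hq : c * w ≤ lateralSq L k := by
      have hs : (1 : ℝ) ≤ (k 0 : ℝ) ^ 2 + (k 1 : ℝ) ^ 2 := by
        have : k 0 ≠ 0 ∨ k 1 ≠ 0 := by
          by_contra! h
          exact hk (by ext i; fin_cases i <;> simp [h])
        rcases this with h | h <;> have := one_le_int_sq h <;>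
          nlinarith [sq_nonneg (k 0 : ℝ), sq_nonneg (k 1 : ℝ)]
      unfold lateralSq
      nlinarith
    calc lateralSq L k ^ (-(1 + 1 / 2) : ℝ) ≤ (c * w) ^ (-(1 + 1 / 2) : ℝ) :=
          Real.rpow_le_rpow_of_nonpos (by positivity) hq (by norm_num)
      _ = c ^ (-(3 / 2) : ℝ) * (w ^ (-(3 / 4) : ℝ) * w ^ (-(3 / 4) : ℝ)) := by
          rw [Real.mul_rpow hc0.le w0.le, ← Real.rpow_add w0]; norm_num
      _ ≤ _ := by
          refine mul_le_mul_of_nonneg_left ?_ (by positivity)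
          have hx' := Real.rpow_le_rpow_of_nonpos x0 hxw (by norm_num : (-(3 / 4) : ℝ) ≤ 0)
          have hy' := Real.rpow_le_rpow_of_nonpos y0 hyw (by norm_num : (-(3 / 4) : ℝ) ≤ 0)
          gcongr

/-! ### Asymptotics of the regularized zero-point sum of the plates -/

lemma subord_congr {f g : ℝ → ℝ} (h : ∀ t, 0 < t → f t = g t) {τ : ℝ} (hτ : 0 < τ) :
    subord f τ = subord g τ := by
  unfold subord
  congr 1
  refine setIntegral_congr_fun measurableSet_Ioi fun s hs => ?_
  rw [h τ hτ, h (τ + s) (add_pos hτ hs)]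

lemma SubordIntegrable.congr {f g : ℝ → ℝ} {τ : ℝ} (hf : SubordIntegrable f τ)
    (h : ∀ t, 0 < t → f t = g t) (hτ : 0 < τ) : SubordIntegrable g τ := by
  refine IntegrableOn.congr_fun hf (fun s hs => ?_) measurableSet_Ioi
  rw [h τ hτ, h (τ + s) (add_pos hτ hs)]

lemma SubordIntegrable.add {f g : ℝ → ℝ} {τ : ℝ} (hf : SubordIntegrable f τ)
    (hg : SubordIntegrable g τ) : SubordIntegrable (fun t => f t + g t) τ := by
  refine (Integrable.add hf hg).congr (Eventually.of_forall fun s => ?_)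
  simp only [Pi.add_apply]; ring

lemma SubordIntegrable.const_mul {f : ℝ → ℝ} {τ : ℝ} (c : ℝ) (hf : SubordIntegrable f τ) :
    SubordIntegrable (fun t => c * f t) τ := by
  refine (Integrable.const_mul hf c).congr (Eventually.of_forall fun s => ?_)
  simp only; ring

lemma subord_add {f g : ℝ → ℝ} {τ : ℝ} (hf : SubordIntegrable f τ) (hg : SubordIntegrable g τ) :
    subord (fun t => f t + g t) τ = subord f τ + subord g τ := by
  unfold SubordIntegrable IntegrableOn at hf hg
  unfold subord
  rw [← mul_add, ← integral_add hf hg]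
  congr 2 with s
  ring

lemma subord_const_mul (c : ℝ) (f : ℝ → ℝ) (τ : ℝ) :
    subord (fun t => c * f t) τ = c * subord f τ := by
  unfold subord
  rw [mul_left_comm, ← integral_const_mul c]
  congr 2 with s
  ring

/-- Half of the exponential absorbs the square root, since `√(τl) ≤ e^{τl/2}`. -/
lemma sqrt_mul_exp_le {l τ : ℝ} (hl : 0 ≤ l) (hτ : 0 < τ) :
    Real.sqrt l * Real.exp (-(τ * l)) ≤ (Real.sqrt τ)⁻¹ * Real.exp (-(τ / 2 * l)) := by
  have h1 : Real.sqrt τ * Real.sqrt l ≤ Real.exp (τ / 2 * l) := by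
    have h := Real.add_one_le_exp (τ / 2 * l)
    have h2 := sq_nonneg (Real.sqrt τ * Real.sqrt l - 1)
    have h3 := Real.mul_self_sqrt hl
    have h4 := Real.mul_self_sqrt hτ.le
    have h5 : (Real.sqrt τ * Real.sqrt l) ^ 2 = τ * l := by
      rw [mul_pow, sq, sq, h3, h4]
    nlinarith
  have hs := Real.sqrt_pos.2 hτ
  rw [show -(τ * l) = -(τ / 2 * l) + -(τ / 2 * l) by ring, Real.exp_add, ← mul_assoc,
    Real.exp_neg]
  refine mul_le_mul_of_nonneg_right ?_ (inv_pos.2 (Real.exp_pos _)).le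
  rw [← div_eq_mul_inv, div_le_iff₀ (Real.exp_pos _), ← div_eq_inv_mul, le_div_iff₀ hs]
  linarith

/-- The momentum integral of `|k| e^{-τ|k|²}` as a subordinated heat kernel on the diagonal. -/
lemma subord_heatKernel_zero (d : ℕ) {τ : ℝ} (hτ : 0 < τ) :
    SubordIntegrable (heatKernel (d / 2) 0) τ ∧
    ∫ k : EuclideanSpace ℝ (Fin d), ‖k‖ * Real.exp (-τ * ‖k‖ ^ 2) / (2 * Real.pi) ^ d =
      subord (heatKernel (d / 2) 0) τ := by
  have hpi := Real.pi_pos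
  have hg : ∀ t : ℝ, 0 < t → ∫ k : EuclideanSpace ℝ (Fin d), Real.exp (-(t * ‖k‖ ^ 2)) =
      (Real.pi / t) ^ ((d : ℝ) / 2) := fun t ht => by
    have := GaussianFourier.integral_rexp_neg_mul_sq_norm (V := EuclideanSpace ℝ (Fin d)) ht
    rw [finrank_euclideanSpace, Fintype.card_fin] at this
    rw [← this]
    simp
  have hgi : ∀ t : ℝ, 0 < t →
      Integrable fun k : EuclideanSpace ℝ (Fin d) => Real.exp (-(t * ‖k‖ ^ 2)) := fun t ht =>
    .of_integral_ne_zero (by rw [hg t ht]; positivity)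
  have hs : Integrable fun k : EuclideanSpace ℝ (Fin d) =>
      Real.sqrt (‖k‖ ^ 2) * Real.exp (-(τ * ‖k‖ ^ 2)) := by
    refine ((hgi (τ / 2) (by linarith)).const_mul (Real.sqrt τ)⁻¹).mono' (by fun_prop)
      (Eventually.of_forall fun k => ?_)
    rw [Real.norm_of_nonneg (by positivity)]
    exact sqrt_mul_exp_le (by positivity) hτ
  obtain ⟨h1, h2⟩ := subord_laplace (ν := (volume : Measure (EuclideanSpace ℝ (Fin d))))
    (l := fun k => ‖k‖ ^ 2) (by fun_prop) (fun k => by positivity) (hgi τ hτ) hs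
  have hK : ∀ t : ℝ, 0 < t → ((2 * Real.pi) ^ d)⁻¹ *
      ∫ k : EuclideanSpace ℝ (Fin d), Real.exp (-(t * ‖k‖ ^ 2)) = heatKernel (d / 2) 0 t := by
    intro t ht
    rw [hg t ht, heatKernel, zero_div, neg_zero, Real.exp_zero, mul_one,
      Real.div_rpow hpi.le ht.le, Real.rpow_neg ht.le, Real.rpow_neg (by positivity),
      show (4 : ℝ) * Real.pi = (2 * Real.pi) ^ 2 / Real.pi by field_simp; norm_num,
      Real.div_rpow (by positivity) hpi.le, ← Real.rpow_natCast (2 * Real.pi) 2,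
      ← Real.rpow_mul (by positivity), show ((2 : ℕ) : ℝ) * (d / 2) = d by push_cast; ring,
      Real.rpow_natCast]
    field_simp
  constructor
  · exact (SubordIntegrable.const_mul ((2 * Real.pi) ^ d)⁻¹ h1).congr hK hτ
  · rw [← subord_congr hK hτ, subord_const_mul, ← h2, ← integral_const_mul]
    refine integral_congr_ae (Eventually.of_forall fun k => ?_)
    simp only
    rw [Real.sqrt_sq (norm_nonneg k), neg_mul]
    ring

/-- On the diagonal the heat kernel is homogeneous of degree `-p` in time, so rescaling `s` by `τ`
leaves a pure power. The subtraction therefore carries no hidden constant term. -/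
lemma subord_heatKernel_zero_scaling (p : ℝ) {τ : ℝ} (hτ : 0 < τ) :
    subord (heatKernel p 0) τ = subord (heatKernel p 0) 1 * τ ^ (-(p + 1 / 2)) := by
  have h := integral_comp_mul_left_Ioi
    (fun s => (heatKernel p 0 τ - heatKernel p 0 (τ + s)) * s ^ (-(3 / 2) : ℝ)) 0 hτ
  rw [mul_zero] at h
  have hk : ∀ t, 0 < t → heatKernel p 0 (τ * t) = τ ^ (-p) * heatKernel p 0 t := fun t ht => by
    simp only [heatKernel, zero_div, neg_zero, Real.exp_zero, mul_one]
    rw [Real.mul_rpow hτ.le ht.le]; ring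
  have e : ∀ s ∈ Set.Ioi (0 : ℝ), (heatKernel p 0 τ - heatKernel p 0 (τ + τ * s)) *
      (τ * s) ^ (-(3 / 2) : ℝ) = τ ^ (-p) * τ ^ (-(3 / 2) : ℝ) *
        ((heatKernel p 0 1 - heatKernel p 0 (1 + s)) * s ^ (-(3 / 2) : ℝ)) := by
    intro s hs
    have hs : 0 < s := hs
    have h1 := hk 1 one_pos
    rw [mul_one] at h1
    rw [show τ + τ * s = τ * (1 + s) by ring, hk (1 + s) (by linarith), h1,
      Real.mul_rpow hτ.le hs.le]
    ring
  rw [setIntegral_congr_fun measurableSet_Ioi e, integral_const_mul, smul_eq_mul,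
    eq_inv_mul_iff_mul_eq₀ hτ.ne'] at h
  have ep : τ * (τ ^ (-p) * τ ^ (-(3 / 2) : ℝ)) = τ ^ (-(p + 1 / 2)) := by
    nth_rewrite 1 [← Real.rpow_one τ]
    rw [← Real.rpow_add hτ, ← Real.rpow_add hτ]
    congr 1; ring
  unfold subord
  rw [← h, ← ep]
  ring

/-- The heat trace of the plate operator. -/
def plateTrace (L a t : ℝ) : ℝ := circleTrace L t ^ 2 * (circleTrace (2 * a) t - 1) / 2

/-- The finite part of `∑ √λ e^{-τλ}` for the plate operator, as a sum over images. -/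
def plateFinite (L a : ℝ) : ℝ :=
  -(L ^ 2 * a * (subordConst (3 / 2) *
    ∑' k : {k : Fin 3 → ℤ // k ≠ 0}, imageSq L a k ^ (-(3 / 2 + 1 / 2) : ℝ))) +
  L ^ 2 / 2 * (subordConst 1 *
    ∑' k : {k : Fin 2 → ℤ // k ≠ 0}, lateralSq L k ^ (-(1 + 1 / 2) : ℝ))

lemma tsum_eq_zero_add_ne_zero {d : ℕ} {f : (Fin d → ℤ) → ℝ} (hf : Summable f) :
    ∑' k, f k = f 0 + ∑' k : {k : Fin d → ℤ // k ≠ 0}, f k := by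
  have h := Summable.tsum_add_tsum_compl (s := ({0} : Set (Fin d → ℤ))) (hf.subtype _) (hf.subtype _)
  rw [← h, tsum_singleton]
  rfl

/-- The full circle trace of length `2a` yields the three-dimensional images; deleting its zero mode
yields the two-dimensional lateral ones. The origins of both lattices are separated because they
carry all the divergences. -/
lemma plateTrace_eq {L a t : ℝ} (hL : 0 < L) (ha : 0 < a) (ht : 0 < t) :
    plateTrace L a t = (L ^ 2 * a * heatKernel (3 / 2) 0 t + -(L ^ 2 / 2) * heatKernel 1 0 t) +
      (L ^ 2 * a * ∑' k : {k : Fin 3 → ℤ // k ≠ 0}, heatKernel (3 / 2) (imageSq L a k) t +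
        -(L ^ 2 / 2) * ∑' k : {k : Fin 2 → ℤ // k ≠ 0}, heatKernel 1 (lateralSq L k) t) := by
  have h3 := hasSum_heatKernel_image hL ha ht
  have h2 := hasSum_heatKernel_lateral hL ht
  have s3 := (summable_mul_left_iff (by positivity : L ^ 2 * (2 * a) ≠ 0)).1 h3.summable
  have s2 := (summable_mul_left_iff (by positivity : L ^ 2 ≠ 0)).1 h2.summable
  have e3 := h3.tsum_eq
  have e2 := h2.tsum_eq
  rw [tsum_mul_left, tsum_eq_zero_add_ne_zero s3] at e3
  rw [tsum_mul_left, tsum_eq_zero_add_ne_zero s2] at e2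
  have z3 : imageSq L a 0 = 0 := by simp [imageSq]
  have z2 : lateralSq L 0 = 0 := by simp [lateralSq]
  rw [z3] at e3
  rw [z2] at e2
  rw [plateTrace, mul_sub, ← e3, mul_one, ← e2]
  ring

/-- Subordination is linear: the origin terms cancel against the subtraction, and
`subord_tsum_heatKernel` gives the limits of the rest. -/
lemma tendsto_subord_plateTrace {L a : ℝ} (hL : 0 < L) (ha : 0 < a) :
    Tendsto (fun τ => subord (plateTrace L a) τ - (L ^ 2 * a * subord (heatKernel (3 / 2) 0) τ
      - L ^ 2 / 2 * subord (heatKernel 1 0) τ)) (𝓝[>] 0) (𝓝 (plateFinite L a)) := by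
  have s3 : ∀ t, 0 < t → Summable fun k : {k : Fin 3 → ℤ // k ≠ 0} =>
      heatKernel (3 / 2) (imageSq L a k) t := fun t ht =>
    ((summable_mul_left_iff (by positivity : L ^ 2 * (2 * a) ≠ 0)).1
      (hasSum_heatKernel_image hL ha ht).summable).comp_injective
      (Subtype.val_injective (p := fun k => k ≠ 0))
  have s2 : ∀ t, 0 < t → Summable fun k : {k : Fin 2 → ℤ // k ≠ 0} =>
      heatKernel 1 (lateralSq L k) t := fun t ht =>
    ((summable_mul_left_iff (by positivity : L ^ 2 ≠ 0)).1
      (hasSum_heatKernel_lateral hL ht).summable).comp_injective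
      (Subtype.val_injective (p := fun k => k ≠ 0))
  obtain ⟨i3, l3⟩ := subord_tsum_heatKernel (by norm_num : (0 : ℝ) < 3 / 2)
    (fun k : {k : Fin 3 → ℤ // k ≠ 0} => imageSq_pos hL ha k.2) (summable_imageSq hL ha) s3
  obtain ⟨i2, l2⟩ := subord_tsum_heatKernel (one_pos : (0 : ℝ) < 1)
    (fun k : {k : Fin 2 → ℤ // k ≠ 0} => lateralSq_pos hL k.2) (summable_lateralSq hL) s2
  have hlim := (l3.const_mul (L ^ 2 * a)).add (l2.const_mul (-(L ^ 2 / 2)))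
  have hval : L ^ 2 * a * -(subordConst (3 / 2) *
      ∑' k : {k : Fin 3 → ℤ // k ≠ 0}, imageSq L a k ^ (-(3 / 2 + 1 / 2) : ℝ)) +
      -(L ^ 2 / 2) * -(subordConst 1 *
      ∑' k : {k : Fin 2 → ℤ // k ≠ 0}, lateralSq L k ^ (-(1 + 1 / 2) : ℝ)) = plateFinite L a := by
    unfold plateFinite; ring
  rw [hval] at hlim
  refine hlim.congr' ?_
  filter_upwards [self_mem_nhdsWithin] with τ hτ
  have hτ : 0 < τ := hτ
  have z3 := (subord_heatKernel_zero 3 hτ).1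
  have z2 := (subord_heatKernel_zero 2 hτ).1
  norm_num at z3 z2
  rw [subord_congr (fun t ht => plateTrace_eq hL ha ht) hτ,
    subord_add ((z3.const_mul _).add (z2.const_mul _))
      ((SubordIntegrable.const_mul _ (i3 τ hτ)).add (SubordIntegrable.const_mul _ (i2 τ hτ))),
    subord_add (z3.const_mul _) (z2.const_mul _),
    subord_add (SubordIntegrable.const_mul _ (i3 τ hτ)) (SubordIntegrable.const_mul _ (i2 τ hτ)),
    subord_const_mul, subord_const_mul, subord_const_mul, subord_const_mul]
  ring

/-! ### The large-area limit of the image sums and `ζ(4)`. -/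

lemma subordConst_three_halves : subordConst (3 / 2) = 1 / Real.pi ^ 2 := by
  have hpi := Real.pi_pos
  have e : (4 * Real.pi) ^ (-(3 / 2) : ℝ) = (8 * Real.pi * Real.sqrt Real.pi)⁻¹ := by
    rw [Real.rpow_neg (by positivity), show (3 / 2 : ℝ) = 1 + 1 / 2 by norm_num,
      Real.rpow_add (by positivity), Real.rpow_one, ← Real.sqrt_eq_rpow,
      Real.sqrt_mul (by norm_num), show (4 : ℝ) = 2 ^ 2 by norm_num, Real.sqrt_sq (by norm_num)]
    ring
  rw [subordConst, e, show (3 / 2 + 1 / 2 : ℝ) = 2 by norm_num, Real.Gamma_two]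
  have h := Real.mul_self_sqrt hpi.le
  have := Real.sqrt_pos.2 hpi
  norm_num
  field_simp
  linear_combination -16 * h

/-- Images with a lateral displacement recede to infinity. The remaining column sums to `2 ζ(4) /
(2a)⁴ = π⁴ / (720 a⁴)`. -/
lemma tendsto_tsum_imageSq {a : ℝ} (ha : 0 < a) :
    Tendsto (fun L : ℝ => ∑' k : {k : Fin 3 → ℤ // k ≠ 0},
      imageSq L a k ^ (-(3 / 2 + 1 / 2) : ℝ)) atTop (𝓝 (Real.pi ^ 4 / (720 * a ^ 4))) := by
  set F : (Fin 3 → ℤ) → ℝ := fun k =>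
    if k 0 = 0 ∧ k 1 = 0 then ((2 * a) ^ 2 * (k 2 : ℝ) ^ 2) ^ (-2 : ℝ) else 0 with hF
  have hlim : ∀ k : {k : Fin 3 → ℤ // k ≠ 0}, Tendsto (fun L : ℝ =>
      imageSq L a k ^ (-(3 / 2 + 1 / 2) : ℝ)) atTop (𝓝 (F k)) := by
    rintro ⟨k, hk⟩
    simp only [hF]
    split_ifs with h
    · simp only [imageSq, h.1, h.2]
      norm_num
    · have h' : k 0 ≠ 0 ∨ k 1 ≠ 0 := by by_contra! h2; exact h h2
      have h1 : (1 : ℝ) ≤ (k 0 : ℝ) ^ 2 + (k 1 : ℝ) ^ 2 := by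
        rcases h' with h | h <;> have := one_le_int_sq h <;>
          nlinarith [sq_nonneg (k 0 : ℝ), sq_nonneg (k 1 : ℝ)]
      have : Tendsto (fun L : ℝ => imageSq L a k) atTop atTop := by
        refine tendsto_atTop_mono (fun L => ?_) (tendsto_pow_atTop two_ne_zero)
        unfold imageSq
        nlinarith [sq_nonneg L, sq_nonneg (2 * a * (k 2 : ℝ)), mul_le_mul_of_nonneg_left h1 (sq_nonneg L)]
      exact (tendsto_rpow_neg_atTop (by norm_num)).comp this
  -- For `L ≥ 1` each term is bounded by its value at `L = 1`.
  have hdom := tendsto_tsum_of_dominated_convergence (summable_imageSq one_pos ha) hlim (by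
    filter_upwards [eventually_ge_atTop 1] with L hL k
    have h1 := imageSq_pos one_pos ha k.2
    have h2 := imageSq_pos (L := L) (by linarith) ha k.2
    rw [Real.norm_of_nonneg (by positivity)]
    refine Real.rpow_le_rpow_of_nonpos h1 ?_ (by norm_num)
    have hL2 : (1 : ℝ) ^ 2 ≤ L ^ 2 := pow_le_pow_left₀ zero_le_one hL 2
    unfold imageSq
    gcongr)
  have hsum : ∑' k : {k : Fin 3 → ℤ // k ≠ 0}, F k = Real.pi ^ 4 / (720 * a ^ 4) := by
    -- The origin may be put back because `0 ^ (-2) = 0` for the real power.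
    have e1 : ∑' k : {k : Fin 3 → ℤ // k ≠ 0}, F k = ∑' k, F k := by
      refine tsum_subtype_eq_of_support_subset (s := {k | k ≠ 0}) (f := F) ?_
      intro k hk h0
      refine hk ?_
      have h0 : k = 0 := h0
      simp [hF, h0]
    have hinj : Function.Injective fun m : ℤ => (![0, 0, m] : Fin 3 → ℤ) := fun m n h => by
      simpa using congrFun h 2
    have h4 : HasSum (fun m : ℤ => ((2 * a) ^ 2 * (m : ℝ) ^ 2) ^ (-2 : ℝ))
        (Real.pi ^ 4 / (720 * a ^ 4)) := by
      have hz := (hasSum_zeta_four).mul_left (((2 * a) ^ 4)⁻¹)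
      have hn : ∀ n : ℕ, ((2 * a) ^ 4)⁻¹ * (1 / (n : ℝ) ^ 4) =
          ((2 * a) ^ 2 * ((n : ℤ) : ℝ) ^ 2) ^ (-2 : ℝ) := fun n => by
        rw [Real.rpow_neg (by positivity), show (2 : ℝ) = ((2 : ℕ) : ℝ) by norm_num,
          Real.rpow_natCast, Int.cast_natCast, one_div, ← mul_inv]
        congr 1; ring
      simp_rw [hn] at hz
      have := hz.of_nat_of_neg (f := fun m : ℤ => ((2 * a) ^ 2 * (m : ℝ) ^ 2) ^ (-2 : ℝ))
        (by simpa using hz)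
      have h0 : ((2 * a) ^ 2 * ((0 : ℤ) : ℝ) ^ 2) ^ (-2 : ℝ) = 0 := by simp
      have hv : ((2 * a) ^ 4)⁻¹ * (Real.pi ^ 4 / 90) + ((2 * a) ^ 4)⁻¹ * (Real.pi ^ 4 / 90) =
          Real.pi ^ 4 / (720 * a ^ 4) := by
        field_simp
        norm_num
      rwa [h0, sub_zero, hv] at this
    rw [e1, ← hinj.tsum_eq (f := F), ← h4.tsum_eq]
    · refine tsum_congr fun m => ?_
      simp [hF]
    · intro k hk
      simp only [hF, Function.mem_support, ne_eq, ite_eq_right_iff, not_forall] at hk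
      obtain ⟨⟨h0, h1⟩, -⟩ := hk
      exact ⟨k 2, by ext i; fin_cases i <;> simp [h0, h1]⟩
  rw [hsum] at hdom
  exact hdom

/-- By homogeneity the sum is `L⁻³` times its value at `L = 1`, for `L > 0`. -/
lemma tendsto_tsum_lateralSq :
    Tendsto (fun L : ℝ => ∑' k : {k : Fin 2 → ℤ // k ≠ 0},
      lateralSq L k ^ (-(1 + 1 / 2) : ℝ)) atTop (𝓝 0) := by
  have h : ∀ k : {k : Fin 2 → ℤ // k ≠ 0}, ∀ L : ℝ, lateralSq L k ^ (-(1 + 1 / 2) : ℝ) =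
      (L ^ 2) ^ (-(1 + 1 / 2) : ℝ) * lateralSq 1 k ^ (-(1 + 1 / 2) : ℝ) := fun k L => by
    rw [← Real.mul_rpow (sq_nonneg L) (lateralSq_pos one_pos k.2).le]
    congr 1
    simp only [lateralSq]; ring
  have h' : ∀ L : ℝ, ∑' k : {k : Fin 2 → ℤ // k ≠ 0}, lateralSq L k ^ (-(1 + 1 / 2) : ℝ) =
      (L ^ 2) ^ (-(1 + 1 / 2) : ℝ) *
        ∑' k : {k : Fin 2 → ℤ // k ≠ 0}, lateralSq 1 k ^ (-(1 + 1 / 2) : ℝ) := fun L => by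
    rw [← tsum_mul_left]
    exact tsum_congr fun k => h k L
  rw [funext h']
  rw [← zero_mul (∑' k : {k : Fin 2 → ℤ // k ≠ 0}, lateralSq 1 k ^ (-(1 + 1 / 2) : ℝ))]
  exact ((tendsto_rpow_neg_atTop (by norm_num)).comp (tendsto_pow_atTop two_ne_zero)).mul_const _

/-- The finite part per unit area tends to the Casimir value. -/
lemma tendsto_plateFinite_div {a : ℝ} (ha : 0 < a) :
    Tendsto (fun L : ℝ => plateFinite L a / L ^ 2) atTop (𝓝 (-(Real.pi ^ 2 / (720 * a ^ 3)))) := by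
  have h := (((tendsto_tsum_imageSq ha).const_mul (subordConst (3 / 2))).const_mul (-a)).add
    ((tendsto_tsum_lateralSq.const_mul (subordConst 1)).const_mul (1 / 2))
  have hv : -a * (subordConst (3 / 2) * (Real.pi ^ 4 / (720 * a ^ 4))) +
      1 / 2 * (subordConst 1 * 0) = -(Real.pi ^ 2 / (720 * a ^ 3)) := by
    rw [subordConst_three_halves]
    have := Real.pi_pos
    field_simp
    ring
  rw [hv] at h
  refine h.congr' ?_
  filter_upwards [eventually_gt_atTop 0] with L hL
  rw [plateFinite]
  field_simp

/-! ### Parseval's identity for the plate modes -/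

/-- Lebesgue measure on the box `∏ [0, b i]`, as a product measure. -/
def boxMeasure (b : Fin 3 → ℝ) : Measure (Fin 3 → ℝ) :=
  Measure.pi fun i => volume.restrict (Set.Icc 0 (b i))

/-- The plate mode `e^{2πi(k₀x + k₁y)/L} sin(πk₂z/a)`. -/
def modeFun (L a : ℝ) (k : Fin 3 → ℤ) (y : Fin 3 → ℝ) : ℂ :=
  Complex.exp (2 * Real.pi * Complex.I * (k 0 * y 0 + k 1 * y 1) / L) *
    Complex.sin (Real.pi * k 2 * y 2 / a)

/-- The map `y ↦ (c i y i mod 1)` to the torus. -/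
def torusMap (c : Fin 3 → ℝ) (y : Fin 3 → ℝ) : UnitAddTorus (Fin 3) := fun i => ((c i * y i : ℝ) : UnitAddCircle)

lemma measurable_torusMap (c : Fin 3 → ℝ) : Measurable (torusMap c) :=
  measurable_pi_lambda _ fun i => AddCircle.measurable_mk'.comp (by fun_prop)

lemma restrict_preimage_mul {c : ℝ} (hc : c ≠ 0) (J : Set ℝ)
    {s : Set UnitAddCircle} (hs : MeasurableSet s) :
    (volume.restrict ((c * ·) ⁻¹' J)).map (fun x : ℝ => ((c * x : ℝ) : UnitAddCircle)) s =
      ENNReal.ofReal |c⁻¹| * volume (((↑) : ℝ → UnitAddCircle) ⁻¹' s ∩ J) := by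
  have hm : Measurable (fun x : ℝ => ((c * x : ℝ) : UnitAddCircle)) :=
    AddCircle.measurable_mk'.comp (by fun_prop)
  rw [Measure.map_apply hm hs, Measure.restrict_apply (hm hs), ← Real.volume_preimage_mul_left hc]
  rfl

lemma haar_eq_volume_inter (t : ℝ) {s : Set UnitAddCircle} (hs : MeasurableSet s) :
    volume (((↑) : ℝ → UnitAddCircle) ⁻¹' s ∩ Set.Ioc t (t + 1)) =
      (AddCircle.haarAddCircle : Measure UnitAddCircle) s := by
  have h := (AddCircle.measurePreserving_mk 1 t).measure_preimage hs.nullMeasurableSet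
  rw [Measure.restrict_apply (AddCircle.measurable_mk' hs)] at h
  rw [h, AddCircle.volume_eq_smul_haarAddCircle]
  simp

lemma map_circle_lateral {L : ℝ} (hL : 0 < L) {s : Set UnitAddCircle} (hs : MeasurableSet s) :
    (volume.restrict (Set.Icc 0 L)).map (fun x : ℝ => ((L⁻¹ * x : ℝ) : UnitAddCircle)) s =
      ENNReal.ofReal L * (AddCircle.haarAddCircle : Measure UnitAddCircle) s := by
  have hp : (L⁻¹ * ·) ⁻¹' Set.Ioc (0 : ℝ) (0 + 1) = Set.Ioc 0 L := by
    ext x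
    simp only [Set.mem_preimage, Set.mem_Ioc, zero_add, ← div_eq_inv_mul, div_le_one hL]
    exact and_congr_left' (div_pos_iff_of_pos_right hL)
  rw [← Measure.restrict_congr_set Ioc_ae_eq_Icc, ← hp, restrict_preimage_mul (inv_ne_zero hL.ne') _ hs, haar_eq_volume_inter 0 hs, inv_inv, abs_of_pos hL]

/-- The interval covers half of the circle of length `2a`; its reflection covers the other half up
to a null set. -/
lemma map_circle_transverse {a : ℝ} (ha : 0 < a) {s : Set UnitAddCircle} (hs : MeasurableSet s) :
    (volume.restrict (Set.Icc 0 a)).map (fun x : ℝ => (((2 * a)⁻¹ * x : ℝ) : UnitAddCircle)) s +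
    (volume.restrict (Set.Icc 0 a)).map (fun x : ℝ => ((-(2 * a)⁻¹ * x : ℝ) : UnitAddCircle)) s =
      ENNReal.ofReal (2 * a) * (AddCircle.haarAddCircle : Measure UnitAddCircle) s := by
  have h2a : 0 < 2 * a := by positivity
  have hp : ((2 * a)⁻¹ * ·) ⁻¹' Set.Ioc (0 : ℝ) (1 / 2) = Set.Ioc 0 a := by
    ext x
    simp only [Set.mem_preimage, Set.mem_Ioc, ← div_eq_inv_mul, div_le_div_iff₀ h2a two_pos]
    refine and_congr (div_pos_iff_of_pos_right h2a) ?_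
    constructor <;> intro h <;> linarith
  have hm : (-(2 * a)⁻¹ * ·) ⁻¹' Set.Ico (-(1 / 2) : ℝ) 0 = Set.Ioc 0 a := by
    ext x
    simp only [Set.mem_preimage, Set.mem_Ico, Set.mem_Ioc, neg_mul, ← div_eq_inv_mul,
      neg_le_neg_iff, div_le_div_iff₀ h2a two_pos, neg_lt_zero]
    rw [and_comm]
    refine and_congr (div_pos_iff_of_pos_right h2a) ?_
    constructor <;> intro h <;> linarith
  have e1 := restrict_preimage_mul (inv_ne_zero h2a.ne') (Set.Ioc 0 (1 / 2)) hs
  have e2 := restrict_preimage_mul (neg_ne_zero.2 (inv_ne_zero h2a.ne'))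
    (Set.Ico (-(1 / 2)) 0) hs
  rw [hp, Measure.restrict_congr_set Ioc_ae_eq_Icc] at e1
  rw [hm, Measure.restrict_congr_set Ioc_ae_eq_Icc] at e2
  rw [e1, e2, inv_neg, abs_neg, inv_inv, abs_of_pos h2a, ← mul_add]
  congr 1
  have hms := AddCircle.measurable_mk' (a := (1 : ℝ)) hs
  have e3 : volume (((↑) : ℝ → UnitAddCircle) ⁻¹' s ∩ Set.Ico (-(1 / 2)) 0) =
      volume (((↑) : ℝ → UnitAddCircle) ⁻¹' s ∩ Set.Ioc (-(1 / 2)) 0) :=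
    measure_congr ((ae_eq_refl _).inter Ico_ae_eq_Ioc)
  rw [e3, ← haar_eq_volume_inter (-(1 / 2)) hs, show (-(1 / 2) + 1 : ℝ) = 1 / 2 by norm_num,
    ← Set.Ioc_union_Ioc_eq_Ioc (by norm_num : (-(1 / 2) : ℝ) ≤ 0) (by norm_num : (0 : ℝ) ≤ 1 / 2),
    Set.inter_union_distrib_left, measure_union, add_comm]
  · exact (Set.disjoint_left.2 fun x hx hy => not_lt.2 hx.2.2 hy.2.1)
  · exact hms.inter measurableSet_Ioc

/-- The torus is covered by two reflected copies of the box. -/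
lemma haar_torus_eq {L a : ℝ} (hL : 0 < L) (ha : 0 < a) :
    Measure.pi (fun _ : Fin 3 => (AddCircle.haarAddCircle : Measure UnitAddCircle)) =
      ENNReal.ofReal (2 * L ^ 2 * a)⁻¹ •
        ((boxMeasure ![L, L, a]).map (torusMap ![L⁻¹, L⁻¹, (2 * a)⁻¹]) +
          (boxMeasure ![L, L, a]).map (torusMap ![L⁻¹, L⁻¹, -(2 * a)⁻¹])) := by
  refine Measure.pi_eq fun s hs => ?_
  have hmap : ∀ c : Fin 3 → ℝ, (boxMeasure ![L, L, a]).map (torusMap c) (Set.univ.pi s) =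
      ∏ i, (volume.restrict (Set.Icc 0 ((![L, L, a] : Fin 3 → ℝ) i))).map
        (fun x : ℝ => ((c i * x : ℝ) : UnitAddCircle)) (s i) := by
    intro c
    have hm : ∀ i, Measurable (fun x : ℝ => ((c i * x : ℝ) : UnitAddCircle)) := fun i =>
      AddCircle.measurable_mk'.comp (by fun_prop)
    have := Measure.pi_map_pi (μ := fun i => volume.restrict (Set.Icc 0 ((![L, L, a] : Fin 3 → ℝ) i)))
      (f := fun i (x : ℝ) => ((c i * x : ℝ) : UnitAddCircle)) (fun i => (hm i).aemeasurable)
    unfold boxMeasure torusMap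
    rw [this, Measure.pi_pi]
  rw [Measure.smul_apply, Measure.add_apply, hmap, hmap]
  simp only [Fin.prod_univ_three, Matrix.cons_val]
  rw [map_circle_lateral hL (hs 0), map_circle_lateral hL (hs 1), ← mul_add,
    map_circle_transverse ha (hs 2), smul_eq_mul]
  have h : ENNReal.ofReal (2 * L ^ 2 * a)⁻¹ * (ENNReal.ofReal L * ENNReal.ofReal L *
      ENNReal.ofReal (2 * a)) = 1 := by
    rw [← ENNReal.ofReal_mul hL.le, ← ENNReal.ofReal_mul (by positivity),
      ← ENNReal.ofReal_mul (by positivity), ← ENNReal.ofReal_one]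
    congr 1
    field_simp
  calc _ = (ENNReal.ofReal (2 * L ^ 2 * a)⁻¹ * (ENNReal.ofReal L * ENNReal.ofReal L *
      ENNReal.ofReal (2 * a))) * (AddCircle.haarAddCircle (s 0) * AddCircle.haarAddCircle (s 1) *
        AddCircle.haarAddCircle (s 2)) := by ring
    _ = _ := by rw [h, one_mul]

/-- The odd reflection of a function on the box, as a function on the torus. -/
def torusExtend (L a : ℝ) (F : (Fin 3 → ℝ) → ℂ) (t : UnitAddTorus (Fin 3)) : ℂ :=
  let x : ℝ := AddCircle.measurableEquivIoc 1 0 (t 0)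
  let y : ℝ := AddCircle.measurableEquivIoc 1 0 (t 1)
  let z : ℝ := AddCircle.measurableEquivIoc 1 (-(1 / 2)) (t 2)
  if 0 < z then F ![L * x, L * y, 2 * a * z] else -F ![L * x, L * y, -(2 * a * z)]

lemma torusExtend_eq (L a : ℝ) (F : (Fin 3 → ℝ) → ℂ) {t : UnitAddTorus (Fin 3)} {x y z : ℝ}
    (hx : (AddCircle.measurableEquivIoc 1 0 (t 0) : ℝ) = x)
    (hy : (AddCircle.measurableEquivIoc 1 0 (t 1) : ℝ) = y)
    (hz : (AddCircle.measurableEquivIoc 1 (-(1 / 2)) (t 2) : ℝ) = z) :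
    torusExtend L a F t =
      if 0 < z then F ![L * x, L * y, 2 * a * z] else -F ![L * x, L * y, -(2 * a * z)] := by
  subst hx hy hz
  rfl

lemma measurable_torusExtend (L a : ℝ) {F : (Fin 3 → ℝ) → ℂ} (hF : Measurable F) :
    Measurable (torusExtend L a F) := by
  have hr : ∀ (r : ℝ) (i : Fin 3), Measurable fun t : UnitAddTorus (Fin 3) =>
      (AddCircle.measurableEquivIoc 1 r (t i)).1 := fun r i =>
    measurable_subtype_coe.comp ((MeasurableEquiv.measurable _).comp (measurable_pi_apply i))
  have hv : ∀ {u v w : UnitAddTorus (Fin 3) → ℝ}, Measurable u → Measurable v → Measurable w →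
      Measurable fun t => F ![u t, v t, w t] := fun hu hv hw => hF.comp
    (measurable_pi_lambda _ fun i => by fin_cases i <;> assumption)
  unfold torusExtend
  exact Measurable.ite (measurableSet_lt measurable_const (hr _ 2))
    (hv ((hr _ 0).const_mul _) ((hr _ 1).const_mul _) ((hr _ 2).const_mul _))
    (hv ((hr _ 0).const_mul _) ((hr _ 1).const_mul _) ((hr _ 2).const_mul _).neg).neg

lemma measurableEquivIoc_coe {t x : ℝ} (hx : x ∈ Set.Ioc t (t + 1)) :
    (AddCircle.measurableEquivIoc 1 t (x : UnitAddCircle)).1 = x := by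
  exact AddCircle.equivIoc_coe_of_mem (p := (1 : ℝ)) (a := t) hx

/-- The faces are discarded because there the chosen circle representatives need not return the
original coordinates. -/
lemma ae_boxMeasure (b : Fin 3 → ℝ) : ∀ᵐ y ∂boxMeasure b, ∀ i, y i ∈ Set.Ioo 0 (b i) := by
  refine ae_all_iff.2 fun i => ?_
  have h1 : ∀ᵐ y ∂boxMeasure b, y i ≠ 0 := Measure.ae_eval_ne (fun i => volume.restrict (Set.Icc 0 (b i))) i 0
  have h2 : ∀ᵐ y ∂boxMeasure b, y i ≠ b i := Measure.ae_eval_ne (fun i => volume.restrict (Set.Icc 0 (b i))) i (b i)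
  have h3 : ∀ᵐ y ∂boxMeasure b, y ∈ Set.univ.pi fun i => Set.Icc 0 (b i) := by
    unfold boxMeasure
    rw [← Measure.restrict_pi_pi]
    exact ae_restrict_mem (MeasurableSet.univ_pi fun i => measurableSet_Icc)
  filter_upwards [h1, h2, h3] with y h1 h2 h3
  have := h3 i (Set.mem_univ i)
  exact ⟨lt_of_le_of_ne this.1 (Ne.symm h1), lt_of_le_of_ne this.2 h2⟩

lemma torusExtend_torusMap {L a : ℝ} (hL : 0 < L) (ha : 0 < a) (F : (Fin 3 → ℝ) → ℂ) {y : Fin 3 → ℝ}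
    (hy : ∀ i, y i ∈ Set.Ioo 0 ((![L, L, a] : Fin 3 → ℝ) i)) :
    torusExtend L a F (torusMap ![L⁻¹, L⁻¹, (2 * a)⁻¹] y) = F y ∧
    torusExtend L a F (torusMap ![L⁻¹, L⁻¹, -(2 * a)⁻¹] y) = -F y := by
  have h0 := hy 0
  have h1 := hy 1
  have h2 := hy 2
  simp only [Matrix.cons_val] at h0 h1 h2
  have hlat : ∀ x, x ∈ Set.Ioo 0 L → L⁻¹ * x ∈ Set.Ioc (0 : ℝ) (0 + 1) := fun x hx => by
    rw [← div_eq_inv_mul, zero_add]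
    exact ⟨div_pos hx.1 hL, (div_le_one hL).2 hx.2.le⟩
  have hz : 0 < (2 * a)⁻¹ * y 2 ∧ (2 * a)⁻¹ * y 2 < 1 / 2 := by
    rw [← div_eq_inv_mul]
    refine ⟨div_pos h2.1 (by positivity), ?_⟩
    rw [div_lt_div_iff₀ (by positivity) two_pos]
    linarith [h2.2]
  have c0 := measurableEquivIoc_coe (hlat _ h0)
  have c1 := measurableEquivIoc_coe (hlat _ h1)
  have cp := measurableEquivIoc_coe (t := -(1 / 2)) (x := (2 * a)⁻¹ * y 2)
    ⟨by linarith [hz.1], by linarith [hz.2]⟩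
  have cm := measurableEquivIoc_coe (t := -(1 / 2)) (x := -(2 * a)⁻¹ * y 2)
    ⟨by linarith [hz.2], by linarith [hz.1]⟩
  have hvec : (![L * (L⁻¹ * y 0), L * (L⁻¹ * y 1), 2 * a * ((2 * a)⁻¹ * y 2)] : Fin 3 → ℝ) = y := by
    ext i
    fin_cases i <;> simp <;> field_simp
  constructor
  · rw [torusExtend_eq L a F (t := torusMap ![L⁻¹, L⁻¹, (2 * a)⁻¹] y) c0 c1 cp, if_pos hz.1, hvec]
  · rw [torusExtend_eq L a F (t := torusMap ![L⁻¹, L⁻¹, -(2 * a)⁻¹] y) c0 c1 cm,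
      if_neg (by linarith [hz.1]), neg_mul, mul_neg, neg_neg, hvec]

/-- `A` and `B` are the pullbacks to the two reflected copies of the box: equal for even integrands
such as `‖G‖²`, opposite in sign for the odd extension itself. -/
lemma integral_torus {L a : ℝ} (hL : 0 < L) (ha : 0 < a) {E : Type*} [NormedAddCommGroup E]
    [NormedSpace ℝ E] {Φ : UnitAddTorus (Fin 3) → E} (hΦ : StronglyMeasurable Φ)
    {A B : (Fin 3 → ℝ) → E} (hA : Integrable A (boxMeasure ![L, L, a]))
    (hB : Integrable B (boxMeasure ![L, L, a]))
    (hΦA : ∀ᵐ y ∂boxMeasure ![L, L, a], Φ (torusMap ![L⁻¹, L⁻¹, (2 * a)⁻¹] y) = A y)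
    (hΦB : ∀ᵐ y ∂boxMeasure ![L, L, a], Φ (torusMap ![L⁻¹, L⁻¹, -(2 * a)⁻¹] y) = B y) :
    Integrable Φ (Measure.pi fun _ : Fin 3 => (AddCircle.haarAddCircle : Measure UnitAddCircle)) ∧
    ∫ t, Φ t ∂(Measure.pi fun _ : Fin 3 => (AddCircle.haarAddCircle : Measure UnitAddCircle)) =
      (2 * L ^ 2 * a)⁻¹ • ((∫ y, A y ∂boxMeasure ![L, L, a]) + ∫ y, B y ∂boxMeasure ![L, L, a]) := by
  have m1 := measurable_torusMap ![L⁻¹, L⁻¹, (2 * a)⁻¹]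
  have m2 := measurable_torusMap ![L⁻¹, L⁻¹, -(2 * a)⁻¹]
  have i1 : Integrable Φ ((boxMeasure ![L, L, a]).map (torusMap ![L⁻¹, L⁻¹, (2 * a)⁻¹])) :=
    (integrable_map_measure hΦ.aestronglyMeasurable m1.aemeasurable).2
      (hA.congr (hΦA.mono fun y hy => hy.symm))
  have i2 : Integrable Φ ((boxMeasure ![L, L, a]).map (torusMap ![L⁻¹, L⁻¹, -(2 * a)⁻¹])) :=
    (integrable_map_measure hΦ.aestronglyMeasurable m2.aemeasurable).2
      (hB.congr (hΦB.mono fun y hy => hy.symm))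
  rw [haar_torus_eq hL ha]
  refine ⟨(i1.add_measure i2).smul_measure ENNReal.ofReal_ne_top, ?_⟩
  rw [integral_smul_measure, integral_add_measure i1 i2, ENNReal.toReal_ofReal (by positivity),
    integral_map m1.aemeasurable hΦ.aestronglyMeasurable,
    integral_map m2.aemeasurable hΦ.aestronglyMeasurable, integral_congr_ae hΦA,
    integral_congr_ae hΦB]

lemma mFourier_torusMap (k : Fin 3 → ℤ) (c y : Fin 3 → ℝ) :
    UnitAddTorus.mFourier k (torusMap c y) =
      Complex.exp (2 * Real.pi * Complex.I * ∑ i, (k i : ℂ) * ((c i : ℂ) * (y i : ℂ))) := by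
  simp only [UnitAddTorus.mFourier, ContinuousMap.coe_mk, torusMap]
  rw [Finset.mul_sum, Complex.exp_sum]
  refine Finset.prod_congr rfl fun i _ => ?_
  rw [fourier_coe_apply]
  congr 1
  push_cast
  ring

/-- Against an odd function the exponentials at `z` and `-z` are subtracted, which leaves the sine
of the Dirichlet mode. -/
lemma mFourier_sub_mFourier {L a : ℝ} (k : Fin 3 → ℤ) (y : Fin 3 → ℝ) :
    UnitAddTorus.mFourier (-k) (torusMap ![L⁻¹, L⁻¹, (2 * a)⁻¹] y) -
      UnitAddTorus.mFourier (-k) (torusMap ![L⁻¹, L⁻¹, -(2 * a)⁻¹] y) =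
      -2 * Complex.I * starRingEnd ℂ (modeFun L a k y) := by
  have e1 : starRingEnd ℂ (Complex.exp (2 * Real.pi * Complex.I * (k 0 * y 0 + k 1 * y 1) / L)) =
      Complex.exp (-(2 * Real.pi * Complex.I * (k 0 * y 0 + k 1 * y 1) / L)) := by
    rw [← Complex.exp_conj]
    congr 1
    simp only [map_div₀, map_mul, map_add, Complex.conj_I, Complex.conj_ofReal, map_intCast,
      map_ofNat]
    ring
  have e2 : starRingEnd ℂ (Complex.sin (Real.pi * k 2 * y 2 / a)) =
      Complex.sin (Real.pi * k 2 * y 2 / a) := by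
    rw [← Complex.sin_conj]
    simp
  rw [mFourier_torusMap, mFourier_torusMap, modeFun, map_mul, e1, e2, Complex.sin]
  simp only [Fin.sum_univ_three, Matrix.cons_val, Pi.neg_apply]
  set X := 2 * Real.pi * Complex.I * (k 0 * y 0 + k 1 * y 1) / (L : ℂ) with hX
  set Y := (Real.pi : ℂ) * k 2 * y 2 / a with hY
  have e3 : 2 * (Real.pi : ℂ) * Complex.I * (((-k 0 : ℤ) : ℂ) * (((L⁻¹ : ℝ) : ℂ) * y 0) +
      ((-k 1 : ℤ) : ℂ) * (((L⁻¹ : ℝ) : ℂ) * y 1) + ((-k 2 : ℤ) : ℂ) * ((((2 * a)⁻¹ : ℝ) : ℂ) * y 2)) =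
      -X + -Y * Complex.I := by
    rw [hX, hY]; push_cast; rw [mul_inv]; ring
  have e4 : 2 * (Real.pi : ℂ) * Complex.I * (((-k 0 : ℤ) : ℂ) * (((L⁻¹ : ℝ) : ℂ) * y 0) +
      ((-k 1 : ℤ) : ℂ) * (((L⁻¹ : ℝ) : ℂ) * y 1) + ((-k 2 : ℤ) : ℂ) * (((-(2 * a)⁻¹ : ℝ) : ℂ) * y 2)) =
      -X + Y * Complex.I := by
    rw [hX, hY]; push_cast; rw [mul_inv]; ring
  rw [e3, e4, Complex.exp_add, Complex.exp_add]
  linear_combination (Complex.exp (-X) * (Complex.exp (-Y * Complex.I) -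
    Complex.exp (Y * Complex.I))) * Complex.I_sq

section

local instance : MeasureSpace UnitAddCircle := ⟨AddCircle.haarAddCircle⟩

lemma hasSum_sq_integral_mFourier {G : UnitAddTorus (Fin 3) → ℂ}
    (hG : MemLp G 2 (Measure.pi fun _ : Fin 3 => (AddCircle.haarAddCircle : Measure UnitAddCircle))) :
    HasSum (fun k : Fin 3 → ℤ => ‖∫ t, UnitAddTorus.mFourier (-k) t * G t
        ∂(Measure.pi fun _ : Fin 3 => (AddCircle.haarAddCircle : Measure UnitAddCircle))‖ ^ 2)
      (∫ t, ‖G t‖ ^ 2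
        ∂(Measure.pi fun _ : Fin 3 => (AddCircle.haarAddCircle : Measure UnitAddCircle))) := by
  have h := UnitAddTorus.hasSum_sq_mFourierCoeff (hG.toLp G)
  have e : ∀ᵐ t ∂(Measure.pi fun _ : Fin 3 => (AddCircle.haarAddCircle : Measure UnitAddCircle)),
      hG.toLp G t = G t := hG.coeFn_toLp
  convert h using 1
  · ext k
    congr 2
    exact integral_congr_ae (e.mono fun t ht => by simp only [smul_eq_mul, ht])
  · exact integral_congr_ae (e.mono fun t ht => by simp only [ht])

end

lemma measurable_modeFun (L a : ℝ) (k : Fin 3 → ℤ) : Measurable (modeFun L a k) := by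
  unfold modeFun
  fun_prop

/-- Parseval's identity on the box. -/
lemma hasSum_sq_modeFun {L a : ℝ} (hL : 0 < L) (ha : 0 < a) {F : (Fin 3 → ℝ) → ℂ}
    (hF : Measurable F) (hi : MemLp F 2 (boxMeasure ![L, L, a])) :
    HasSum (fun k : Fin 3 → ℤ =>
        ‖∫ y, starRingEnd ℂ (modeFun L a k y) * F y ∂boxMeasure ![L, L, a]‖ ^ 2)
      (L ^ 2 * a * ∫ y, ‖F y‖ ^ 2 ∂boxMeasure ![L, L, a]) := by
  have hfin : IsFiniteMeasure (boxMeasure ![L, L, a]) := by unfold boxMeasure; infer_instance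
  set G := torusExtend L a F with hGdef
  have hGm : Measurable G := measurable_torusExtend L a hF
  have hae := ae_boxMeasure ![L, L, a]
  have hsq : Integrable (fun y => ‖F y‖ ^ 2) (boxMeasure ![L, L, a]) :=
    (memLp_two_iff_integrable_sq_norm hF.aestronglyMeasurable).1 hi
  have hFi : Integrable F (boxMeasure ![L, L, a]) := hi.integrable one_le_two
  obtain ⟨g1, g2⟩ := integral_torus hL ha (Φ := fun t => ‖G t‖ ^ 2)
    (hGm.norm.pow_const 2).stronglyMeasurable hsq hsq
    (hae.mono fun y hy => by simp only [hGdef, (torusExtend_torusMap hL ha F hy).1])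
    (hae.mono fun y hy => by simp only [hGdef, (torusExtend_torusMap hL ha F hy).2, norm_neg])
  have hmem := (memLp_two_iff_integrable_sq_norm hGm.aestronglyMeasurable).2 g1
  have hc : ∀ k : Fin 3 → ℤ, ∫ t, UnitAddTorus.mFourier (-k) t * G t
      ∂(Measure.pi fun _ : Fin 3 => (AddCircle.haarAddCircle : Measure UnitAddCircle)) =
      (2 * L ^ 2 * a)⁻¹ • (-2 * Complex.I *
        ∫ y, starRingEnd ℂ (modeFun L a k y) * F y ∂boxMeasure ![L, L, a]) := by
    intro k
    have hm : ∀ c, Measurable fun y => UnitAddTorus.mFourier (-k) (torusMap c y) := fun c =>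
      (UnitAddTorus.mFourier (-k)).continuous.measurable.comp (measurable_torusMap c)
    have hb : ∀ c y, ‖UnitAddTorus.mFourier (-k) (torusMap c y)‖ ≤ 1 := fun c y =>
      ((UnitAddTorus.mFourier (-k)).norm_coe_le_norm _).trans UnitAddTorus.mFourier_norm.le
    have hI : ∀ c, Integrable (fun y => UnitAddTorus.mFourier (-k) (torusMap c y) * F y)
        (boxMeasure ![L, L, a]) := fun c =>
      hFi.bdd_mul (hm c).aestronglyMeasurable (ae_of_all _ (hb c))
    have h := (integral_torus hL ha (Φ := fun t => UnitAddTorus.mFourier (-k) t * G t)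
      (((UnitAddTorus.mFourier (-k)).continuous.measurable.mul hGm).stronglyMeasurable)
      (hI ![L⁻¹, L⁻¹, (2 * a)⁻¹]) (hI ![L⁻¹, L⁻¹, -(2 * a)⁻¹]).neg
      (hae.mono fun y hy => by simp only [hGdef, (torusExtend_torusMap hL ha F hy).1])
      (hae.mono fun y hy => by
        simp only [Pi.neg_apply, hGdef, (torusExtend_torusMap hL ha F hy).2, mul_neg])).2
    rw [h, ← integral_add (hI _) (hI _).neg, ← integral_const_mul]
    congr 2
    ext y
    rw [← mul_assoc, ← mFourier_sub_mFourier, Pi.neg_apply]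
    ring
  -- Normalisation: torus coefficients have modulus `(L²a)⁻¹` times that of the box coefficients.
  -- The sum runs over all of `ℤ³`, counting `±k 2` separately, hence a total of `L²a` and not
  -- `L²a/2`.
  have h := (hasSum_sq_integral_mFourier hmem).mul_left ((L ^ 2 * a) ^ 2)
  have e1 : ∀ k : Fin 3 → ℤ, (L ^ 2 * a) ^ 2 * ‖∫ t, UnitAddTorus.mFourier (-k) t * G t
      ∂(Measure.pi fun _ : Fin 3 => (AddCircle.haarAddCircle : Measure UnitAddCircle))‖ ^ 2 =
      ‖∫ y, starRingEnd ℂ (modeFun L a k y) * F y ∂boxMeasure ![L, L, a]‖ ^ 2 := by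
    intro k
    rw [hc, norm_smul, norm_mul, norm_mul, norm_neg, Complex.norm_I,
      Real.norm_of_nonneg (by positivity)]
    simp only [Complex.norm_ofNat]
    field_simp
  have e2 : (L ^ 2 * a) ^ 2 * ∫ t, ‖G t‖ ^ 2
      ∂(Measure.pi fun _ : Fin 3 => (AddCircle.haarAddCircle : Measure UnitAddCircle)) =
      L ^ 2 * a * ∫ y, ‖F y‖ ^ 2 ∂boxMeasure ![L, L, a] := by
    rw [g2, smul_eq_mul]
    field_simp
    ring
  rw [e2] at h
  simpa only [e1] using h

/-! ### The spectrum of the plate operator -/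

/-- The linear form `x ↦ ∑ i, c i * x i`. -/
def waveForm (c : Fin 3 → ℂ) : E3 →L[ℝ] ℂ :=
  ∑ i, c i • Complex.ofRealCLM.comp (EuclideanSpace.proj i)

lemma waveForm_apply (c : Fin 3 → ℂ) (x : E3) : waveForm c x = ∑ i, c i * x i := by
  simp [waveForm]

lemma contDiff_exp_waveForm (c : Fin 3 → ℂ) {n : WithTop ℕ∞} :
    ContDiff ℝ n fun x : E3 => Complex.exp (waveForm c x) :=
  Complex.contDiff_exp.comp (waveForm c).contDiff

lemma laplacian_exp_waveForm (c : Fin 3 → ℂ) (x : E3) :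
    Laplacian.laplacian (fun x : E3 => Complex.exp (waveForm c x)) x =
      (∑ i, c i ^ 2) * Complex.exp (waveForm c x) := by
  have h1 : ∀ y, HasFDerivAt (fun x : E3 => Complex.exp (waveForm c x))
      (Complex.exp (waveForm c y) • waveForm c) y := fun y => (waveForm c).hasFDerivAt.cexp
  have h2 : fderiv ℝ (fun x : E3 => Complex.exp (waveForm c x)) =
      fun y => Complex.exp (waveForm c y) • waveForm c := funext fun y => (h1 y).fderiv
  have h3 := ((h1 x).smul_const (waveForm c)).fderiv
  rw [InnerProductSpace.laplacian_eq_iteratedFDeriv_orthonormalBasis _ (EuclideanSpace.basisFun (Fin 3) ℝ)]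
  simp only [iteratedFDeriv_two_apply, h2]
  rw [h3, Finset.sum_mul]
  refine Finset.sum_congr rfl fun i _ => ?_
  have : waveForm c (EuclideanSpace.single i 1) = c i := by
    rw [waveForm_apply, Finset.sum_eq_single i (fun b _ hb => by simp [hb])
      (fun h => absurd (Finset.mem_univ i) h)]
    simp
  simp [this]
  ring

/-- The eigenvalue of the plate mode `k`. -/
def plateEigenvalue (L a : ℝ) (k : Fin 3 → ℤ) : ℝ :=
  (2 * Real.pi * k 0 / L) ^ 2 + (2 * Real.pi * k 1 / L) ^ 2 + (2 * Real.pi * k 2 / (2 * a)) ^ 2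

/-- The plate mode as a function on Euclidean space. -/
def plateMode (L a : ℝ) (k : Fin 3 → ℤ) (x : E3) : ℂ := modeFun L a k fun i => x i

/-- The wave vectors of the two plane waves making up a plate mode. -/
def waveVector (L b : ℝ) (k : Fin 3 → ℤ) : Fin 3 → ℂ :=
  ![2 * Real.pi * Complex.I * k 0 / L, 2 * Real.pi * Complex.I * k 1 / L, Real.pi * Complex.I * k 2 / b]

/-- As a difference of plane waves, the mode has a Laplacian that is read off from the exponentials.
Reflecting in `z` amounts to replacing `a` by `-a` in the wave vector. -/
lemma plateMode_eq (L a : ℝ) (k : Fin 3 → ℤ) :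
    plateMode L a k = (Complex.I / 2) • ((fun x => Complex.exp (waveForm (waveVector L (-a) k) x)) -
      fun x => Complex.exp (waveForm (waveVector L a k) x)) := by
  ext x
  simp only [plateMode, modeFun, Pi.smul_apply, Pi.sub_apply, waveForm_apply, waveVector,
    Fin.sum_univ_three, Matrix.cons_val, smul_eq_mul, Complex.sin, Complex.exp_add]
  rw [show 2 * (Real.pi : ℂ) * Complex.I * (k 0 * x 0 + k 1 * x 1) / L =
      2 * Real.pi * Complex.I * k 0 / L * x 0 + 2 * Real.pi * Complex.I * k 1 / L * x 1 by ring,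
    Complex.exp_add, show -((Real.pi : ℂ) * k 2 * x 2 / a) * Complex.I =
      Real.pi * Complex.I * k 2 / ((-a : ℝ) : ℂ) * x 2 by push_cast; rw [div_neg]; ring,
    show (Real.pi : ℂ) * k 2 * x 2 / a * Complex.I = Real.pi * Complex.I * k 2 / a * x 2 by ring]
  ring

lemma sum_sq_waveVector (L b : ℝ) (k : Fin 3 → ℤ) :
    ∑ i, waveVector L b k i ^ 2 = -(plateEigenvalue L b k : ℂ) := by
  simp only [waveVector, Fin.sum_univ_three, Matrix.cons_val, plateEigenvalue]
  push_cast
  simp only [div_pow, mul_pow, Complex.I_sq]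
  ring

lemma plateEigenvalue_neg (L b : ℝ) (k : Fin 3 → ℤ) :
    plateEigenvalue L (-b) k = plateEigenvalue L b k := by
  simp only [plateEigenvalue, mul_neg, div_neg, neg_sq]

lemma contDiff_plateMode (L a : ℝ) (k : Fin 3 → ℤ) {n : WithTop ℕ∞} :
    ContDiff ℝ n (plateMode L a k) := by
  rw [plateMode_eq]
  exact contDiff_const.mul ((contDiff_exp_waveForm _).sub (contDiff_exp_waveForm _))

lemma laplacian_plateMode (L a : ℝ) (k : Fin 3 → ℤ) (x : E3) :
    Laplacian.laplacian (plateMode L a k) x = -(plateEigenvalue L a k * plateMode L a k x) := by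
  have h1 := fun b => (contDiff_exp_waveForm (waveVector L b k) (n := 2)).contDiffAt (x := x)
  have h := InnerProductSpace.laplacian_smul (Complex.I / 2) ((h1 (-a)).sub (h1 a))
  have e := (h1 (-a)).laplacian_sub (h1 a)
  rw [plateMode_eq]
  refine (h.trans (congrArg _ e)).trans ?_
  rw [laplacian_exp_waveForm, laplacian_exp_waveForm,
    sum_sq_waveVector, sum_sq_waveVector, plateEigenvalue_neg]
  simp only [Pi.smul_apply, Pi.sub_apply, smul_eq_mul]
  ring

/-- This allows the modes as test functions in the weak formulation that defines the plate operator.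
-/
lemma isPlateTest_plateMode {L a : ℝ} (hL : 0 < L) (ha : 0 < a) (k : Fin 3 → ℤ) :
    IsPlateTest L a (plateMode L a k) where
  smooth := contDiff_plateMode L a k
  periodic_zero x := by
    have hL' : (L : ℂ) ≠ 0 := by exact_mod_cast hL.ne'
    have h : 2 * (Real.pi : ℂ) * Complex.I * (k 0 * ((x 0 + L : ℝ) : ℂ) + k 1 * x 1) / L =
        2 * Real.pi * Complex.I * (k 0 * x 0 + k 1 * x 1) / L + k 0 * (2 * Real.pi * Complex.I) := by
      push_cast; field_simp; ring
    simp [plateMode, modeFun]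
    rw [← Complex.ofReal_add, h, Complex.exp_add, Complex.exp_int_mul_two_pi_mul_I, mul_one]
    exact Or.inl rfl
  periodic_one x := by
    have hL' : (L : ℂ) ≠ 0 := by exact_mod_cast hL.ne'
    have h : 2 * (Real.pi : ℂ) * Complex.I * (k 0 * x 0 + k 1 * ((x 1 + L : ℝ) : ℂ)) / L =
        2 * Real.pi * Complex.I * (k 0 * x 0 + k 1 * x 1) / L + k 1 * (2 * Real.pi * Complex.I) := by
      push_cast; field_simp; ring
    simp [plateMode, modeFun]
    rw [← Complex.ofReal_add, h, Complex.exp_add, Complex.exp_int_mul_two_pi_mul_I, mul_one]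
    exact Or.inl rfl
  dirichlet_zero x hx := by simp [plateMode, modeFun, hx]
  dirichlet_a x hx := by
    have ha' : (a : ℂ) ≠ 0 := by exact_mod_cast ha.ne'
    have h : (Real.pi : ℂ) * k 2 * a / a = k 2 * Real.pi := by field_simp
    simp only [plateMode, modeFun, hx, h, Complex.sin_int_mul_pi, mul_zero]

/-- The coefficient of `f` in the plate mode `k`. -/
def modeCoeff {L a : ℝ} (k : Fin 3 → ℤ) (f : PlateSpace L a) : ℂ :=
  ∫ x in plateBox L a, starRingEnd ℂ (plateMode L a k x) * f x

lemma modeCoeff_smul {L a : ℝ} (k : Fin 3 → ℤ) (c : ℂ) (f : PlateSpace L a) :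
    modeCoeff k (c • f) = c * modeCoeff k f := by
  unfold modeCoeff
  rw [← integral_const_mul]
  refine integral_congr_ae ((Lp.coeFn_smul c f).mono fun x hx => ?_)
  simp only [hx, Pi.smul_apply, smul_eq_mul]
  ring

/-- Testing the weak equation with the mode puts the Laplacian on the mode, so no regularity of the
basis vector enters. Consequently a coefficient vanishes unless the two eigenvalues agree. -/
lemma modeCoeff_eigen {L a : ℝ} (hL : 0 < L) (ha : 0 < a) (S : PlateEigenbasis L a) (j : ℕ)
    (k : Fin 3 → ℤ) :
    (plateEigenvalue L a k : ℂ) * modeCoeff k (S.u j) = S.lam j * modeCoeff k (S.u j) := by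
  have h := S.eigen j _ (isPlateTest_plateMode hL ha k)
  rw [← modeCoeff_smul k (S.lam j : ℂ), modeCoeff, modeCoeff, ← h, ← integral_const_mul]
  congr 1
  ext x
  rw [laplacian_plateMode, neg_neg, map_mul, Complex.conj_ofReal, mul_assoc]

lemma measurePreserving_box (b : Fin 3 → ℝ) :
    MeasurePreserving (fun x : E3 => fun i => x i) (volume.restrict (box b)) (boxMeasure b) := by
  unfold boxMeasure
  rw [← Measure.restrict_pi_pi]
  have h : box b = (@WithLp.ofLp 2 (Fin 3 → ℝ)) ⁻¹' (Set.univ.pi fun i => Set.Icc 0 (b i)) := by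
    ext x; simp only [box, Set.mem_ofPred_eq, Set.mem_preimage, Set.mem_pi, Set.mem_univ,
      forall_true_left]
  rw [h]
  exact (PiLp.volume_preserving_ofLp (Fin 3)).restrict_preimage
    (MeasurableSet.univ_pi fun i => measurableSet_Icc)

lemma norm_sq_eq_integral {α : Type*} [MeasurableSpace α] {ν : Measure α} (f : Lp ℂ 2 ν) :
    ∫ x, ‖f x‖ ^ 2 ∂ν = ‖f‖ ^ 2 := by
  have h : ⟪f, f⟫_ℂ = ((∫ x, ‖f x‖ ^ 2 ∂ν : ℝ) : ℂ) := by
    rw [L2.inner_def, ← integral_complex_ofReal]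
    congr 1
    ext x
    rw [inner_self_eq_norm_sq_to_K]
    simp
  rw [inner_self_eq_norm_sq_to_K] at h
  exact (Complex.ofReal_injective ((Complex.ofReal_pow _ 2).trans h)).symm

/-- Parseval's identity for the plate modes. -/
lemma hasSum_sq_modeCoeff {L a : ℝ} (hL : 0 < L) (ha : 0 < a) (f : PlateSpace L a) :
    HasSum (fun k => ‖modeCoeff k f‖ ^ 2) (L ^ 2 * a * ‖f‖ ^ 2) := by
  have hfm := Lp.aestronglyMeasurable f
  -- A measurable representative is needed to transport the class `f` to an honest function of three
  -- coordinates.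
  set g := hfm.mk f with hg
  have hgm : Measurable g := hfm.stronglyMeasurable_mk.measurable
  have hfg : f =ᵐ[volume.restrict (plateBox L a)] g := hfm.ae_eq_mk
  set F : (Fin 3 → ℝ) → ℂ := fun y => g (WithLp.toLp 2 y) with hF
  have hFm : Measurable F := hgm.comp (by fun_prop)
  have hgF : ∀ x : E3, g x = F fun i => x i := fun x => rfl
  have hmp : MeasurePreserving (fun x : E3 => fun i => x i) (volume.restrict (plateBox L a))
      (boxMeasure ![L, L, a]) := by
    rw [plateBox_eq]; exact measurePreserving_box _
  have hmem : MemLp F 2 (boxMeasure ![L, L, a]) := by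
    rw [← hmp.map_eq, memLp_map_measure_iff hFm.aestronglyMeasurable hmp.measurable.aemeasurable]
    exact (memLp_congr_ae hfg).1 (Lp.memLp f)
  have h := hasSum_sq_modeFun hL ha hFm hmem
  have e1 : ∫ y, ‖F y‖ ^ 2 ∂boxMeasure ![L, L, a] = ‖f‖ ^ 2 := by
    rw [← norm_sq_eq_integral, ← hmp.map_eq, integral_map hmp.measurable.aemeasurable
      (hFm.norm.pow_const 2).aestronglyMeasurable]
    exact integral_congr_ae (hfg.mono fun x hx => by simp only [hx, hgF])
  have e2 : ∀ k, ∫ y, starRingEnd ℂ (modeFun L a k y) * F y ∂boxMeasure ![L, L, a] =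
      modeCoeff k f := by
    intro k
    have hm : Measurable fun y => starRingEnd ℂ (modeFun L a k y) * F y :=
      (continuous_star.measurable.comp (measurable_modeFun L a k)).mul hFm
    rw [← hmp.map_eq, integral_map hmp.measurable.aemeasurable hm.aestronglyMeasurable]
    exact integral_congr_ae (hfg.mono fun x hx => by simp only [hx, hgF, plateMode])
  simpa only [e1, e2] using h

lemma integral_sin_mode_sq {a : ℝ} (ha : 0 < a) (k : ℤ) :
    ∫ t in Set.Icc 0 a, Real.sin (Real.pi * k * t / a) ^ 2 = if k = 0 then 0 else a / 2 := by
  split_ifs with hk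
  · simp [hk]
  · have hc : Real.pi * k / a ≠ 0 := by
      have : (k : ℝ) ≠ 0 := by exact_mod_cast hk
      have := Real.pi_pos
      positivity
    have h := intervalIntegral.integral_comp_mul_left (a := 0) (b := a) (fun x => Real.sin x ^ 2) hc
    rw [integral_sin_sq, mul_zero, div_mul_cancel₀ _ ha.ne', mul_comm Real.pi (k : ℝ),
      Real.sin_int_mul_pi, Real.sin_zero] at h
    rw [integral_Icc_eq_integral_Ioc, ← intervalIntegral.integral_of_le ha.le]
    refine Eq.trans (intervalIntegral.integral_congr fun t _ => ?_) (h.trans ?_)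
    · congr 2; ring
    · have : (k : ℝ) ≠ 0 := by exact_mod_cast hk
      have := Real.pi_pos
      simp only [smul_eq_mul]
      field_simp
      ring

lemma norm_sq_plateMode (L a : ℝ) (k : Fin 3 → ℤ) (x : E3) :
    ‖plateMode L a k x‖ ^ 2 = Real.sin (Real.pi * k 2 * x 2 / a) ^ 2 := by
  have h1 : 2 * (Real.pi : ℂ) * Complex.I * (k 0 * x 0 + k 1 * x 1) / L =
      ((2 * Real.pi * (k 0 * x 0 + k 1 * x 1) / L : ℝ) : ℂ) * Complex.I := by push_cast; ring
  have h2 : (Real.pi : ℂ) * k 2 * x 2 / a = ((Real.pi * k 2 * x 2 / a : ℝ) : ℂ) := by push_cast; ring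
  rw [plateMode, modeFun, norm_mul, h1, Complex.norm_exp_ofReal_mul_I, h2, ← Complex.ofReal_sin,
    Complex.norm_real, one_mul, Real.norm_eq_abs, sq_abs]

lemma memLp_plateMode (L a : ℝ) (k : Fin 3 → ℤ) :
    MemLp (plateMode L a k) 2 (volume.restrict (plateBox L a)) := by
  rw [plateBox_eq]
  refine MemLp.of_bound (contDiff_plateMode L a k (n := 0)).continuous.aestronglyMeasurable 1
    (ae_of_all _ fun x => ?_)
  rw [← sq_le_one_iff₀ (norm_nonneg _), norm_sq_plateMode]
  exact Real.sin_sq_le_one _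

/-- The coefficients of a plate mode in an orthonormal basis. -/
lemma hasSum_sq_modeCoeff_basis {L a : ℝ} (hL : 0 < L) (ha : 0 < a)
    (u : HilbertBasis ℕ ℂ (PlateSpace L a)) (k : Fin 3 → ℤ) :
    HasSum (fun j => ‖modeCoeff k (u j)‖ ^ 2) (if k 2 = 0 then 0 else L ^ 2 * a / 2) := by
  set m : PlateSpace L a := (memLp_plateMode L a k).toLp _ with hm
  have hc : ∀ f : PlateSpace L a, modeCoeff k f = ⟪m, f⟫_ℂ := by
    intro f
    rw [modeCoeff, L2.inner_def]
    refine integral_congr_ae ((memLp_plateMode L a k).coeFn_toLp.mono fun x hx => ?_)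
    simp only [hm, hx, RCLike.inner_apply]
    ring
  have hn : ‖m‖ ^ 2 = if k 2 = 0 then 0 else L ^ 2 * a / 2 := by
    rw [← norm_sq_eq_integral]
    have e : ∫ x in plateBox L a, ‖m x‖ ^ 2 =
        ∫ x in box ![L, L, a], ∏ i, (![fun _ => 1, fun _ => 1,
          fun t => Real.sin (Real.pi * k 2 * t / a) ^ 2] : Fin 3 → ℝ → ℝ) i (x i) := by
      rw [← plateBox_eq]
      refine integral_congr_ae ((memLp_plateMode L a k).coeFn_toLp.mono fun x hx => ?_)
      simp only [hm, hx, norm_sq_plateMode, Fin.prod_univ_three, Matrix.cons_val, one_mul]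
    rw [e, setIntegral_box_prod]
    simp only [Fin.prod_univ_three, Matrix.cons_val, integral_sin_mode_sq ha]
    simp only [integral_const, smul_eq_mul, mul_one, measureReal_restrict_apply_univ,
      Real.volume_real_Icc_of_le hL.le]
    split_ifs <;> ring
  have h := u.hasSum_inner_mul_inner m m
  rw [← hn]
  have h2 := (Complex.hasSum_re h)
  have e : (⟪m, m⟫_ℂ).re = ‖m‖ ^ 2 := by
    rw [inner_self_eq_norm_sq_to_K]
    norm_cast
  rw [e] at h2
  refine h2.congr_fun fun j => ?_
  rw [hc, ← inner_conj_symm (u j) m, Complex.mul_conj, Complex.ofReal_re, Complex.normSq_eq_norm_sq]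

/-- Tonelli for double series, arranged so that known column sums give the sum of the row sums. -/
lemma hasSum_swap_of_nonneg {ι κ : Type*} {f : ι → κ → ℝ} {r : ι → ℝ} {c : κ → ℝ} {s : ℝ}
    (hf : ∀ i k, 0 ≤ f i k) (hr : ∀ i, HasSum (f i) (r i)) (hc : ∀ k, HasSum (fun i => f i k) (c k))
    (hs : HasSum c s) : HasSum r s := by
  have h1 : Summable fun x : κ × ι => f x.2 x.1 :=
    (summable_prod_of_nonneg fun x => hf _ _).2
      ⟨fun k => (hc k).summable, hs.summable.congr fun k => (hc k).tsum_eq.symm⟩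
  have h2 := h1.hasSum
  have h3 := h2.prod_fiberwise hc
  have h4 : HasSum (fun x : ι × κ => f x.1 x.2) (∑' x : κ × ι, f x.2 x.1) :=
    (Equiv.prodComm ι κ).hasSum_iff.2 h2
  rw [← hs.unique h3] at h4
  exact h4.prod_fiberwise hr

lemma modeCoeff_ne_zero_imp {L a : ℝ} (hL : 0 < L) (ha : 0 < a) (S : PlateEigenbasis L a) {j : ℕ}
    {k : Fin 3 → ℤ} (h : modeCoeff k (S.u j) ≠ 0) : plateEigenvalue L a k = S.lam j := by
  have := mul_right_cancel₀ h (modeCoeff_eigen hL ha S j k)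
  exact_mod_cast this

/-- A unit vector has a nonzero mode coefficient by Parseval. The modes with `k 2 = 0` vanish, so
its eigenvalue has `k 2 ≠ 0`. The gap keeps `λ⁻¹` bounded, hence the potential of the source square
summable. -/
lemma le_lam {L a : ℝ} (hL : 0 < L) (ha : 0 < a) (S : PlateEigenbasis L a) (j : ℕ) :
    (Real.pi / a) ^ 2 ≤ S.lam j := by
  have h := hasSum_sq_modeCoeff hL ha (S.u j)
  rw [S.u.orthonormal.norm_eq_one] at h
  obtain ⟨k, hk⟩ : ∃ k, modeCoeff k (S.u j) ≠ 0 := by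
    by_contra! h0
    have h1 : HasSum (fun k => ‖modeCoeff k (S.u j)‖ ^ 2) 0 := by simp [h0]
    have := h.unique h1
    have h2 : 0 < L ^ 2 * a * 1 ^ 2 := by positivity
    exact h2.ne' this
  rw [← modeCoeff_ne_zero_imp hL ha S hk]
  have hk2 : k 2 ≠ 0 := by
    intro h0
    have hs := hasSum_sq_modeCoeff_basis hL ha S.u k
    rw [if_pos h0, hasSum_zero_iff_of_nonneg (fun _ => by positivity)] at hs
    have := congrFun hs j
    simp at this
    exact hk this
  have h1 := mul_le_mul_of_nonneg_left (one_le_int_sq hk2) (sq_nonneg (Real.pi / a))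
  have h2 : (2 * Real.pi * k 2 / (2 * a)) ^ 2 = (Real.pi / a) ^ 2 * (k 2 : ℝ) ^ 2 := by
    field_simp
  unfold plateEigenvalue
  rw [h2]
  nlinarith [sq_nonneg (2 * Real.pi * k 0 / L), sq_nonneg (2 * Real.pi * k 1 / L)]

lemma lam_pos {L a : ℝ} (hL : 0 < L) (ha : 0 < a) (S : PlateEigenbasis L a) (j : ℕ) :
    0 < S.lam j :=
  (sq_pos_of_pos (div_pos Real.pi_pos ha)).trans_le (le_lam hL ha S j)

/-- The heat trace of the plate operator, computed in any eigenbasis. -/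
theorem hasSum_exp_lam {L a : ℝ} (hL : 0 < L) (ha : 0 < a) (S : PlateEigenbasis L a) {t : ℝ}
    (ht : 0 < t) : HasSum (fun j => Real.exp (-(t * S.lam j))) (plateTrace L a t) := by
  have hV : 0 < L ^ 2 * a := by positivity
  -- Rows sum over modes for fixed `j`, columns over basis vectors for fixed `k`. Comparing the two
  -- totals matches the spectra without any bookkeeping of multiplicities.
  have hrow : ∀ j, HasSum (fun k => Real.exp (-(t * plateEigenvalue L a k)) *
      ‖modeCoeff k (S.u j)‖ ^ 2) (Real.exp (-(t * S.lam j)) * (L ^ 2 * a)) := by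
    intro j
    have h := (hasSum_sq_modeCoeff hL ha (S.u j)).mul_left (Real.exp (-(t * S.lam j)))
    rw [S.u.orthonormal.norm_eq_one, one_pow, mul_one] at h
    refine h.congr_fun fun k => ?_
    rcases eq_or_ne (modeCoeff k (S.u j)) 0 with h0 | h0
    · simp [h0]
    · rw [modeCoeff_ne_zero_imp hL ha S h0]
  have hcol : ∀ k, HasSum (fun j => Real.exp (-(t * plateEigenvalue L a k)) *
      ‖modeCoeff k (S.u j)‖ ^ 2) (Real.exp (-(t * plateEigenvalue L a k)) *
        if k 2 = 0 then 0 else L ^ 2 * a / 2) := fun k =>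
    (hasSum_sq_modeCoeff_basis hL ha S.u k).mul_left _
  have h0 := hasSum_circleTrace hL ht
  -- Modes with zero transverse number are identically zero, so the `m = 0` term is removed from the
  -- transverse trace.
  have h2 := hasSum_ite_sub_hasSum (hasSum_circleTrace (b := 2 * a) (by positivity) ht) 0
  simp only [Int.cast_zero, mul_zero, zero_div, ne_eq, OfNat.ofNat_ne_zero, not_false_eq_true,
    zero_pow, neg_zero, Real.exp_zero] at h2
  have h3 := (hasSum_pi_three h0 h0 h2 (fun m => by positivity) (fun m => by positivity)
    (fun m => by split_ifs <;> positivity)).mul_right (L ^ 2 * a / 2)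
  have hsum : HasSum (fun k => Real.exp (-(t * plateEigenvalue L a k)) *
        if k 2 = 0 then 0 else L ^ 2 * a / 2) (plateTrace L a t * (L ^ 2 * a)) := by
    have e : plateTrace L a t * (L ^ 2 * a) =
        circleTrace L t * circleTrace L t * (circleTrace (2 * a) t - 1) * (L ^ 2 * a / 2) := by
      rw [plateTrace]; ring
    rw [e]
    refine h3.congr_fun fun k => ?_
    rw [plateEigenvalue, mul_add, mul_add, neg_add, neg_add, Real.exp_add, Real.exp_add]
    split_ifs <;> ring
  have := (hasSum_swap_of_nonneg (fun j k => by positivity) hrow hcol hsum).mul_right (L ^ 2 * a)⁻¹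
  simpa only [mul_assoc, mul_inv_cancel₀ hV.ne', mul_one] using this

/-! ### The expected regulated energy -/

section Basis

variable {E : Type*} [NormedAddCommGroup E] [InnerProductSpace ℂ E]

/-- Square summability makes the series converge; without it `∑'` could take its default value `0`.
-/
lemma hilbertBasis_tsum_smul (u : HilbertBasis ℕ ℂ E) {c : ℕ → ℂ}
    (hc : Summable fun j => ‖c j‖ ^ 2) (j : ℕ) : ⟪u j, ∑' j, c j • u j⟫_ℂ = c j := by
  have hm : Memℓp c 2 := by
    refine memℓp_gen ?_
    simpa using hc
  have h := u.hasSum_repr_symm ⟨c, hm⟩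
  have e : ∑' j, c j • u j = u.repr.symm ⟨c, hm⟩ := h.tsum_eq
  rw [e, ← u.repr_apply_apply, LinearIsometryEquiv.apply_symm_apply]

lemma hilbertBasis_inner_tsum (u : HilbertBasis ℕ ℂ E) {c : ℕ → ℂ}
    (hc : Summable fun j => ‖c j‖ ^ 2) (w : ℕ → ℝ) (hw : Summable fun j => ‖(w j : ℂ) * c j‖ ^ 2) :
    HasSum (fun j => w j * ‖c j‖ ^ 2)
      (⟪∑' j, c j • u j, ∑' j, ((w j : ℂ) * c j) • u j⟫_ℂ).re := by
  have h := Complex.hasSum_re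
    (u.hasSum_inner_mul_inner (∑' j, c j • u j) (∑' j, ((w j : ℂ) * c j) • u j))
  refine h.congr_fun fun j => ?_
  rw [hilbertBasis_tsum_smul u hw, ← inner_conj_symm, hilbertBasis_tsum_smul u hc, mul_left_comm,
    ← Complex.normSq_eq_conj_mul_self, Complex.re_ofReal_mul, Complex.ofReal_re,
    Complex.normSq_eq_norm_sq]

end Basis

section Noise

variable {Ω : Type*} [MeasurableSpace Ω] {P : Measure Ω}

lemma IsWhiteNoise.integral_norm_sq {ξ : ℕ → Ω → ℂ} (h : IsWhiteNoise ξ P) (j : ℕ) :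
    Integrable (fun ω => ‖ξ j ω‖ ^ 2) P ∧ ∫ ω, ‖ξ j ω‖ ^ 2 ∂P = 1 := by
  have hc := h.cov j j
  rw [if_pos rfl] at hc
  have e : ∀ ω, ξ j ω * starRingEnd ℂ (ξ j ω) = ((‖ξ j ω‖ ^ 2 : ℝ) : ℂ) := fun ω => by
    rw [Complex.mul_conj, Complex.normSq_eq_norm_sq]
  simp only [e] at hc
  rw [integral_complex_ofReal] at hc
  have h1 : ∫ ω, ‖ξ j ω‖ ^ 2 ∂P = 1 := by exact_mod_cast hc
  -- Integrability comes from the normalisation: a nonintegrable function would have integral `0`,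
  -- not `1`.
  exact ⟨by_contra fun hn => by simp [integral_undef hn] at h1, h1⟩

/-- Weighted sums of squares of a white noise converge almost surely and in mean. -/
lemma IsWhiteNoise.tsum_mul_norm_sq {ξ : ℕ → Ω → ℂ} (h : IsWhiteNoise ξ P) {w : ℕ → ℝ}
    (hw0 : ∀ j, 0 ≤ w j) (hw : Summable w) :
    (∀ᵐ ω ∂P, Summable fun j => w j * ‖ξ j ω‖ ^ 2) ∧
      Integrable (fun ω => ∑' j, w j * ‖ξ j ω‖ ^ 2) P ∧
      ∫ ω, ∑' j, w j * ‖ξ j ω‖ ^ 2 ∂P = ∑' j, w j := by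
  have hF : ∀ j, Integrable (fun ω => w j * ‖ξ j ω‖ ^ 2) P := fun j =>
    (h.integral_norm_sq j).1.const_mul _
  have hn : ∀ j ω, ‖w j * ‖ξ j ω‖ ^ 2‖ = w j * ‖ξ j ω‖ ^ 2 := fun j ω =>
    Real.norm_of_nonneg (mul_nonneg (hw0 j) (by positivity))
  have hI : ∀ j, ∫ ω, w j * ‖ξ j ω‖ ^ 2 ∂P = w j := fun j => by
    rw [integral_const_mul, (h.integral_norm_sq j).2, mul_one]
  have hs : Summable fun j => ∫ ω, ‖w j * ‖ξ j ω‖ ^ 2‖ ∂P := by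
    simpa only [hn, hI] using hw
  obtain ⟨h1, h2⟩ := integrable_tsum_of_summable_integral_norm hF hs
  refine ⟨by simpa only [hn] using h1, h2, ?_⟩
  rw [← integral_tsum_of_summable_integral_norm hF hs]
  simp only [hI]

end Noise

section Weights

variable {L a : ℝ}

lemma summable_sqrt_lam (hL : 0 < L) (ha : 0 < a) (S : PlateEigenbasis L a) {τ : ℝ} (hτ : 0 < τ) :
    Summable fun j => Real.sqrt (S.lam j) * Real.exp (-(τ * S.lam j)) :=
  Summable.of_nonneg_of_le (fun j => by positivity)
    (fun j => sqrt_mul_exp_le (lam_pos hL ha S j).le hτ)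
    ((hasSum_exp_lam hL ha S (half_pos hτ)).summable.mul_left _)

/-- The squared source coefficients carry the weight `λ^{3/2}`, so this is what puts the source in
`L²` almost surely. It is the cube of `sqrt_mul_exp_le` at time `τ/3`. -/
lemma summable_sqrt_lam_pow_three (hL : 0 < L) (ha : 0 < a) (S : PlateEigenbasis L a) {τ : ℝ}
    (hτ : 0 < τ) : Summable fun j => Real.sqrt (S.lam j) ^ 3 * Real.exp (-(τ * S.lam j)) := by
  refine Summable.of_nonneg_of_le (fun j => by positivity) (fun j => ?_)
    ((hasSum_exp_lam hL ha S (half_pos hτ)).summable.mul_left ((Real.sqrt (τ / 3))⁻¹ ^ 3))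
  have h := pow_le_pow_left₀ (by positivity)
    (sqrt_mul_exp_le (lam_pos hL ha S j).le (by positivity : 0 < τ / 3)) 3
  rw [mul_pow, mul_pow, ← Real.exp_nat_mul, ← Real.exp_nat_mul] at h
  rwa [show ((3 : ℕ) : ℝ) * -(τ / 3 * S.lam j) = -(τ * S.lam j) by push_cast; ring,
    show ((3 : ℕ) : ℝ) * -(τ / 3 / 2 * S.lam j) = -(τ / 2 * S.lam j) by push_cast; ring] at h

/-- The sum over eigenvalues is an integral for counting measure, to which `subord_laplace` applies.
-/
lemma tsum_sqrt_lam (hL : 0 < L) (ha : 0 < a) (S : PlateEigenbasis L a) {τ : ℝ} (hτ : 0 < τ) :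
    ∑' j, Real.sqrt (S.lam j) * Real.exp (-(τ * S.lam j)) = subord (plateTrace L a) τ := by
  have hc : ∀ {f : ℕ → ℝ}, (∀ j, 0 ≤ f j) → Summable f →
      Integrable f Measure.count ∧ ∫ j, f j ∂Measure.count = ∑' j, f j := by
    intro f h0 hf
    have hi : Integrable f Measure.count :=
      integrable_count_iff.2 (hf.congr fun j => (Real.norm_of_nonneg (h0 j)).symm)
    refine ⟨hi, ?_⟩
    rw [integral_countable hi]
    simp
  have h1 := hc (fun j => by positivity) (summable_sqrt_lam hL ha S hτ)
  have h2 := fun t (ht : 0 < t) => hc (fun j => by positivity) (hasSum_exp_lam hL ha S ht).summable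
  have h3 := (subord_laplace (l := S.lam) (measurable_of_countable _)
    (fun j => (lam_pos hL ha S j).le) (h2 τ hτ).1 h1.1).2
  rw [← h1.2, h3]
  exact subord_congr (fun t ht => (h2 t ht).2.trans (hasSum_exp_lam hL ha S ht).tsum_eq) hτ

end Weights

section Energy

variable {Ω : Type*} {L a hbar c g : ℝ}

/-- The interaction energy of one channel in terms of the noise coefficients. -/
lemma inner_source (hL : 0 < L) (ha : 0 < a) (hhbar : 0 < hbar) (hc : 0 < c) (hg : 0 < g)
    (S : PlateEigenbasis L a) {ξ : ℕ → Ω → ℂ} {τ : ℝ} {ω : Ω}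
    (hs : Summable fun j => Real.sqrt (S.lam j) ^ 3 * Real.exp (-(τ * S.lam j)) * ‖ξ j ω‖ ^ 2) :
    (⟪source hbar c g S ξ τ ω,
      S.multiplier (fun l => g * l⁻¹) (source hbar c g S ξ τ ω)⟫_ℂ).re =
      hbar * c * ∑' j, Real.sqrt (S.lam j) * Real.exp (-(τ * S.lam j)) * ‖ξ j ω‖ ^ 2 := by
  set d : ℕ → ℂ := fun j => (((Real.sqrt (hbar * c / g) * S.lam j ^ (3 / 4 : ℝ) *
    Real.exp (-τ * S.lam j / 2) : ℝ) : ℂ) * ξ j ω) with hd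
  have hdn : ∀ j, ‖d j‖ ^ 2 = hbar * c / g *
      (Real.sqrt (S.lam j) ^ 3 * Real.exp (-(τ * S.lam j)) * ‖ξ j ω‖ ^ 2) := by
    intro j
    have h0 := (lam_pos hL ha S j).le
    have h1 : (S.lam j ^ (3 / 4 : ℝ)) ^ 2 = Real.sqrt (S.lam j) ^ 3 := by
      rw [Real.sqrt_eq_rpow, ← Real.rpow_natCast, ← Real.rpow_natCast, ← Real.rpow_mul h0,
        ← Real.rpow_mul h0]
      norm_num
    have h2 : Real.exp (-τ * S.lam j / 2) ^ 2 = Real.exp (-(τ * S.lam j)) := by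
      rw [← Real.exp_nat_mul]; congr 1; push_cast; ring
    rw [hd]
    simp only [norm_mul, mul_pow, Complex.norm_real, Real.norm_eq_abs, sq_abs, h1, h2]
    rw [Real.sq_sqrt (by positivity)]
    ring
  have hds : Summable fun j => ‖d j‖ ^ 2 := by
    simp only [hdn]
    exact hs.mul_left _
  have hsrc : source hbar c g S ξ τ ω = ∑' j, d j • S.u j := rfl
  have hmul : S.multiplier (fun l => g * l⁻¹) (source hbar c g S ξ τ ω) =
      ∑' j, (((g * (S.lam j)⁻¹ : ℝ) : ℂ) * d j) • S.u j := by
    unfold PlateEigenbasis.multiplier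
    simp only [hsrc, hilbertBasis_tsum_smul S.u hds]
  have hws : Summable fun j => ‖((g * (S.lam j)⁻¹ : ℝ) : ℂ) * d j‖ ^ 2 := by
    refine Summable.of_nonneg_of_le (fun j => by positivity) (fun j => ?_)
      (hds.mul_left ((g * ((Real.pi / a) ^ 2)⁻¹) ^ 2))
    have h0 := lam_pos hL ha S j
    have hp : 0 < (Real.pi / a) ^ 2 := sq_pos_of_pos (div_pos Real.pi_pos ha)
    rw [norm_mul, mul_pow, Complex.norm_real, Real.norm_of_nonneg (by positivity)]
    gcongr
    exact le_lam hL ha S j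
  rw [hmul, hsrc, ← (hilbertBasis_inner_tsum S.u hds _ hws).tsum_eq, ← tsum_mul_left]
  refine tsum_congr fun j => ?_
  have h0 := lam_pos hL ha S j
  -- The factor `λ^{3/2} · λ⁻¹` leaves `√λ`, and the coupling `g` cancels.
  have h3 : Real.sqrt (S.lam j) ^ 3 = S.lam j * Real.sqrt (S.lam j) := by
    rw [pow_succ, Real.sq_sqrt h0.le]
  rw [hdn, h3]
  field_simp

variable [MeasurableSpace Ω] {P : Measure Ω}

theorem integral_energy (hL : 0 < L) (ha : 0 < a) (hhbar : 0 < hbar) (hc : 0 < c) (hg : 0 < g)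
    {N : ℕ} (S : PlateEigenbasis L a) {ξ : Fin N → ℕ → Ω → ℂ} (hξ : ∀ i, IsWhiteNoise (ξ i) P)
    {τ : ℝ} (hτ : 0 < τ) :
    Integrable (energy hbar c g S ξ τ) P ∧
      ∫ ω, energy hbar c g S ξ τ ω ∂P = N * (hbar * c / 2 * subord (plateTrace L a) τ) := by
  have h1 := fun i => (hξ i).tsum_mul_norm_sq (fun j => by positivity)
    (summable_sqrt_lam hL ha S hτ)
  have h2 := fun i => ((hξ i).tsum_mul_norm_sq (fun j => by positivity)
    (summable_sqrt_lam_pow_three hL ha S hτ)).1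
  -- The identity holds only almost surely: where the source series diverges, its `∑'` carries no
  -- meaning.
  have hE : energy hbar c g S ξ τ =ᵐ[P] fun ω => ∑ i, 1 / 2 * (hbar * c *
      ∑' j, Real.sqrt (S.lam j) * Real.exp (-(τ * S.lam j)) * ‖ξ i j ω‖ ^ 2) := by
    filter_upwards [ae_all_iff.2 h2] with ω hω
    unfold energy
    exact Finset.sum_congr rfl fun i _ => by rw [inner_source hL ha hhbar hc hg S (hω i)]
  have hi : ∀ i, Integrable (fun ω => 1 / 2 * (hbar * c *
      ∑' j, Real.sqrt (S.lam j) * Real.exp (-(τ * S.lam j)) * ‖ξ i j ω‖ ^ 2)) P := fun i =>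
    ((h1 i).2.1.const_mul _).const_mul _
  refine ⟨(integrable_finsetSum _ fun i _ => hi i).congr hE.symm, ?_⟩
  rw [integral_congr_ae hE, integral_finsetSum _ fun i _ => hi i]
  simp only [integral_const_mul, (h1 _).2.2, tsum_sqrt_lam hL ha S hτ]
  rw [Finset.sum_const, Finset.card_univ, Fintype.card_fin, nsmul_eq_mul]
  ring

end Energy

/-! ### Finite parts -/

lemma tendsto_rpow_neg_mul_log {μ β : ℝ} (hμ : 0 < μ) (hβ : 0 < β) :
    Tendsto (fun τ : ℝ => τ ^ β * Real.log (μ ^ 2 * τ)) (𝓝[>] 0) (𝓝 0) := by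
  have h1 := tendsto_log_mul_rpow_nhdsGT_zero hβ
  have h2 : Tendsto (fun τ : ℝ => τ ^ β) (𝓝[>] 0) (𝓝 0) := by
    have := (Real.continuousAt_rpow_const 0 β (Or.inr hβ.le)).tendsto
    rw [Real.zero_rpow hβ.ne'] at this
    exact this.mono_left nhdsWithin_le_nhds
  have h := (h2.mul_const (Real.log (μ ^ 2))).add h1
  rw [zero_mul, zero_add] at h
  refine h.congr' ?_
  filter_upwards [self_mem_nhdsWithin] with τ hτ
  rw [Real.log_mul (by positivity) (ne_of_gt hτ)]
  ring

/-- A combination of negative powers and a logarithm has no nonzero finite limit at `0⁺`. -/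
lemma limit_eq_zero_of_divergent {μ : ℝ} (hμ : 0 < μ) (D : Finset ℝ) (hD : ∀ β ∈ D, 0 < β)
    (B : ℝ → ℝ) (b l : ℝ)
    (h : Tendsto (fun τ : ℝ => ∑ β ∈ D, B β * τ ^ (-β) + b * Real.log (μ ^ 2 * τ)) (𝓝[>] 0) (𝓝 l)) :
    l = 0 := by
  -- Multiplication by `τ^β` for the largest `β` sends every term but the leading one to `0`, so
  -- that coefficient vanishes. In the base case division by the logarithm plays this role.
  induction D using Finset.induction_on_max with
  | empty =>
    simp only [Finset.sum_empty, zero_add] at h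
    have h1 : Tendsto (fun τ : ℝ => Real.log (μ ^ 2 * τ)) (𝓝[>] 0) atBot := by
      refine (tendsto_atBot_add_const_left _ (Real.log (μ ^ 2)) Real.tendsto_log_nhdsGT_zero).congr' ?_
      filter_upwards [self_mem_nhdsWithin] with τ hτ
      rw [Real.log_mul (by positivity) (ne_of_gt hτ)]
    have h2 := h.mul (tendsto_inv_atBot_zero.comp h1)
    have h3 : Tendsto (fun _ : ℝ => b) (𝓝[>] (0 : ℝ)) (𝓝 (l * 0)) := by
      refine h2.congr' ?_
      filter_upwards [h1.eventually_lt_atBot 0] with τ hτ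
      simp only [Function.comp_apply]
      rw [mul_assoc, mul_inv_cancel₀ hτ.ne, mul_one]
    have hb : b = 0 := by
      rw [mul_zero] at h3
      exact tendsto_nhds_unique tendsto_const_nhds h3
    simp only [hb, zero_mul] at h
    exact (tendsto_nhds_unique tendsto_const_nhds h).symm
  | insert β s hs ih =>
    have hβ : 0 < β := hD β (Finset.mem_insert_self _ _)
    have hn : β ∉ s := fun hm => lt_irrefl _ (hs β hm)
    have hpow : ∀ r : ℝ, 0 < r → Tendsto (fun τ : ℝ => τ ^ r) (𝓝[>] 0) (𝓝 0) := by
      intro r hr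
      have := (Real.continuousAt_rpow_const 0 r (Or.inr hr.le)).tendsto
      rw [Real.zero_rpow hr.ne'] at this
      exact this.mono_left nhdsWithin_le_nhds
    have h1 := (hpow β hβ).mul h
    rw [zero_mul] at h1
    have h2 : Tendsto (fun τ : ℝ => B β + ∑ γ ∈ s, B γ * τ ^ (β - γ) +
        b * (τ ^ β * Real.log (μ ^ 2 * τ))) (𝓝[>] 0) (𝓝 (B β + ∑ γ ∈ s, B γ * 0 + b * 0)) := by
      refine (tendsto_const_nhds.add (tendsto_finsetSum _ fun γ hγ => ?_)).add
        ((tendsto_rpow_neg_mul_log hμ hβ).const_mul b)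
      exact (hpow _ (sub_pos.2 (hs γ hγ))).const_mul _
    have hB : B β = 0 := by
      have := tendsto_nhds_unique (h2.congr' ?_) h1
      · simpa using this
      · filter_upwards [self_mem_nhdsWithin] with τ hτ
        rw [Set.mem_Ioi] at hτ
        rw [Finset.sum_insert hn, mul_add, mul_add, Finset.mul_sum]
        congr 1
        · congr 1
          · rw [mul_left_comm, ← Real.rpow_add hτ]; simp
          · refine Finset.sum_congr rfl fun γ _ => ?_
            rw [mul_left_comm, ← Real.rpow_add hτ, sub_eq_add_neg]
        · ring
    refine ih (fun γ hγ => hD γ (Finset.mem_insert_of_mem hγ)) ?_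
    simpa only [Finset.sum_insert hn, hB, zero_mul, zero_add] using h

/-- The difference of two admissible subtractions, with coefficients extended by zero to the union
of the exponents, is again a divergent combination with a finite limit. -/
lemma IsFinitePart.unique {μ : ℝ} (hμ : 0 < μ) {f : ℝ → ℝ} {c d : ℝ} (hc : IsFinitePart μ f c)
    (hd : IsFinitePart μ f d) : c = d := by
  obtain ⟨D, A, b, hD, h⟩ := hc
  obtain ⟨D', A', b', hD', h'⟩ := hd
  refine sub_eq_zero.1 (limit_eq_zero_of_divergent hμ (D ∪ D') (fun β hβ =>
    (Finset.mem_union.1 hβ).elim (hD β) (hD' β))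
    (fun β => (if β ∈ D' then A' β else 0) - if β ∈ D then A β else 0) (b' - b) _ ?_)
  refine (h.sub h').congr fun τ => ?_
  have e1 : ∑ β ∈ D ∪ D', (if β ∈ D' then A' β else 0) * τ ^ (-β) = ∑ β ∈ D', A' β * τ ^ (-β) := by
    simp only [ite_mul, zero_mul, Finset.sum_ite_mem, Finset.inter_eq_right.2 Finset.subset_union_right]
  have e2 : ∑ β ∈ D ∪ D', (if β ∈ D then A β else 0) * τ ^ (-β) = ∑ β ∈ D, A β * τ ^ (-β) := by
    simp only [ite_mul, zero_mul, Finset.sum_ite_mem, Finset.inter_eq_right.2 Finset.subset_union_left]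
  simp only [sub_mul, Finset.sum_sub_distrib, e1, e2]
  ring

lemma IsFinitePart.finitePart_eq {μ : ℝ} (hμ : 0 < μ) {f : ℝ → ℝ} {c : ℝ}
    (hc : IsFinitePart μ f c) : finitePart μ f = c :=
  IsFinitePart.unique hμ (Classical.epsilon_spec ⟨c, hc⟩) hc

/-! ### The comparison coefficient -/

/-- The bulk and plate momentum integrals are the subordinated diagonal heat kernels. Two plates at
`-1/4` each give the coefficient `-1/2` of the lateral origin term. -/
lemma plateSubtraction_eq (hbar c : ℝ) (N : ℕ) (L a : ℝ) {τ : ℝ} (hτ : 0 < τ) :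
    plateSubtraction hbar c N L a τ = N * (hbar * c / 2) *
      (L ^ 2 * a * subord (heatKernel (3 / 2) 0) τ - L ^ 2 / 2 * subord (heatKernel 1 0) τ) := by
  have h3 := (subord_heatKernel_zero 3 hτ).2
  have h2 := (subord_heatKernel_zero 2 hτ).2
  rw [show ((2 : ℕ) : ℝ) / 2 = 1 by norm_num] at h2
  rw [show ((3 : ℕ) : ℝ) / 2 = 3 / 2 by norm_num] at h3
  rw [plateSubtraction, bulkDensity, plateSelfEnergy, h3, h2]
  ring

section Comparison

variable {Ω : Type*} [MeasurableSpace Ω] {P : Measure Ω} {hbar c g γ Q μ a L α : ℝ} {N : ℕ}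

lemma referenceEnergy_aspectCell (hQ : γ * Q ^ 2 = hbar * c) (ha : 0 < a) :
    referenceEnergy γ Q (aspectCell α) (L / a) a = -(L ^ 2 * (hbar * c) * delta α / a ^ 3) := by
  rw [referenceEnergy_eq γ Q α _ ha, hQ]
  field_simp

lemma integral_ratio (hL : 0 < L) (ha : 0 < a) (hhbar : 0 < hbar) (hc : 0 < c) (hg : 0 < g)
    (S : PlateEigenbasis L a) {ξ : Fin N → ℕ → Ω → ℂ} (hξ : IsChannelNoise ξ P) {τ : ℝ}
    (hτ : 0 < τ) :
    Integrable (ratio hbar c g γ Q S ξ α τ) P ∧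
      ∫ ω, ratio hbar c g γ Q S ξ α τ ω ∂P = N * (hbar * c / 2 * subord (plateTrace L a) τ) /
        referenceEnergy γ Q (aspectCell α) (L / a) a := by
  obtain ⟨h1, h2⟩ := integral_energy hL ha hhbar hc hg S hξ.whiteNoise hτ
  refine ⟨h1.div_const _, ?_⟩
  unfold ratio
  rw [integral_div, h2]

/-- The subtracted expectation of the ratio converges. -/
lemma tendsto_integral_ratio_sub (hL : 0 < L) (ha : 0 < a) (hhbar : 0 < hbar) (hc : 0 < c)
    (hg : 0 < g) (S : PlateEigenbasis L a) {ξ : Fin N → ℕ → Ω → ℂ} (hξ : IsChannelNoise ξ P) :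
    Tendsto (fun τ => (∫ ω, ratio hbar c g γ Q S ξ α τ ω ∂P) -
        plateSubtraction hbar c N L a τ / referenceEnergy γ Q (aspectCell α) (L / a) a) (𝓝[>] 0)
      (𝓝 (N * (hbar * c / 2) * plateFinite L a /
        referenceEnergy γ Q (aspectCell α) (L / a) a)) := by
  refine (((tendsto_subord_plateTrace hL ha).const_mul (N * (hbar * c / 2))).div_const
    (referenceEnergy γ Q (aspectCell α) (L / a) a)).congr' ?_
  filter_upwards [self_mem_nhdsWithin] with τ hτ
  rw [(integral_ratio hL ha hhbar hc hg S hξ hτ).2, plateSubtraction_eq _ _ _ _ _ hτ]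
  ring

/-- The physical subtraction is a combination of `τ^{-2}` (bulk) and `τ^{-3/2}` (plates), with no
logarithm, hence admissible for the minimal finite part. -/
lemma isFinitePart_integral_ratio (hL : 0 < L) (ha : 0 < a) (hhbar : 0 < hbar) (hc : 0 < c)
    (hg : 0 < g) (S : PlateEigenbasis L a) {ξ : Fin N → ℕ → Ω → ℂ} (hξ : IsChannelNoise ξ P) :
    IsFinitePart μ (fun τ => ∫ ω, ratio hbar c g γ Q S ξ α τ ω ∂P)
      (N * (hbar * c / 2) * plateFinite L a / referenceEnergy γ Q (aspectCell α) (L / a) a) := by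
  set U := referenceEnergy γ Q (aspectCell α) (L / a) a with hU
  refine ⟨{2, 3 / 2}, fun β => if β = 2
    then N * (hbar * c / 2) * (L ^ 2 * a * subord (heatKernel (3 / 2) 0) 1) / U
    else -(N * (hbar * c / 2) * (L ^ 2 / 2 * subord (heatKernel 1 0) 1) / U), 0, ?_, ?_⟩
  · intro β hβ
    simp only [Finset.mem_insert, Finset.mem_singleton] at hβ
    rcases hβ with rfl | rfl <;> norm_num
  · refine (tendsto_integral_ratio_sub hL ha hhbar hc hg S hξ).congr' ?_
    filter_upwards [self_mem_nhdsWithin] with τ hτ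
    rw [plateSubtraction_eq _ _ _ _ _ hτ, subord_heatKernel_zero_scaling _ hτ,
      subord_heatKernel_zero_scaling 1 hτ, Finset.sum_pair (by norm_num), if_pos rfl,
      if_neg (by norm_num), show -((3 : ℝ) / 2 + 1 / 2) = -2 by norm_num,
      show -((1 : ℝ) + 1 / 2) = -(3 / 2) by norm_num]
    ring

lemma finitePart_integral_ratio (hμ : 0 < μ) (hL : 0 < L) (ha : 0 < a) (hhbar : 0 < hbar)
    (hc : 0 < c) (hg : 0 < g) (S : PlateEigenbasis L a) {ξ : Fin N → ℕ → Ω → ℂ}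
    (hξ : IsChannelNoise ξ P) :
    (finitePart μ fun τ => ∫ ω, ratio hbar c g γ Q S ξ α τ ω ∂P) =
      N * (hbar * c / 2) * plateFinite L a / referenceEnergy γ Q (aspectCell α) (L / a) a :=
  (isFinitePart_integral_ratio hL ha hhbar hc hg S hξ).finitePart_eq hμ

/-- The area `L²` in the reference energy turns the finite part into one per unit area. The negative
Casimir value over the negative reference energy is positive. -/
lemma tendsto_finitePart (hμ : 0 < μ) (ha : 0 < a) (hhbar : 0 < hbar) (hc : 0 < c) (hg : 0 < g)
    (hQ : γ * Q ^ 2 = hbar * c) (hα : 0 < α) (S : ∀ L : Set.Ioi (0 : ℝ), PlateEigenbasis L a)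
    {ξ : Set.Ioi (0 : ℝ) → Fin N → ℕ → Ω → ℂ} (hξ : ∀ L, IsChannelNoise (ξ L) P) :
    Tendsto (fun L : Set.Ioi (0 : ℝ) => finitePart μ fun τ =>
        ∫ ω, ratio hbar c g γ Q (S L) (ξ L) α τ ω ∂P) atTop
      (𝓝 (N * Real.pi ^ 2 / (1440 * delta α))) := by
  have hd := delta_pos hα
  have h := ((tendsto_comp_val_Ioi_atTop (a := (0 : ℝ))).2 (tendsto_plateFinite_div ha)).const_mul
    (-(N * a ^ 3 / (2 * delta α)))
  have e : -(N * a ^ 3 / (2 * delta α)) * -(Real.pi ^ 2 / (720 * a ^ 3)) =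
      N * Real.pi ^ 2 / (1440 * delta α) := by
    field_simp
    ring
  rw [e] at h
  refine h.congr fun L => ?_
  have hL : (0 : ℝ) < L := L.2
  rw [finitePart_integral_ratio hμ hL ha hhbar hc hg (S L) (hξ L),
    referenceEnergy_aspectCell hQ ha]
  field_simp

lemma comparisonCoeff_eq (hμ : 0 < μ) (ha : 0 < a) (hhbar : 0 < hbar) (hc : 0 < c) (hg : 0 < g)
    (hQ : γ * Q ^ 2 = hbar * c) (hα : 0 < α) (S : ∀ L : Set.Ioi (0 : ℝ), PlateEigenbasis L a)
    {ξ : Set.Ioi (0 : ℝ) → Fin N → ℕ → Ω → ℂ} (hξ : ∀ L, IsChannelNoise (ξ L) P) :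
    comparisonCoeff hbar c g γ Q μ P S ξ α = N * Real.pi ^ 2 / (1440 * delta α) :=
  (tendsto_finitePart hμ ha hhbar hc hg hQ hα S hξ).limUnder_eq

end Comparison

end

end CasimirPlate

/-! ### Assembly of the comparison theorem. -/

theorem mainTheorem6 (hbar c g γ Q μ a : ℝ) (hhbar : 0 < hbar) (hc : 0 < c) (hg : 0 < g)
    (hγ : 0 < γ) (hQ : γ * Q ^ 2 = hbar * c) (hμ : 0 < μ) (ha : 0 < a)
    (N : ℕ) (hN : 1 ≤ N)
    {Ω : Type*} [MeasurableSpace Ω] (P : MeasureTheory.Measure Ω)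
    [MeasureTheory.IsProbabilityMeasure P]
    (S : ∀ L : Set.Ioi (0 : ℝ), CasimirPlate.PlateEigenbasis L a)
    (ξ : Set.Ioi (0 : ℝ) → Fin N → ℕ → Ω → ℂ)
    (hξ : ∀ L, CasimirPlate.IsChannelNoise (ξ L) P) :
    -- the finite part exists on every box and equals the interaction-energy subtraction
    (∀ α : ℝ, 0 < α → ∀ L : Set.Ioi (0 : ℝ),
      (∀ τ : ℝ, 0 < τ → MeasureTheory.Integrable
        (CasimirPlate.ratio hbar c g γ Q (S L) (ξ L) α τ) P) ∧
      CasimirPlate.IsFinitePart μ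
        (fun τ => ∫ ω, CasimirPlate.ratio hbar c g γ Q (S L) (ξ L) α τ ω ∂P)
        (CasimirPlate.finitePart μ
          fun τ => ∫ ω, CasimirPlate.ratio hbar c g γ Q (S L) (ξ L) α τ ω ∂P) ∧
      Filter.Tendsto
        (fun τ => (∫ ω, CasimirPlate.ratio hbar c g γ Q (S L) (ξ L) α τ ω ∂P) -
          CasimirPlate.plateSubtraction hbar c N L a τ /
            CasimirPlate.referenceEnergy γ Q (CasimirPlate.aspectCell α) (L / a) a)
        (nhdsWithin 0 (Set.Ioi 0))
        (nhds (CasimirPlate.finitePart μ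
          fun τ => ∫ ω, CasimirPlate.ratio hbar c g γ Q (S L) (ξ L) α τ ω ∂P))) ∧
    -- the large-area limit exists and has the stated value
    (∀ α : ℝ, 0 < α →
      Filter.Tendsto
        (fun L : Set.Ioi (0 : ℝ) => CasimirPlate.finitePart μ
          fun τ => ∫ ω, CasimirPlate.ratio hbar c g γ Q (S L) (ξ L) α τ ω ∂P)
        Filter.atTop (nhds (CasimirPlate.comparisonCoeff hbar c g γ Q μ P S ξ α)) ∧
      CasimirPlate.comparisonCoeff hbar c g γ Q μ P S ξ α =
        N * Real.pi ^ 2 / (1440 * CasimirPlate.delta α)) ∧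
    -- the cubical minimum
    CasimirPlate.comparisonCoeff hbar c g γ Q μ P S ξ 1 =
      N * Real.pi ^ 2 / (1440 * CasimirPlate.deltaCube) ∧
    (∀ α : ℝ, 0 < α →
      CasimirPlate.comparisonCoeff hbar c g γ Q μ P S ξ 1 ≤
        CasimirPlate.comparisonCoeff hbar c g γ Q μ P S ξ α ∧
      (CasimirPlate.comparisonCoeff hbar c g γ Q μ P S ξ α =
        CasimirPlate.comparisonCoeff hbar c g γ Q μ P S ξ 1 ↔ α = 1)) ∧
    -- two channels
    (N = 2 → CasimirPlate.comparisonCoeff hbar c g γ Q μ P S ξ 1 =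
      Real.pi ^ 2 / (720 * CasimirPlate.deltaCube)) := by
  have hcoef := fun {α : ℝ} (hα : 0 < α) => CasimirPlate.comparisonCoeff_eq hμ ha hhbar hc hg hQ hα S hξ
  have hpi := Real.pi_pos
  have hN0 : (0 : ℝ) < N := by exact_mod_cast hN
  refine ⟨fun α hα L => ⟨fun τ hτ => ?_, ?_, ?_⟩, fun α hα => ⟨?_, hcoef hα⟩, ?_, fun α hα => ?_, ?_⟩
  · exact (CasimirPlate.integral_ratio L.2 ha hhbar hc hg (S L) (hξ L) hτ).1
  · rw [CasimirPlate.finitePart_integral_ratio hμ L.2 ha hhbar hc hg (S L) (hξ L)]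
    exact CasimirPlate.isFinitePart_integral_ratio L.2 ha hhbar hc hg (S L) (hξ L)
  · rw [CasimirPlate.finitePart_integral_ratio hμ L.2 ha hhbar hc hg (S L) (hξ L)]
    exact CasimirPlate.tendsto_integral_ratio_sub L.2 ha hhbar hc hg (S L) (hξ L)
  · rw [hcoef hα]
    exact CasimirPlate.tendsto_finitePart hμ ha hhbar hc hg hQ hα S hξ
  · rw [hcoef one_pos, CasimirPlate.delta_one]
  · have h0 := CasimirPlate.delta_pos hα
    -- The coefficient is inversely proportional to `Δ(α)`, so the strict maximum of the Green
    -- energy at the cube becomes a strict minimum.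
    have hlt : α ≠ 1 → N * Real.pi ^ 2 / (1440 * CasimirPlate.delta 1) <
        N * Real.pi ^ 2 / (1440 * CasimirPlate.delta α) := fun h => by
      have := CasimirPlate.delta_lt_delta_one hα h
      gcongr
    rw [hcoef hα, hcoef one_pos]
    refine ⟨?_, fun h => by_contra fun hne => (hlt hne).ne' h, fun h => by rw [h]⟩
    rcases eq_or_ne α 1 with rfl | h
    · exact le_rfl
    · exact (hlt h).le
  · rintro rfl
    rw [hcoef one_pos, CasimirPlate.delta_one]
    push_cast
    rw [show (1440 : ℝ) * CasimirPlate.deltaCube = 2 * (720 * CasimirPlate.deltaCube) by ring,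
      mul_div_mul_left _ _ two_ne_zero]
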